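/- **Setting.** Let $S$ be a Riemann surface (Hausdorff, second countable, not necessarily compact). A *conformal field theory* on $S$ consists of * a complex vector space $F$ filtered by finite-dimensional subspaces, with a smooth filtration-preserving representation $\rho$ of the group of germs of conformal maps of $(\mathbb C,0)$. A field at $p$, for a Riemannian metric $G$ on $S$, is a pair $(\zeta,v)$ of a conformal coordinate $\zeta$ of $G$ at $p$ and $v\in F$, where $(\zeta,v)\sim(\zeta',\rho(\tau)v)$ if $\zeta'-\zeta'(p)=\tau(\zeta-\zeta(p))$ near $p$; there is an invariant vector $1\in F$, the identity field; * a state: for every smooth metric $G$ and $N\ge 0$ an $N$-point function $\langle v_1(p_1)\cdots v_N(p_N)\rangle_G$ of fields at distinct points, $N$-linear, symmetric, smooth in the positions, and unchanged by insertion of $1$; such that three axioms hold. (1) $N$-point functions are invariant under orientation-preserving diffeomorphisms that preserve the conformal structure near the $p_i$. (2) For every $G$ there is a smooth symmetric tensor $T_{\mu\nu}$ with values in the fields such that, for smooth families of metrics $G_s$ that are constant outside a compact set and of constant conformal class near the $p_i$, the $N$-point functions are differentiable at $s=0$ with derivative $-\frac12\iint(\partial_sG_{\mu\nu})\langle T^{\mu\nu}\cdots\rangle\,d\mathrm{vol}_G$.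 (3) $T_\mu{}^\mu=\frac{c}{24\pi}\mathcal R_G\cdot 1$, with $\mathcal R_G$ the scalar curvature and $c\in\mathbb R$. Let $G$ be a metric on $S$, compatible with the complex structure, of scalar curvature $\mathcal R=0$. Let $\gamma\subset S$ be a smoothly embedded oriented closed curve, $R$ a tubular neighbourhood of $\gamma$, and $A=\partial/\partial z$ a nowhere vanishing holomorphic vector field on $R$ that conserves $G$; thus $G=\varrho|dz|^2$ on $R$ with $\varrho=G(A,A)$ invariant under $z\mapsto z+\epsilon$, $\epsilon$ real. Let $\varphi$ be a holomorphic field, i.e. its $N$-point functions for $G$ depend holomorphically on its position, and write $T_{zz}=\frac14(T_{00}-2iT_{10}-T_{11})$, $T_{\bar z\bar z}=\frac14(T_{00}+2iT_{10}-T_{11})$ for $z=x^0+ix^1$. *Cut and reglue.* Let $W\subset S$ be open with $\overline W\cap\gamma=\emptyset$, $W\cup R=S$ and $S\setminus W$ compact, and let $F:R\to[0,1]$ be smooth with $F=1$ on the part of $R\cap W$ to the left of $\gamma$ and $F=0$ on the part to the right. For small $\epsilon\in\mathbb C$ let $G^\epsilon=G$ on $W$ and $G^\epsilon=\varrho\,|d(z+\epsilon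 F)|^2$ on $S\setminus W$; for real $\epsilon$ (and for complex $\epsilon$ if $\varrho$ is constant) this is the pullback of $G$ under $z\mapsto z+\epsilon F$. **Theorem.** Let $w\in S$ not lie on $\gamma$. Then such $(W,F)$ with $w\in W$ exist. For every such $(W,F)$, $G^\epsilon$ is a smooth metric on $S$ for all small $\epsilon\in\mathbb C$, the function $\epsilon\mapsto\langle\varphi(w)\rangle_{G^\epsilon}$ is real differentiable at $\epsilon=0$, and its derivative with respect to $\epsilon$ (the Wirtinger derivative $\partial/\partial\epsilon$) is $$\left.\frac{\partial}{\partial\epsilon}\right|_{\epsilon=0}\langle\varphi(w)\rangle_{G^\epsilon}=-i\oint_\gamma\langle T_{zz}\,\varphi(w)\rangle_G\,dz .$$ The antiholomorphic contribution has the same form: $\left.\frac{\partial}{\partial\bar\epsilon}\right|_{\epsilon=0}\langle\varphi(w)\rangle_{G^\epsilon}=i\oint_\gamma\langle T_{\bar z\bar z}\,\varphi(w)\rangle_G\,d\bar z$. -/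

import Mathlib

open Complex Set Filter Topology MeasureTheory
open scoped Manifold ContDiff ENNReal

/-!
# Conformal field theories on a surface

Throughout, `S` is a Riemann surface, i.e. a complex manifold modelled on `ℂ`.  Its complex
structure provides the underlying smooth oriented surface; Riemannian metrics on `S` are arbitrary
smooth metrics on that real surface, not necessarily compatible with the complex structure.
-/

/-- A Riemann surface is in particular a smooth real surface. -/
instance realSmoothSurface {S : Type*} [TopologicalSpace S] [ChartedSpace ℂ S]
    [h : IsManifold 𝓘(ℂ, ℂ) ω S] : IsManifold 𝓘(ℝ, ℂ) ∞ S := by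
  apply isManifold_of_contDiffOn
  intro e e' he he'
  have h1 := (h.compatible he he')
  rw [contDiffGroupoid, mem_groupoid_of_pregroupoid] at h1
  have h2 := h1.1
  simp only [contDiffPregroupoid] at h2
  exact (h2.restrict_scalars ℝ).of_le (by simp)

namespace CFT

section Geometry

variable {S : Type*} [TopologicalSpace S] [ChartedSpace ℂ S]

/-- The real tangent plane at `x`.  As a type it is `ℂ`, by means of the preferred chart at `x`; as
the charts are holomorphic, multiplication by `I` on it is the complex structure of `S`. -/
abbrev Tan (x : S) : Type := TangentSpace 𝓘(ℝ, ℂ) x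

/-- The complex number that represents a tangent vector. -/
def toC {x : S} (u : Tan x) : ℂ := u

/-- Multiplication by `I` on the tangent plane (rotation by `+90°` with respect to any compatible
metric). -/
def rot {x : S} (u : Tan x) : Tan x := (I * toC u : ℂ)

/-- A tangent vector, for the complex manifold `S`, as an element of the real tangent plane (the
complex vector field `∂/∂z` becomes the real vector field `∂/∂x⁰`, `z = x⁰ + i x¹`). -/
def real {x : S} (a : TangentSpace 𝓘(ℂ, ℂ) x) : Tan x := a

/-- The basis `∂₀ = 1`, `∂₁ = I` of the tangent plane `ℂ`. -/
def e : Fin 2 → ℂ := ![1, I]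

/-- The same basis, as vectors of `Tan x`. -/
def eTan (x : S) (i : Fin 2) : Tan x := e i

variable (S) in
/-- Smooth Riemannian metrics on the real surface underlying `S`. -/
abbrev Metric [IsManifold 𝓘(ℂ, ℂ) ω S] :=
  Bundle.ContMDiffRiemannianMetric 𝓘(ℝ, ℂ) ∞ ℂ (fun x : S => TangentSpace 𝓘(ℝ, ℂ) x)

/-- The real derivative at `x` of a function `ζ : S → ℂ`. -/
noncomputable def dC (ζ : S → ℂ) (x : S) : Tan x →L[ℝ] ℂ := mfderiv 𝓘(ℝ, ℂ) 𝓘(ℝ, ℂ) ζ x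

/-- The real derivative at `x` of a function `f : S → ℝ`. -/
noncomputable def dR (f : S → ℝ) (x : S) : Tan x →L[ℝ] ℝ := mfderiv 𝓘(ℝ, ℂ) 𝓘(ℝ, ℝ) f x

/-- The Jacobian determinant at `x` of a map between surfaces, with respect to the bases `e`; its
sign says whether the map preserves the orientation. -/
noncomputable def jac {S₁ S₂ : Type*} [TopologicalSpace S₁] [ChartedSpace ℂ S₁]
    [TopologicalSpace S₂] [ChartedSpace ℂ S₂] (f : S₁ → S₂) (x : S₁) : ℝ :=
  ContinuousLinearMap.det (R := ℝ) (M := ℂ) (mfderiv 𝓘(ℝ, ℂ) 𝓘(ℝ, ℂ) f x)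

variable [IsManifold 𝓘(ℂ, ℂ) ω S]

/-- The metric `G` is compatible with the complex structure of `S` (multiplication by `I` is an
isometry of every tangent plane). -/
def IsCompatible (G : Metric S) : Prop :=
  ∀ (x : S) (u v : Tan x), G.inner x (rot u) (rot v) = G.inner x u v

/-- `ζ` is near `p` an oriented conformal coordinate for the metric `G`: it is smooth, preserves the
orientation, and `G = l |dζ|²` with `l > 0`.  (Such coordinates are the local holomorphic
coordinates of the complex structure determined by `G`.) -/
def IsConformalCoord (G : Metric S) (ζ : S → ℂ) (p : S) : Prop :=
  ∀ᶠ q in 𝓝 p, ContMDiffAt 𝓘(ℝ, ℂ) 𝓘(ℝ, ℂ) ∞ ζ q ∧ 0 < jac ζ q ∧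
    ∃ l : ℝ, 0 < l ∧ ∀ u v : Tan q,
      G.inner q u v = l * ((starRingEnd ℂ) (dC ζ q u) * dC ζ q v).re

/-- The vector at `x₀.symm u` with constant coordinates `a` in the preferred chart at `x₀`. -/
noncomputable def chartVec (x₀ : S) (u a : ℂ) : Tan ((chartAt ℂ x₀).symm u) :=
  mfderiv 𝓘(ℝ, ℂ) 𝓘(ℝ, ℂ) (chartAt ℂ x₀).symm u a

/-- The metric `G` at the point with coordinate `u` in the preferred chart at `x₀`, evaluated on the
constant coordinate vectors `a`, `b`. -/
noncomputable def metricComp (G : Metric S) (x₀ : S) (u a b : ℂ) : ℝ :=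
  G.inner ((chartAt ℂ x₀).symm u) (chartVec x₀ u a) (chartVec x₀ u b)

/-- The matrix `G_{μν}` as a function of the coordinate `u` in the preferred chart at `x₀`. -/
noncomputable def gram (G : Metric S) (x₀ : S) (u : ℂ) : Matrix (Fin 2) (Fin 2) ℝ :=
  Matrix.of fun i j => metricComp G x₀ u (e i) (e j)

/-- Partial derivative `∂ᵢ` of a function of the coordinate. -/
noncomputable def pd (i : Fin 2) (f : ℂ → ℝ) (u : ℂ) : ℝ := fderiv ℝ f u (e i)

/-- The Christoffel symbol `Γᵏᵢⱼ` of the Levi-Civita connection in the preferred chart at `x₀`. -/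
noncomputable def christoffel (G : Metric S) (x₀ : S) (k i j : Fin 2) (u : ℂ) : ℝ :=
  (1 / 2) * ∑ l, (gram G x₀ u)⁻¹ k l *
    (pd i (fun y => gram G x₀ y j l) u + pd j (fun y => gram G x₀ y i l) u
      - pd l (fun y => gram G x₀ y i j) u)

/-- The Ricci tensor in the preferred chart at `x₀`. -/
noncomputable def ricci (G : Metric S) (x₀ : S) (k l : Fin 2) (u : ℂ) : ℝ :=
  ∑ m, (pd m (christoffel G x₀ m k l) u - pd l (christoffel G x₀ m k m) u)
    + ∑ m, ∑ n, (christoffel G x₀ m m n u * christoffel G x₀ n k l u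
      - christoffel G x₀ m l n u * christoffel G x₀ n k m u)

/-- The scalar curvature `R = G^{kl} R_{kl}` of `G` at `x` (twice the Gauss curvature). -/
noncomputable def scalarCurvature (G : Metric S) (x : S) : ℝ :=
  ∑ k, ∑ l, (gram G x (chartAt ℂ x x))⁻¹ k l * ricci G x k l (chartAt ℂ x x)

/-- The measure `√(det G_{μν}) dx⁰dx¹` on the domain of the preferred chart at `x₀`, extended by
zero. -/
noncomputable def chartVol [MeasurableSpace S] (G : Metric S) (x₀ : S) : Measure S :=
  Measure.map (chartAt ℂ x₀).symm
    ((volume.restrict (chartAt ℂ x₀).target).withDensity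
      fun u => ENNReal.ofReal (Real.sqrt (gram G x₀ u).det))

/-- The Riemannian area measure of `G`.  It is the least measure that dominates all the measures
`chartVol G x₀`; as those agree on overlaps, it restricts to `chartVol G x₀` on each chart. -/
noncomputable def dvol [MeasurableSpace S] (G : Metric S) : Measure S :=
  ⨆ x₀ : S, chartVol G x₀

/-- A family of metrics that is smooth, jointly in the parameter and the point, for parameters in a
neighbourhood of `0`. -/
def SmoothFamily {E : Type*} [NormedAddCommGroup E] [NormedSpace ℝ E] (g : E → Metric S) : Prop :=
  ∃ V : Set E, IsOpen V ∧ (0 : E) ∈ V ∧ ∀ (x₀ : S) (a b : ℂ),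
    ContDiffOn ℝ ∞ (fun q : E × ℂ => metricComp (g q.1) x₀ q.2 a b)
      (V ×ˢ (chartAt ℂ x₀).target)

/-- The derivative of a family of metrics at parameter `0` in the direction `s`, at the point `x`. -/
noncomputable def dMetric {E : Type*} [NormedAddCommGroup E] [NormedSpace ℝ E] (g : E → Metric S)
    (s : E) (x : S) (u v : Tan x) : ℝ :=
  fderiv ℝ (fun r : E => (g r).inner x u v) 0 s

/-- The contraction `T^{μν} h_{μν}`, indices being raised with `G`, of a bilinear form `t = T_{μν}`
with values in a complex vector space and a real bilinear form `h` on the tangent plane at `x`. -/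
noncomputable def contract {F : Type*} [AddCommGroup F] [Module ℂ F] (G : Metric S) (x : S)
    (t : Tan x →ₗ[ℝ] Tan x →ₗ[ℝ] F) (h : Tan x → Tan x → ℝ) : F :=
  let g : Matrix (Fin 2) (Fin 2) ℝ := Matrix.of fun i j => G.inner x (eTan x i) (eTan x j)
  ∑ m, ∑ n, ∑ k, ∑ l,
    ((g⁻¹ m k * g⁻¹ n l * h (eTan x m) (eTan x n) : ℝ) : ℂ) • t (eTan x k) (eTan x l)

end Geometry

/-- `g` represents a germ of a conformal map fixing `0`. -/
def IsConformalGerm (g : ℂ → ℂ) : Prop := AnalyticAt ℂ g 0 ∧ g 0 = 0 ∧ deriv g 0 ≠ 0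

/-- The data of an `F`-bundle functor: the fibre `F`, a quasi-finite complex vector space, with a
smooth representation `ρ` on `F` of the group of germs of conformal maps fixing `0`; here `ρ` is
written as a function of representatives of germs.  An element of the fibre at `p` of the bundle
over a Riemann surface is given by a local holomorphic coordinate `ζ` at `p` and a vector `v : F`
(the field `v_ζ(p)`); with `τ` the germ at `0` that expresses `ζ' - ζ'(p)` through `ζ - ζ(p)`, the
pairs `(ζ, v)` and `(ζ', ρ(τ) v)` represent the same element. -/
structure FieldBundle (F : Type*) [AddCommGroup F] [Module ℂ F] where
  /-- the filtration of `F` -/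
  fil : ℕ → Submodule ℂ F
  fil_mono : Monotone fil
  fil_finite : ∀ n, FiniteDimensional ℂ (fil n)
  fil_top : ∀ v : F, ∃ n, v ∈ fil n
  /-- the representation of the group of conformal germs -/
  ρ : (ℂ → ℂ) → F →ₗ[ℂ] F
  ρ_germ : ∀ g h, IsConformalGerm g → g =ᶠ[𝓝 0] h → ρ g = ρ h
  ρ_id : ρ id = LinearMap.id
  ρ_comp : ∀ g h, IsConformalGerm g → IsConformalGerm h → ρ (g ∘ h) = ρ g ∘ₗ ρ h
  ρ_fil : ∀ g, IsConformalGerm g → ∀ n, ∀ v ∈ fil n, ρ g v ∈ fil n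
  ρ_smooth : ∀ (k : ℕ) (g : (Fin k → ℝ) → ℂ → ℂ) (U : Set ((Fin k → ℝ) × ℂ)), IsOpen U →
    (0, 0) ∈ U → ContDiffOn ℝ ∞ (fun q : (Fin k → ℝ) × ℂ => g q.1 q.2) U →
    (∀ s, IsConformalGerm (g s)) → (∀ q ∈ U, DifferentiableAt ℂ (g q.1) q.2) →
    ∀ (v : F) (f : Module.Dual ℂ F), ContDiffAt ℝ ∞ (fun s => f (ρ (g s) v)) 0
  /-- the identity field -/
  one : F
  ρ_one : ∀ g, IsConformalGerm g → ρ g one = one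

section Theory

variable (S : Type*) [TopologicalSpace S] [ChartedSpace ℂ S] [IsManifold 𝓘(ℂ, ℂ) ω S]

variable {S} in
/-- `N` distinct points with a conformal coordinate for `G` at each of them. -/
def IsConfig (G : Metric S) {N : ℕ} (p : Fin N → S) (ζ : Fin N → S → ℂ) : Prop :=
  Function.Injective p ∧ ∀ i, IsConformalCoord G (ζ i) (p i)

/-- A state on the surface `S`: a family of `N`-point functions
`⟨v₁(p₁) ⋯ v_N(p_N)⟩_G = corr G N p ζ v`, where the field at `pᵢ` is given by the vector `vᵢ` in the
conformal coordinate `ζᵢ`.  Only configurations with `IsConfig G p ζ` are meaningful. -/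
structure State {F : Type*} [AddCommGroup F] [Module ℂ F] (B : FieldBundle F) where
  /-- the `N`-point functions, `N`-linear in the fibres -/
  corr : Metric S → (N : ℕ) → (Fin N → S) → (Fin N → S → ℂ) →
    MultilinearMap ℂ (fun _ : Fin N => F) ℂ
  /-- the value only depends on the elements of the fibres of the bundle -/
  corr_coord : ∀ (G : Metric S) (N : ℕ) (p : Fin N → S) (ζ ζ' : Fin N → S → ℂ)
    (τ : Fin N → ℂ → ℂ) (v : Fin N → F), IsConfig G p ζ → IsConfig G p ζ' →
    (∀ i, IsConformalGerm (τ i)) →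
    (∀ i, ∀ᶠ q in 𝓝 (p i), ζ' i q - ζ' i (p i) = τ i (ζ i q - ζ i (p i))) →
    corr G N p ζ' (fun i => B.ρ (τ i) (v i)) = corr G N p ζ v
  corr_symm : ∀ (G : Metric S) (N : ℕ) (p : Fin N → S) (ζ : Fin N → S → ℂ) (v : Fin N → F)
    (σ : Equiv.Perm (Fin N)), IsConfig G p ζ →
    corr G N (p ∘ σ) (ζ ∘ σ) (v ∘ σ) = corr G N p ζ v
  /-- smoothness in the positions, away from the partial diagonals -/
  corr_smooth : ∀ (G : Metric S) (N : ℕ) (p : Fin N → S) (ζ : Fin N → S → ℂ) (v : Fin N → F),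
    IsConfig G p ζ →
    ContDiffAt ℝ ∞ (fun u : Fin N → ℂ => corr G N (fun i => (chartAt ℂ (p i)).symm (u i)) ζ v)
      (fun i => chartAt ℂ (p i) (p i))
  /-- inserting the identity field does not change the value -/
  corr_one : ∀ (G : Metric S) (N : ℕ) (p : Fin N → S) (ζ : Fin N → S → ℂ) (v : Fin N → F)
    (x : S) (ξ : S → ℂ), IsConfig G (Matrix.vecCons x p) (Matrix.vecCons ξ ζ) →
    corr G (N + 1) (Matrix.vecCons x p) (Matrix.vecCons ξ ζ) (Matrix.vecCons B.one v)
      = corr G N p ζ v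

/-- A conformal field theory on the surface `S`: a bundle functor and a state that satisfy the three
axioms, invariance under diffeomorphisms, existence of the energy-momentum tensor (the derivative
of the `N`-point functions with respect to the metric), and the trace anomaly. -/
structure ConformalFieldTheory [MeasurableSpace S] (F : Type*) [AddCommGroup F] [Module ℂ F] where
  bundle : FieldBundle F
  state : State S bundle
  /-- Invariance under orientation preserving diffeomorphisms that preserve the conformal structure
  near the base points.  Here `G'` is the metric transported from `G` by `f`; the field `v_ζ(p)` is
  transported to the field at `f p` with the vector `v` in the coordinate `ζ ∘ f⁻¹`. -/
  diffeo : ∀ (G G' : Metric S) (f : Diffeomorph 𝓘(ℝ, ℂ) 𝓘(ℝ, ℂ) S S ∞) (N : ℕ) (p : Fin N → S)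
    (ζ : Fin N → S → ℂ) (v : Fin N → F),
    (∀ x, 0 < jac f x) →
    (∀ (x : S) (a b : Tan x), G'.inner (f x) (mfderiv 𝓘(ℝ, ℂ) 𝓘(ℝ, ℂ) f x a)
      (mfderiv 𝓘(ℝ, ℂ) 𝓘(ℝ, ℂ) f x b) = G.inner x a b) →
    IsConfig G p ζ → (∀ i, IsConformalCoord G (ζ i ∘ f.symm) (f (p i))) →
    state.corr G' N (f ∘ p) (fun i => ζ i ∘ f.symm) v = state.corr G N p ζ v
  /-- The energy-momentum tensor `T_{μν}` of the metric `G` at the point `x`, with values in the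
  fibre at `x`, written in the conformal coordinate `ζ`. -/
  T : (G : Metric S) → (ζ : S → ℂ) → (x : S) → Tan x →ₗ[ℝ] Tan x →ₗ[ℝ] F
  T_symm : ∀ G ζ x a b, T G ζ x a b = T G ζ x b a
  T_coord : ∀ (G : Metric S) (x : S) (ζ ζ' : S → ℂ) (τ : ℂ → ℂ), IsConformalCoord G ζ x →
    IsConformalCoord G ζ' x → IsConformalGerm τ →
    (∀ᶠ q in 𝓝 x, ζ' q - ζ' x = τ (ζ q - ζ x)) →
    ∀ a b, T G ζ' x a b = bundle.ρ τ (T G ζ x a b)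
  T_fil : ∀ (G : Metric S) (x : S) (ζ : S → ℂ), IsConformalCoord G ζ x →
    ∃ n, ∀ᶠ q in 𝓝 x, ∀ a b : Tan q, T G ζ q a b ∈ bundle.fil n
  T_smooth : ∀ (G : Metric S) (x : S) (ζ : S → ℂ), IsConformalCoord G ζ x →
    ∀ (a b : ℂ) (f : Module.Dual ℂ F), ContDiffAt ℝ ∞
      (fun u => f (T G ζ ((chartAt ℂ x).symm u) (chartVec x u a) (chartVec x u b)))
      (chartAt ℂ x x)
  /-- The variation of the metric: for a smooth family of metrics `g s`, constant outside of a
  compact set and of constant conformal class near the field positions, the derivative of the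
  `N`-point function at `s = 0` is `-1/2 ∬ ∂_s G_{μν} ⟨T^{μν} ⋯⟩ dvol`. -/
  variation : ∀ (E : Type) [NormedAddCommGroup E] [NormedSpace ℝ E] [FiniteDimensional ℝ E]
    (g : E → Metric S) (N : ℕ) (p : Fin N → S) (ζ : Fin N → S → ℂ) (v : Fin N → F)
    (ξ : S → S → ℂ),
    SmoothFamily g → IsConfig (g 0) p ζ → (∀ x, IsConformalCoord (g 0) (ξ x) x) →
    (∃ K : Set S, IsCompact K ∧ ∀ᶠ s in 𝓝 (0 : E), ∀ x ∉ K, ∀ a b : Tan x,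
      (g s).inner x a b = (g 0).inner x a b) →
    (∀ i, ∃ U ∈ 𝓝 (p i), ∀ᶠ s in 𝓝 (0 : E), ∀ x ∈ U, ∃ l : ℝ, 0 < l ∧ ∀ a b : Tan x,
      (g s).inner x a b = l * (g 0).inner x a b) →
    ∃ D : E →L[ℝ] ℂ, HasFDerivAt (fun s => state.corr (g s) N p ζ v) D 0 ∧
      ∀ s, D s = ∫ x, state.corr (g 0) (N + 1) (Matrix.vecCons x p) (Matrix.vecCons (ξ x) ζ)
        (Matrix.vecCons
          ((-(1 / 2) : ℂ) • contract (g 0) x (T (g 0) (ξ x) x) (dMetric g s x)) v) ∂(dvol (g 0))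
  /-- the central charge -/
  c : ℝ
  /-- The trace anomaly `T_μ^μ = c/(24π) R · 1`. -/
  trace : ∀ (G : Metric S) (x : S) (ζ : S → ℂ), IsConformalCoord G ζ x →
    contract G x (T G ζ x) (fun a b => G.inner x a b)
      = ((c / (24 * Real.pi) * scalarCurvature G x : ℝ) : ℂ) • bundle.one

end Theory

section Deformation

variable {S : Type*} [TopologicalSpace S] [ChartedSpace ℂ S] [IsManifold 𝓘(ℂ, ℂ) ω S]

/-- `φ` is a holomorphic field for the metric `G`: all `N`-point functions in which it occurs depend
holomorphically on its position, with respect to any conformal coordinate. -/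
def IsHolomorphicField [MeasurableSpace S] {F : Type*} [AddCommGroup F] [Module ℂ F]
    (C : ConformalFieldTheory S F) (G : Metric S) (φ : F) : Prop :=
  ∀ (N : ℕ) (p : Fin N → S) (ζ : Fin N → S → ℂ) (v : Fin N → F) (x : S) (ξ : S → ℂ),
    IsConfig G (Matrix.vecCons x p) (Matrix.vecCons ξ ζ) →
    ∃ h : ℂ → ℂ, AnalyticAt ℂ h (ξ x) ∧ ∀ᶠ y in 𝓝 x,
      C.state.corr G (N + 1) (Matrix.vecCons y p) (Matrix.vecCons ξ ζ) (Matrix.vecCons φ v)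
        = h (ξ y)

/-- The strip `|Im u| < 1`. -/
def strip : Set ℂ := {u | |u.im| < 1}

/-- `Ψ` parametrizes, with period `1`, a tubular neighbourhood `R = Ψ(strip)` of the smoothly
embedded oriented closed curve `γ(t) = Ψ(t)`, `0 ≤ t ≤ 1`: it is a smooth orientation preserving
local diffeomorphism of the strip, injective modulo translation by integers.  The part of `R` on the
left of `γ` is the image of `Im u > 0`, the part on the right that of `Im u < 0`. -/
structure IsTube (Ψ : ℂ → S) : Prop where
  smooth : ContMDiffOn 𝓘(ℝ, ℂ) 𝓘(ℝ, ℂ) ∞ Ψ strip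
  oriented : ∀ u ∈ strip, 0 < jac Ψ u
  inj : ∀ u ∈ strip, ∀ u' ∈ strip, Ψ u = Ψ u' ↔ ∃ n : ℤ, u = u' + n

/-- The tubular neighbourhood `R`. -/
def tube (Ψ : ℂ → S) : Set S := Ψ '' strip

/-- The curve `γ`, as a map of a real parameter of period `1`. -/
def core (Ψ : ℂ → S) (t : ℝ) : S := Ψ (t : ℂ)

/-- The velocity of `γ`, in the tangent plane of `S` at `γ(t)`. -/
noncomputable def coreVel (Ψ : ℂ → S) (t : ℝ) : Tan (core Ψ t) :=
  mfderiv 𝓘(ℝ, ℝ) 𝓘(ℝ, ℂ) (core Ψ) t (1 : ℝ)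

/-- `A` is on `R` a nowhere vanishing holomorphic vector field, `A = ∂/∂z` for local holomorphic
coordinates `z`, that conserves the metric `G`.  As `G = G(A,A) |dz|²`, the latter means that
`G(A,A)` is constant along the real flow `z ↦ z + ε` of `A`. -/
structure IsMetricPreservingField (G : Metric S) (R : Set S)
    (A : (x : S) → TangentSpace 𝓘(ℂ, ℂ) x) : Prop where
  holomorphic : MDifferentiableOn 𝓘(ℂ, ℂ) 𝓘(ℂ, ℂ).tangent
    (fun x => (⟨x, A x⟩ : TangentBundle 𝓘(ℂ, ℂ) S)) R
  ne_zero : ∀ x ∈ R, A x ≠ 0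
  conserves : ∀ x ∈ R, dR (fun y => G.inner y (real (A y)) (real (A y))) x (real (A x)) = 0

/-- The holomorphic one-form `dz` dual to the vector field `A = ∂/∂z`. -/
noncomputable def dz (A : (x : S) → TangentSpace 𝓘(ℂ, ℂ) x) (x : S) (u : Tan x) : ℂ :=
  toC u / toC (real (A x))

/-- The auxiliary data `W`, `F` of the cut and reglue construction: `F = 1` on the left part and
`F = 0` on the right part of `R`, except over the compact subset `Wᶜ` of `R`. -/
structure IsCutoff (Ψ : ℂ → S) (W : Set S) (F : S → ℝ) : Prop where
  isOpen : IsOpen W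
  disjoint : ∀ t : ℝ, core Ψ t ∉ closure W
  cover : W ∪ tube Ψ = univ
  compact : IsCompact Wᶜ
  smooth : ContMDiffOn 𝓘(ℝ, ℂ) 𝓘(ℝ, ℝ) ∞ F (tube Ψ)
  range : ∀ x ∈ tube Ψ, F x ∈ Icc (0 : ℝ) 1
  left : ∀ u ∈ strip, 0 < u.im → Ψ u ∈ W → F (Ψ u) = 1
  right : ∀ u ∈ strip, u.im < 0 → Ψ u ∈ W → F (Ψ u) = 0

/-- `G'` is the metric `G^ε` obtained from `G = ρ |dz|²`, `ρ = G(A,A)`, by the change of coordinates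
`z ↦ z + ε F`: it equals `G` on `W` and `ρ |d(z + ε F)|²` on `Wᶜ`.  For real `ε`, and for complex
`ε` if `ρ` is locally constant, the function `ρ` is invariant under the displacement, and the latter
is the pullback of `G` by `z ↦ z + ε F`. -/
def IsReglued (G : Metric S) (A : (x : S) → TangentSpace 𝓘(ℂ, ℂ) x) (W : Set S) (F : S → ℝ)
    (ε : ℂ) (G' : Metric S) : Prop :=
  (∀ x ∈ W, ∀ u v : Tan x, G'.inner x u v = G.inner x u v) ∧
  ∀ x ∉ W, ∀ u v : Tan x, G'.inner x u v = G.inner x (real (A x)) (real (A x)) *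
    ((starRingEnd ℂ) (dz A x u + ε * (dR F x u : ℝ)) * (dz A x v + ε * (dR F x v : ℝ))).re

variable {F : Type*} [AddCommGroup F] [Module ℂ F]

/-- `T_zz = (T₀₀ - 2i T₁₀ - T₁₁)/4` for the coordinate `z = x⁰ + i x¹` with `∂/∂x⁰ = a`. -/
noncomputable def Tzz {x : S} (t : Tan x →ₗ[ℝ] Tan x →ₗ[ℝ] F) (a : Tan x) : F :=
  (1 / 4 : ℂ) • (t a a - (2 * I) • t (rot a) a - t (rot a) (rot a))

/-- `T_z̄z̄ = (T₀₀ + 2i T₁₀ - T₁₁)/4` for the coordinate `z = x⁰ + i x¹` with `∂/∂x⁰ = a`. -/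
noncomputable def Tzzbar {x : S} (t : Tan x →ₗ[ℝ] Tan x →ₗ[ℝ] F) (a : Tan x) : F :=
  (1 / 4 : ℂ) • (t a a + (2 * I) • t (rot a) a - t (rot a) (rot a))

variable [MeasurableSpace S]

/-- The contour integral `∮_γ ⟨T_zz φ(w)⟩ dz`, where `A = ∂/∂z`.  The field `φ(w)` is taken in the
coordinate `ζ`; the coordinate used to write the field `T_zz` at `γ(t)` does not matter. -/
noncomputable def contourT (C : ConformalFieldTheory S F) (G : Metric S)
    (A : (x : S) → TangentSpace 𝓘(ℂ, ℂ) x) (Ψ : ℂ → S) (φ : F) (w : S) (ζ : S → ℂ) : ℂ :=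
  ∫ t in (0 : ℝ)..1,
    C.state.corr G 2 ![core Ψ t, w] ![chartAt ℂ (core Ψ t), ζ]
      ![Tzz (C.T G (chartAt ℂ (core Ψ t)) (core Ψ t)) (real (A (core Ψ t))), φ]
    * dz A (core Ψ t) (coreVel Ψ t)

/-- The contour integral `∮_γ ⟨T_z̄z̄ φ(w)⟩ dz̄`. -/
noncomputable def contourTbar (C : ConformalFieldTheory S F) (G : Metric S)
    (A : (x : S) → TangentSpace 𝓘(ℂ, ℂ) x) (Ψ : ℂ → S) (φ : F) (w : S) (ζ : S → ℂ) : ℂ :=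
  ∫ t in (0 : ℝ)..1,
    C.state.corr G 2 ![core Ψ t, w] ![chartAt ℂ (core Ψ t), ζ]
      ![Tzzbar (C.T G (chartAt ℂ (core Ψ t)) (core Ψ t)) (real (A (core Ψ t))), φ]
    * (starRingEnd ℂ) (dz A (core Ψ t) (coreVel Ψ t))

end Deformation

end CFT

/-!
# The response of a one-point function to cutting and regluing

The reglued metric `G^ε` is obtained from the compatible metric `G` by composing it, in every tangent
plane over the tube, with `a ↦ a + ε df(a) A`.  It differs from `G` only over a compact set away from
`w`, so the variation axiom applies, and the derivative of `⟨φ(w)⟩` is an area integral of the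
energy-momentum tensor contracted with `∂G^ε`.  Because `G` is flat, the trace of the tensor drops
out, and only the coefficients `⟨T_zz φ(w)⟩` and `⟨T_z̄z̄ φ(w)⟩` contribute, each multiplied by the
antilinear part of `df` (`twoPoint_variation`).  In the coordinates of the tube this makes the
derivative in the direction `s` equal to `i s ∬ df ∧ b + conj (i s ∬ df ∧ b')` with the one-forms
`b = ⟨T_zz φ(w)⟩ dz` and `b' = conj ⟨T_z̄z̄ φ(w)⟩ dz` (`exists_hasFDerivAt_reglued`,
`jac_mul_differential`).

These one-forms are holomorphic away from `w`.  This is the conservation law of the energy-momentum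
tensor, which is derived here from the axioms: let `k` be a function with compact support in a chart
that does not contain `w`; the metrics `θ_s^* G`, with `θ_s (u) = u + k(u) s`, all give the same
one-point function, by diffeomorphism invariance (`corr_pullback`), whereas the variation axiom
expresses its derivative through the integrals of `⟨T_zz φ(w)⟩ ∂̄k` and of the conjugate term.  As `s`
may be any complex number, both integrals vanish (`integral_quadCoord`), and Weyl's lemma shows that
the coefficients are holomorphic (`differentiableAt_quadCoord`).

Hence `b` and `b'` are closed, and `df ∧ b` equals `d((f - 1) b)` on the left half of the tube and
`d(f b)` on the right half.  The functions `f - 1` and `f` vanish on the respective outer parts of the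
tube, also near `w`, so that Stokes' theorem leaves only the integral of `b` over the core curve
(`integral_wedge`).

To compare the area measure, which is defined through the charts, with Lebesgue measure in the
coordinates of the tube, the change of variables formula is proved for arbitrary injective
parametrizations (`integral_dvol_image`).  All metrics in the argument are constructed from families
of bilinear forms that are smooth in charts (`exists_metric`, `smoothFamily_of_smoothFormAt`).
-/

namespace CFT

/-! ### Coordinate changes and differentials -/

section Charts

variable {S : Type*} [TopologicalSpace S] [ChartedSpace ℂ S]

/-- The coordinate change from the preferred chart at `x` to the preferred chart at `y`. -/
noncomputable def coordChange (x y : S) (u : ℂ) : ℂ := chartAt ℂ y ((chartAt ℂ x).symm u)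

/-- The complex derivative at `x` of the preferred chart at `x` with respect to the preferred chart
at `y`.  It is the factor by which a vector given by its coordinates in the chart at `y` has to be
multiplied in order to obtain the complex number that represents it in `Tan x`. -/
noncomputable def frame (y x : S) : ℂ := deriv (coordChange y x) (chartAt ℂ y x)

lemma frame_self (x : S) : frame x x = 1 := by
  have : coordChange x x =ᶠ[𝓝 (chartAt ℂ x x)] id := by
    filter_upwards [(chartAt ℂ x).open_target.mem_nhds (mem_chart_target ℂ x)] with u hu
    simp [coordChange, (chartAt ℂ x).right_inv hu]
  rw [frame, this.deriv_eq, deriv_id]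

variable [IsManifold 𝓘(ℂ, ℂ) ω S]

lemma contDiffAt_coordChange {x y : S} {u : ℂ} (hu : u ∈ (chartAt ℂ x).target)
    (hy : (chartAt ℂ x).symm u ∈ (chartAt ℂ y).source) :
    ContDiffAt ℂ ω (coordChange x y) u := by
  have h1 := HasGroupoid.compatible (G := contDiffGroupoid ω 𝓘(ℂ, ℂ)) (chart_mem_atlas ℂ x)
    (chart_mem_atlas ℂ y)
  rw [contDiffGroupoid, mem_groupoid_of_pregroupoid] at h1
  have h2 := h1.1
  simp only [contDiffPregroupoid] at h2
  refine (h2 u (by simp [hu, hy])).contDiffAt ?_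
  have := ((chartAt ℂ x).symm.trans (chartAt ℂ y)).open_source.mem_nhds
    (show u ∈ _ by simp [hu, hy])
  simpa using this

lemma hasDerivAt_coordChange {x y : S} {u : ℂ} (hu : u ∈ (chartAt ℂ x).target)
    (hy : (chartAt ℂ x).symm u ∈ (chartAt ℂ y).source) :
    HasDerivAt (coordChange x y) (deriv (coordChange x y) u) u :=
  ((contDiffAt_coordChange hu hy).differentiableAt (by simp)).hasDerivAt

lemma mdiffAt_chart (y : S) {x : S} (hx : x ∈ (chartAt ℂ y).source) :
    MDifferentiableAt 𝓘(ℝ, ℂ) 𝓘(ℝ, ℂ) (chartAt ℂ y) x :=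
  mdifferentiableAt_atlas (chart_mem_atlas ℂ y) hx

lemma mdiffAt_chart_symm (y : S) {u : ℂ} (hu : u ∈ (chartAt ℂ y).target) :
    MDifferentiableAt 𝓘(ℝ, ℂ) 𝓘(ℝ, ℂ) (chartAt ℂ y).symm u :=
  mdifferentiableAt_atlas_symm (chart_mem_atlas ℂ y) hu

/-- Change of coordinates for the factors `frame`. -/
lemma frame_mul {y z x : S} (hy : x ∈ (chartAt ℂ y).source) (hz : x ∈ (chartAt ℂ z).source) :
    frame y x = frame z x * deriv (coordChange y z) (chartAt ℂ y x) := by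
  have hu : chartAt ℂ y x ∈ (chartAt ℂ y).target := (chartAt ℂ y).map_source hy
  have h1 := hasDerivAt_coordChange hu (y := z) (by rwa [(chartAt ℂ y).left_inv hy])
  have e1 : coordChange y z (chartAt ℂ y x) = chartAt ℂ z x := by
    simp [coordChange, (chartAt ℂ y).left_inv hy]
  have h2 := hasDerivAt_coordChange (x := z) (y := x) ((chartAt ℂ z).map_source hz)
    (by rw [(chartAt ℂ z).left_inv hz]; exact mem_chart_source ℂ x)
  rw [← e1] at h2
  have h3 := h2.comp _ h1
  rw [e1] at h3
  have h4 : coordChange z x ∘ coordChange y z =ᶠ[𝓝 (chartAt ℂ y x)] coordChange y x := by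
    have : ((chartAt ℂ y).symm ⁻¹' (chartAt ℂ z).source) ∈ 𝓝 (chartAt ℂ y x) := by
      apply ((chartAt ℂ y).continuousAt_symm hu).preimage_mem_nhds
      rw [(chartAt ℂ y).left_inv hy]
      exact (chartAt ℂ z).open_source.mem_nhds hz
    filter_upwards [this] with v hv
    simp [coordChange, (chartAt ℂ z).left_inv hv]
  rw [frame, ← h4.deriv_eq, h3.deriv, frame]

lemma frame_ne_zero {y x : S} (hy : x ∈ (chartAt ℂ y).source) : frame y x ≠ 0 := by
  have := frame_mul (mem_chart_source ℂ x) hy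
  rw [frame_self] at this
  exact left_ne_zero_of_mul (this ▸ one_ne_zero)

lemma deriv_coordChange_ne_zero {y z x : S} (hy : x ∈ (chartAt ℂ y).source)
    (hz : x ∈ (chartAt ℂ z).source) : deriv (coordChange y z) (chartAt ℂ y x) ≠ 0 := by
  have := frame_mul hy hz
  exact right_ne_zero_of_mul (this ▸ frame_ne_zero hy)

/-- The differential of a map from a normed space to the surface, through the chart at `y`. -/
lemma mfderiv_to_surface {E : Type*} [NormedAddCommGroup E] [NormedSpace ℝ E] {Φ : E → S} {u : E}
    (h : MDifferentiableAt 𝓘(ℝ, E) 𝓘(ℝ, ℂ) Φ u) {y : S} (hy : Φ u ∈ (chartAt ℂ y).source) (a : E) :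
    toC (x := Φ u) (mfderiv 𝓘(ℝ, E) 𝓘(ℝ, ℂ) Φ u a)
      = frame y (Φ u) * fderiv ℝ (fun v => chartAt ℂ y (Φ v)) u a := by
  have h0 : ∀ z : S, Φ u ∈ (chartAt ℂ z).source →
      DifferentiableAt ℝ (fun v => chartAt ℂ z (Φ v)) u := by
    intro z hz
    have := (mdiffAt_chart z hz).comp u h
    exact this.differentiableAt
  have h1 : toC (x := Φ u) (mfderiv 𝓘(ℝ, E) 𝓘(ℝ, ℂ) Φ u a)
      = fderiv ℝ (fun v => chartAt ℂ (Φ u) (Φ v)) u a := by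
    have e : (mfderiv 𝓘(ℝ, E) 𝓘(ℝ, ℂ) Φ u : E →L[ℝ] ℂ)
        = fderiv ℝ (fun v => chartAt ℂ (Φ u) (Φ v)) u := by
      refine h.mfderiv.trans ?_
      simp only [writtenInExtChartAt, extChartAt, mfld_simps, fderivWithin_univ]
      rfl
    exact DFunLike.congr_fun e a
  rw [h1]
  have hu := (chartAt ℂ y).map_source hy
  have h2 := hasDerivAt_coordChange hu (y := Φ u)
    (by rw [(chartAt ℂ y).left_inv hy]; exact mem_chart_source ℂ _)
  have h3 := (h2.hasFDerivAt.restrictScalars ℝ).comp u (h0 y hy).hasFDerivAt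
  have h4 : (coordChange y (Φ u)) ∘ (fun v => chartAt ℂ y (Φ v)) =ᶠ[𝓝 u]
      (fun v => chartAt ℂ (Φ u) (Φ v)) := by
    filter_upwards [h.continuousAt.preimage_mem_nhds ((chartAt ℂ y).open_source.mem_nhds hy)]
      with v hv
    simp only [coordChange, Function.comp]
    rw [(chartAt ℂ y).left_inv hv]
  rw [← h4.fderiv_eq, h3.fderiv]
  simp [frame, mul_comm]

/-- The differential of a function on the surface, through the chart at `y`. -/
lemma mfderiv_from_surface {E : Type*} [NormedAddCommGroup E] [NormedSpace ℝ E] {f : S → E} {x : S}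
    (h : MDifferentiableAt 𝓘(ℝ, ℂ) 𝓘(ℝ, E) f x) {y : S} (hy : x ∈ (chartAt ℂ y).source) (a : ℂ) :
    fderiv ℝ (fun v => f ((chartAt ℂ y).symm v)) (chartAt ℂ y x) a
      = (mfderiv 𝓘(ℝ, ℂ) 𝓘(ℝ, E) f x (frame y x * a : ℂ) : E) := by
  have h1 : ∀ b : ℂ, (mfderiv 𝓘(ℝ, ℂ) 𝓘(ℝ, E) f x b : E)
      = fderiv ℝ (fun v => f ((chartAt ℂ x).symm v)) (chartAt ℂ x x) b := by
    intro b
    have e : (mfderiv 𝓘(ℝ, ℂ) 𝓘(ℝ, E) f x : ℂ →L[ℝ] E)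
        = fderiv ℝ (fun v => f ((chartAt ℂ x).symm v)) (chartAt ℂ x x) := by
      refine h.mfderiv.trans ?_
      simp only [writtenInExtChartAt, extChartAt, mfld_simps, fderivWithin_univ]
      rfl
    exact DFunLike.congr_fun e b
  rw [h1]
  have hu := (chartAt ℂ y).map_source hy
  have hx : (chartAt ℂ y).symm (chartAt ℂ y x) ∈ (chartAt ℂ x).source := by
    rw [(chartAt ℂ y).left_inv hy]; exact mem_chart_source ℂ _
  have h2 := hasDerivAt_coordChange hu hx
  have e1 : coordChange y x (chartAt ℂ y x) = chartAt ℂ x x := by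
    simp [coordChange, (chartAt ℂ y).left_inv hy]
  have h0 : DifferentiableAt ℝ (fun v => f ((chartAt ℂ x).symm v)) (coordChange y x (chartAt ℂ y x)) := by
    rw [e1]
    have := MDifferentiableAt.comp (I' := 𝓘(ℝ, ℂ)) (g := f) (chartAt ℂ x x)
      (by rwa [(chartAt ℂ x).left_inv (mem_chart_source ℂ x)])
      (mdiffAt_chart_symm x (mem_chart_target ℂ x))
    exact this.differentiableAt
  have h3 := h0.hasFDerivAt.comp _ (h2.hasFDerivAt.restrictScalars ℝ)
  have h4 : (fun v => f ((chartAt ℂ x).symm v)) ∘ coordChange y x =ᶠ[𝓝 (chartAt ℂ y x)]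
      (fun v => f ((chartAt ℂ y).symm v)) := by
    filter_upwards [((chartAt ℂ y).continuousAt_symm hu).preimage_mem_nhds
      ((chartAt ℂ x).open_source.mem_nhds hx)] with v hv
    simp only [coordChange, Function.comp]
    rw [(chartAt ℂ x).left_inv hv]
  rw [← h4.fderiv_eq, h3.fderiv, e1]
  simp [frame, mul_comm]

lemma toC_chartVec {y : S} {u : ℂ} (hu : u ∈ (chartAt ℂ y).target) (a : ℂ) :
    toC (chartVec y u a) = frame y ((chartAt ℂ y).symm u) * a := by
  rw [chartVec, mfderiv_to_surface (mdiffAt_chart_symm y hu) ((chartAt ℂ y).map_target hu)]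
  congr 1
  have : (fun v => chartAt ℂ y ((chartAt ℂ y).symm v)) =ᶠ[𝓝 u] id := by
    filter_upwards [(chartAt ℂ y).open_target.mem_nhds hu] with v hv
    exact (chartAt ℂ y).right_inv hv
  rw [this.fderiv_eq]; simp

end Charts

/-! ### Bilinear forms and metrics in coordinates -/

section Forms

lemma complex_eq_re_im (a : ℂ) : a = a.re • (1 : ℂ) + a.im • I := by
  apply Complex.ext <;> simp

lemma clm_apply_re_im {V : Type*} [NormedAddCommGroup V] [NormedSpace ℝ V] (L : ℂ →L[ℝ] V) (a : ℂ) :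
    L a = a.re • L 1 + a.im • L I := by
  conv_lhs => rw [complex_eq_re_im a]
  rw [map_add, map_smul, map_smul]

lemma contDiffAt_of_clm_apply {D V : Type*} [NormedAddCommGroup D] [NormedSpace ℝ D]
    [NormedAddCommGroup V] [NormedSpace ℝ V] {n : ℕ∞ω} {f : D → ℂ →L[ℝ] V} {t : D}
    (h : ∀ a, ContDiffAt ℝ n (fun s => f s a) t) : ContDiffAt ℝ n f t := by
  have : f = fun s => ContinuousLinearMap.smulRightL ℝ ℂ V reCLM (f s 1)
      + ContinuousLinearMap.smulRightL ℝ ℂ V imCLM (f s I) := by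
    funext s; ext a
    rw [clm_apply_re_im]
    simp
  rw [this]
  exact ((ContinuousLinearMap.contDiff _).contDiffAt.comp t (h 1)).add
    ((ContinuousLinearMap.contDiff _).contDiffAt.comp t (h I))

variable {S : Type*} [TopologicalSpace S] [ChartedSpace ℂ S]

/-- The family of bilinear forms `B s x` on the tangent planes is, in the preferred chart at `y`,
smooth at `(s, x)`, jointly in the parameter and the point. -/
def SmoothFormAt {E : Type*} [NormedAddCommGroup E] [NormedSpace ℝ E]
    (B : E → S → ℂ →L[ℝ] ℂ →L[ℝ] ℝ) (y : S) (s : E) (x : S) : Prop :=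
  ∀ a b : ℂ, ContDiffAt ℝ ∞ (fun q : E × ℂ => B q.1 ((chartAt ℂ y).symm q.2)
    (frame y ((chartAt ℂ y).symm q.2) * a) (frame y ((chartAt ℂ y).symm q.2) * b))
    (s, chartAt ℂ y x)

section

variable {E : Type*} [NormedAddCommGroup E] [NormedSpace ℝ E]
  {B : E → S → ℂ →L[ℝ] ℂ →L[ℝ] ℝ} {y z x : S} {s : E}

/-- A smooth family of forms, evaluated on smoothly varying vectors. -/
lemma SmoothFormAt.comp {X : Type*} [NormedAddCommGroup X] [NormedSpace ℝ X]
    (h : SmoothFormAt B y s x) {c : X → E × ℂ} {p r : X → ℂ} {t : X} (ht : c t = (s, chartAt ℂ y x))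
    (hc : ContDiffAt ℝ ∞ c t) (hp : ContDiffAt ℝ ∞ p t) (hr : ContDiffAt ℝ ∞ r t) :
    ContDiffAt ℝ ∞ (fun q => B (c q).1 ((chartAt ℂ y).symm (c q).2)
      (frame y ((chartAt ℂ y).symm (c q).2) * p q)
      (frame y ((chartAt ℂ y).symm (c q).2) * r q)) t := by
  have h' : ∀ a b : ℂ, ContDiffAt ℝ ∞ (fun q => B (c q).1 ((chartAt ℂ y).symm (c q).2)
      (frame y ((chartAt ℂ y).symm (c q).2) * a)
      (frame y ((chartAt ℂ y).symm (c q).2) * b)) t := by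
    intro a b
    have := h a b
    rw [← ht] at this
    exact this.comp t hc
  have e : ∀ (β : ℂ →L[ℝ] ℂ →L[ℝ] ℝ) (m a b : ℂ), β (m * a) (m * b) =
      a.re * (b.re * β (m * 1) (m * 1) + b.im * β (m * 1) (m * I))
      + a.im * (b.re * β (m * I) (m * 1) + b.im * β (m * I) (m * I)) := by
    intro β m a b
    have h1 : ∀ c : ℂ, m * c = c.re • (m * 1) + c.im • (m * I) := by
      intro c; conv_lhs => rw [complex_eq_re_im c]
      rw [mul_add, mul_smul_comm, mul_smul_comm]
    rw [h1 a, h1 b]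
    simp only [map_add, map_smul, add_apply, smul_apply, smul_eq_mul]
    ring
  have hre : ∀ {f : X → ℂ}, ContDiffAt ℝ ∞ f t → ContDiffAt ℝ ∞ (fun q => (f q).re) t :=
    fun hf => reCLM.contDiff.contDiffAt.comp t hf
  have him : ∀ {f : X → ℂ}, ContDiffAt ℝ ∞ f t → ContDiffAt ℝ ∞ (fun q => (f q).im) t :=
    fun hf => imCLM.contDiff.contDiffAt.comp t hf
  have key := (((hre hp).mul (((hre hr).mul (h' 1 1)).add ((him hr).mul (h' 1 I)))).add
    ((him hp).mul (((hre hr).mul (h' I 1)).add ((him hr).mul (h' I I)))))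
  refine key.congr_of_eventuallyEq (Eventually.of_forall fun q => ?_)
  exact e _ _ _ _

variable [IsManifold 𝓘(ℂ, ℂ) ω S]

lemma contDiffAt_deriv_coordChange (hy : x ∈ (chartAt ℂ y).source)
    (hz : x ∈ (chartAt ℂ z).source) :
    ContDiffAt ℂ ω (deriv (coordChange y z)) (chartAt ℂ y x) := by
  have := contDiffAt_coordChange ((chartAt ℂ y).map_source hy) (y := z)
    (by rwa [(chartAt ℂ y).left_inv hy])
  exact this.analyticAt.deriv.contDiffAt

/-- Smoothness of a family of forms does not depend on the chart. -/
lemma SmoothFormAt.change (h : SmoothFormAt B y s x) (hy : x ∈ (chartAt ℂ y).source)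
    (hz : x ∈ (chartAt ℂ z).source) : SmoothFormAt B z s x := by
  intro a b
  have hu := (chartAt ℂ z).map_source hz
  have h1 : ContDiffAt ℝ ∞ (coordChange z y) (chartAt ℂ z x) :=
    ((contDiffAt_coordChange hu (y := y) (by rwa [(chartAt ℂ z).left_inv hz])).restrict_scalars
      ℝ).of_le (by simp)
  have h2 : ContDiffAt ℝ ∞ (deriv (coordChange z y)) (chartAt ℂ z x) :=
    ((contDiffAt_deriv_coordChange hz hy).restrict_scalars ℝ).of_le (by simp)
  have hsnd : ContDiffAt ℝ ∞ (Prod.snd : E × ℂ → ℂ) (s, chartAt ℂ z x) := contDiffAt_snd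
  have h1' : ContDiffAt ℝ ∞ (fun q : E × ℂ => coordChange z y q.2) (s, chartAt ℂ z x) :=
    ContDiffAt.comp (g := coordChange z y) (f := Prod.snd) (s, chartAt ℂ z x) h1 hsnd
  have h2' : ContDiffAt ℝ ∞ (fun q : E × ℂ => deriv (coordChange z y) q.2) (s, chartAt ℂ z x) :=
    ContDiffAt.comp (g := deriv (coordChange z y)) (f := Prod.snd)
      (s, chartAt ℂ z x) h2 hsnd
  have key := h.comp (X := E × ℂ) (t := (s, chartAt ℂ z x)) (c := fun q => (q.1, coordChange z y q.2))
    (p := fun q => deriv (coordChange z y) q.2 * a) (r := fun q => deriv (coordChange z y) q.2 * b)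
    (by simp [coordChange, (chartAt ℂ z).left_inv hz])
    (contDiffAt_fst.prodMk h1') (h2'.mul contDiffAt_const) (h2'.mul contDiffAt_const)
  refine key.congr_of_eventuallyEq ?_
  have hn : ∀ᶠ v in 𝓝 (chartAt ℂ z x), v ∈ (chartAt ℂ z).target ∧
      (chartAt ℂ z).symm v ∈ (chartAt ℂ y).source := by
    refine ((chartAt ℂ z).open_target.eventually_mem hu).and ?_
    apply ((chartAt ℂ z).continuousAt_symm hu).preimage_mem_nhds
    rw [(chartAt ℂ z).left_inv hz]
    exact (chartAt ℂ y).open_source.mem_nhds hy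
  have hn' : ∀ᶠ q : E × ℂ in 𝓝 (s, chartAt ℂ z x), q.2 ∈ (chartAt ℂ z).target ∧
      (chartAt ℂ z).symm q.2 ∈ (chartAt ℂ y).source :=
    (continuousAt_snd (p := (s, chartAt ℂ z x))).tendsto.eventually hn
  filter_upwards [hn'] with q hq
  have e1 : (chartAt ℂ y).symm (coordChange z y q.2) = (chartAt ℂ z).symm q.2 := by
    simp [coordChange, (chartAt ℂ y).left_inv hq.2]
  have e2 := frame_mul ((chartAt ℂ z).map_target hq.1) hq.2
  rw [(chartAt ℂ z).right_inv hq.1] at e2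
  simp only [e1, e2, mul_assoc]

/-- The trivialization of the bundle of bilinear forms over the preferred chart at `y`. -/
lemma trivializationAt_form {y x : S} (hx : x ∈ (chartAt ℂ y).source)
    (β : TangentSpace 𝓘(ℝ, ℂ) x →L[ℝ] TangentSpace 𝓘(ℝ, ℂ) x →L[ℝ] ℝ) (a b : ℂ) :
    (trivializationAt (ℂ →L[ℝ] ℂ →L[ℝ] ℝ)
      (fun x : S => TangentSpace 𝓘(ℝ, ℂ) x →L[ℝ] TangentSpace 𝓘(ℝ, ℂ) x →L[ℝ] ℝ) y ⟨x, β⟩).2 a b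
      = β (frame y x * a : ℂ) (frame y x * b : ℂ) := by
  have hf : ∀ c : ℂ, ((tangentBundleCore 𝓘(ℝ, ℂ) S).coordChange (achart ℂ y) (achart ℂ x) x) c
      = frame y x * c := by
    intro c
    have h2 := hasDerivAt_coordChange ((chartAt ℂ y).map_source hx) (y := x)
      (by rw [(chartAt ℂ y).left_inv hx]; exact mem_chart_source ℂ _)
    have h3 := (h2.hasFDerivAt.restrictScalars ℝ).fderiv
    rw [tangentBundleCore_coordChange_achart]
    simp only [extChartAt, mfld_simps, fderivWithin_univ]
    change fderiv ℝ (coordChange y x) (chartAt ℂ y x) c = _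
    rw [h3]
    simp [frame, mul_comm]
  rw [hom_trivializationAt_apply]
  simp only [ContinuousLinearMap.inCoordinates, ContinuousLinearMap.comp_apply]
  rw [Bundle.Trivialization.continuousLinearMapAt_apply, Bundle.Trivialization.linearMapAt_apply,
    if_pos (by simpa using hx), hom_trivializationAt_apply]
  simp only [ContinuousLinearMap.inCoordinates, ContinuousLinearMap.comp_apply]
  have hs : ∀ c : ℂ, (Bundle.Trivialization.symmL ℝ
      (trivializationAt ℂ (TangentSpace 𝓘(ℝ, ℂ)) y) x c : ℂ) = frame y x * c := by
    intro c
    rw [TangentBundle.symmL_trivializationAt_eq_core hx]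
    exact hf c
  refine Eq.trans ?_ (congrArg₂ (fun p r : ℂ => β p r) (hs a) (hs b))
  change (Bundle.Trivialization.continuousLinearMapAt ℝ (Bundle.Trivial.trivialization S ℝ) x) _ = _
  rw [Bundle.Trivial.continuousLinearMapAt_trivialization]
  rfl

/-- Smoothness of a field of bilinear forms, as a section of the bundle, is smoothness of its
coefficients in a chart. -/
lemma contMDiffAt_form_iff (β : (x : S) → Tan x →L[ℝ] Tan x →L[ℝ] ℝ) (x : S) :
    ContMDiffAt 𝓘(ℝ, ℂ) (𝓘(ℝ, ℂ).prod 𝓘(ℝ, ℂ →L[ℝ] ℂ →L[ℝ] ℝ)) ∞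
      (fun b => Bundle.TotalSpace.mk' (ℂ →L[ℝ] ℂ →L[ℝ] ℝ)
        (E := fun x : S => TangentSpace 𝓘(ℝ, ℂ) x →L[ℝ] TangentSpace 𝓘(ℝ, ℂ) x →L[ℝ] ℝ) b (β b)) x ↔
    ∀ a b : ℂ, ContDiffAt ℝ ∞ (fun u => (β ((chartAt ℂ x).symm u)
      (frame x ((chartAt ℂ x).symm u) * a : ℂ) (frame x ((chartAt ℂ x).symm u) * b : ℂ)))
      (chartAt ℂ x x) := by
  have hev : ∀ a b : ℂ, (fun u => (trivializationAt (ℂ →L[ℝ] ℂ →L[ℝ] ℝ)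
      (fun x : S => TangentSpace 𝓘(ℝ, ℂ) x →L[ℝ] TangentSpace 𝓘(ℝ, ℂ) x →L[ℝ] ℝ) x
        ⟨(chartAt ℂ x).symm u, β ((chartAt ℂ x).symm u)⟩).2 a b) =ᶠ[𝓝 (chartAt ℂ x x)]
      (fun u => (β ((chartAt ℂ x).symm u)
      (frame x ((chartAt ℂ x).symm u) * a : ℂ) (frame x ((chartAt ℂ x).symm u) * b : ℂ))) := by
    intro a b
    filter_upwards [(chartAt ℂ x).open_target.mem_nhds (mem_chart_target ℂ x)] with u hu
    exact trivializationAt_form ((chartAt ℂ x).map_target hu) _ a b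
  rw [Bundle.contMDiffAt_section, contMDiffAt_iff_source]
  simp only [extChartAt, mfld_simps, contMDiffWithinAt_univ]
  rw [contMDiffAt_iff_contDiffAt]
  constructor
  · intro h a b
    exact ((h.clm_apply (contDiffAt_const (c := a))).clm_apply
      (contDiffAt_const (c := b))).congr_of_eventuallyEq (hev a b).symm
  · intro h
    exact contDiffAt_of_clm_apply fun a => contDiffAt_of_clm_apply fun b =>
      (h a b).congr_of_eventuallyEq (hev a b)

/-- A positive definite symmetric form with smooth coordinates is a Riemannian metric. -/
lemma exists_metric (B : E → S → ℂ →L[ℝ] ℂ →L[ℝ] ℝ) (s : E)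
    (hsymm : ∀ x a b, B s x a b = B s x b a) (hpos : ∀ x a, a ≠ 0 → 0 < B s x a a)
    (hsm : ∀ x, ∃ y, x ∈ (chartAt ℂ y).source ∧ SmoothFormAt B y s x) :
    ∃ G : Metric S, ∀ x (a b : Tan x), G.inner x a b = B s x (toC a) (toC b) := by
  refine ⟨⟨fun x => B s x, fun x a b => hsymm x a b, fun x a ha => hpos x a ha, ?_, ?_⟩,
    fun x a b => rfl⟩
  · intro x
    -- on the compact unit circle the quadratic form has a positive minimum
    obtain ⟨a₀, ha₀, hmin⟩ := (isCompact_sphere (0 : ℂ) 1).exists_isMinOn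
      (NormedSpace.sphere_nonempty.2 zero_le_one) (f := fun a => B s x a a)
      (by fun_prop)
    have hc : 0 < B s x a₀ a₀ := hpos x a₀ (by rintro rfl; simp at ha₀)
    have : Bornology.IsVonNBounded ℝ {v : ℂ | B s x v v < 1} := by
      rw [NormedSpace.isVonNBounded_iff, isBounded_iff_forall_norm_le]
      refine ⟨1 + 1 / B s x a₀ a₀, fun v hv => ?_⟩
      by_cases hv0 : v = 0
      · subst hv0; simp; positivity
      have hn : 0 < ‖v‖ := norm_pos_iff.2 hv0
      have h1 : B s x a₀ a₀ ≤ B s x (‖v‖⁻¹ • v) (‖v‖⁻¹ • v) :=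
        hmin (by simp [hn.ne'])
      simp only [map_smul, smul_apply, smul_eq_mul] at h1
      have h2 : B s x a₀ a₀ * ‖v‖ ^ 2 ≤ B s x v v := by
        have := mul_le_mul_of_nonneg_right h1 (sq_nonneg ‖v‖)
        calc _ ≤ _ := this
          _ = _ := by field_simp
      have h3 : B s x a₀ a₀ * ‖v‖ ^ 2 < 1 := h2.trans_lt hv
      have h4 : ‖v‖ ^ 2 < 1 / B s x a₀ a₀ := by
        rw [lt_div_iff₀ hc]; linarith
      nlinarith [sq_nonneg (‖v‖ - 1)]
    exact this
  · intro x
    obtain ⟨y, hy, hs⟩ := hsm x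
    have hs := hs.change hy (mem_chart_source ℂ x)
    refine (contMDiffAt_form_iff (fun x => B s x) x).2 fun a b => ?_
    exact ContDiffAt.comp (chartAt ℂ x x) (f := fun u : ℂ => (s, u)) (hs a b)
        (contDiffAt_const.prodMk contDiffAt_id)

/-- The form underlying a metric, as a form on `ℂ`. -/
noncomputable def metricForm (G : Metric S) (x : S) : ℂ →L[ℝ] ℂ →L[ℝ] ℝ := G.inner x

lemma metricForm_apply (G : Metric S) (x : S) (a b : Tan x) :
    G.inner x a b = metricForm G x (toC a) (toC b) := rfl

lemma metricComp_eq (G : Metric S) {y : S} {u : ℂ} (hu : u ∈ (chartAt ℂ y).target) (a b : ℂ) :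
    metricComp G y u a b = metricForm G ((chartAt ℂ y).symm u)
      (frame y ((chartAt ℂ y).symm u) * a) (frame y ((chartAt ℂ y).symm u) * b) := by
  rw [metricComp, metricForm_apply, toC_chartVec hu, toC_chartVec hu]

/-- A metric has smooth coordinates. -/
lemma smoothFormAt_metric (G : Metric S) (hy : x ∈ (chartAt ℂ y).source) (s : E) :
    SmoothFormAt (fun _ : E => metricForm G) y s x := by
  refine SmoothFormAt.change (y := x) ?_ (mem_chart_source ℂ x) hy
  intro a b
  have h3 := (contMDiffAt_form_iff (fun x => G.inner x) x).1 (G.contMDiff x) a b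
  exact ContDiffAt.comp (s, chartAt ℂ x x) h3 contDiffAt_snd

/-- A family of metrics whose coordinates are jointly smooth is a smooth family. -/
lemma smoothFamily_of_smoothFormAt (g : E → Metric S) (B : E → S → ℂ →L[ℝ] ℂ →L[ℝ] ℝ) {V : Set E}
    (hV : IsOpen V) (h0 : (0 : E) ∈ V)
    (hg : ∀ s ∈ V, ∀ x (a b : Tan x), (g s).inner x a b = B s x (toC a) (toC b))
    (hB : ∀ s ∈ V, ∀ x, ∃ y, x ∈ (chartAt ℂ y).source ∧ SmoothFormAt B y s x) :
    SmoothFamily g := by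
  refine ⟨V, hV, h0, fun y a b => ?_⟩
  rintro ⟨s, u⟩ ⟨hs, hu⟩
  simp only at hs hu
  obtain ⟨z, hz, hB⟩ := hB s hs ((chartAt ℂ y).symm u)
  have h1 := hB.change hz ((chartAt ℂ y).map_target hu) a b
  rw [(chartAt ℂ y).right_inv hu] at h1
  refine ContDiffAt.contDiffWithinAt (h1.congr_of_eventuallyEq ?_)
  filter_upwards [(hV.prod (chartAt ℂ y).open_target).mem_nhds (show (s, u) ∈ _ from ⟨hs, hu⟩)]
    with q hq
  rw [metricComp_eq _ hq.2]
  exact hg q.1 hq.1 _ _ _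

end

end Forms

/-! ### The area measure -/

section Measure

lemma det_complex (L : ℂ →L[ℝ] ℂ) : ContinuousLinearMap.det L = (starRingEnd ℂ (L 1) * L I).im := by
  rw [ContinuousLinearMap.det, ← LinearMap.det_toMatrix basisOneI, Matrix.det_fin_two]
  simp [LinearMap.toMatrix_apply]
  ring

lemma det_complex_mul {L M : ℂ →L[ℝ] ℂ} {m : ℂ} (h : ∀ a, M a = m * L a) :
    ContinuousLinearMap.det M = normSq m * ContinuousLinearMap.det L := by
  rw [det_complex, det_complex, h, h]
  simp [normSq_apply]
  ring

lemma measurableSet_inter_preimage {S : Type*} [TopologicalSpace S] [MeasurableSpace S] [BorelSpace S]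
    {D : Set ℂ} {Φ : ℂ → S} (hD : MeasurableSet D) (hc : ContinuousOn Φ D) {s : Set S}
    (hs : MeasurableSet s) : MeasurableSet (D ∩ Φ ⁻¹' s) := by
  have := hD.subtype_image ((continuousOn_iff_continuous_domRestrict.1 hc).measurable hs)
  convert this using 1
  ext u
  simp [and_comm]

variable {S : Type*} [TopologicalSpace S] [ChartedSpace ℂ S]

section

variable [IsManifold 𝓘(ℂ, ℂ) ω S]

lemma jac_eq {Φ : ℂ → S} {u : ℂ} (h : MDifferentiableAt 𝓘(ℝ, ℂ) 𝓘(ℝ, ℂ) Φ u) {y : S}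
    (hy : Φ u ∈ (chartAt ℂ y).source) :
    jac Φ u = normSq (frame y (Φ u))
      * ContinuousLinearMap.det (fderiv ℝ (fun v => chartAt ℂ y (Φ v)) u) :=
  det_complex_mul (M := mfderiv 𝓘(ℝ, ℂ) 𝓘(ℝ, ℂ) Φ u) fun a => mfderiv_to_surface h hy a

lemma jac_chart_symm {y : S} {u : ℂ} (hu : u ∈ (chartAt ℂ y).target) :
    jac (chartAt ℂ y).symm u = normSq (frame y ((chartAt ℂ y).symm u)) := by
  refine (det_complex_mul (M := mfderiv 𝓘(ℝ, ℂ) 𝓘(ℝ, ℂ) (chartAt ℂ y).symm u)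
    (L := ContinuousLinearMap.id ℝ ℂ) fun a => toC_chartVec hu a).trans ?_
  rw [det_complex]
  simp

/-- The conformal factor of a compatible metric: `G = lam |dζ|²` in the plane `Tan x = ℂ`. -/
noncomputable def lam (G : Metric S) (x : S) : ℝ := metricForm G x 1 1

lemma lam_pos (G : Metric S) (x : S) : 0 < lam G x :=
  G.pos x (1 : ℂ) (one_ne_zero (α := ℂ))

lemma metricForm_symm (G : Metric S) (x : S) (a b : ℂ) : metricForm G x a b = metricForm G x b a :=
  G.symm x a b

variable {G : Metric S}

lemma IsCompatible.metricForm_eq (hG : IsCompatible G) (x : S) (a b : ℂ) :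
    metricForm G x a b = lam G x * (starRingEnd ℂ a * b).re := by
  have h : ∀ a b : ℂ, metricForm G x (I * a) (I * b) = metricForm G x a b := fun a b => hG x a b
  have h1 : metricForm G x I I = lam G x := by simpa [lam] using h 1 1
  have h2 : metricForm G x 1 I = 0 := by
    have := h 1 I
    simp only [mul_one, I_mul_I, map_neg] at this
    have h3 := metricForm_symm G x I 1
    linarith
  have h3 : metricForm G x I 1 = 0 := by rw [metricForm_symm, h2]
  conv_lhs => rw [complex_eq_re_im a, complex_eq_re_im b]
  simp only [map_add, map_smul, add_apply, smul_apply, smul_eq_mul]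
  rw [h1, h2, h3]
  simp [lam]
  ring

/-- The area density of `Φ^* G` for a compatible metric `G`. -/
noncomputable def density (G : Metric S) (Φ : ℂ → S) (u : ℂ) : ℝ := |jac Φ u| * lam G (Φ u)

lemma continuousAt_density (hG : IsCompatible G) {Φ : ℂ → S} {O : Set ℂ} (hO : IsOpen O)
    (hΦ : ContMDiffOn 𝓘(ℝ, ℂ) 𝓘(ℝ, ℂ) ∞ Φ O) {u : ℂ} (hu : u ∈ O) :
    ContinuousAt (density G Φ) u := by
  have hd : ∀ v ∈ O, ContMDiffAt 𝓘(ℝ, ℂ) 𝓘(ℝ, ℂ) ∞ Φ v := fun v hv =>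
    (hΦ v hv).contMDiffAt (hO.mem_nhds hv)
  have hc : ContDiffAt ℝ ∞ (fun v => chartAt ℂ (Φ u) (Φ v)) u := by
    have := (contMDiffAt_iff_target.1 (hd u hu)).2
    simpa [extChartAt, Function.comp_def] using this.contDiffAt
  have h1 : ContinuousAt (fun v => ContinuousLinearMap.det
      (fderiv ℝ (fun v => chartAt ℂ (Φ u) (Φ v)) v)) u := by
    have := (hc.fderiv_right (m := 0) (by simp)).continuousAt
    exact ContinuousLinearMap.continuous_det.continuousAt.comp this
  have h2 : ContinuousAt (fun v => metricForm G ((chartAt ℂ (Φ u)).symm (chartAt ℂ (Φ u) (Φ v)))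
      (frame (Φ u) ((chartAt ℂ (Φ u)).symm (chartAt ℂ (Φ u) (Φ v))) * 1)
      (frame (Φ u) ((chartAt ℂ (Φ u)).symm (chartAt ℂ (Φ u) (Φ v))) * 1)) u :=
    ((smoothFormAt_metric (E := ℝ) (s := 0) G (mem_chart_source ℂ (Φ u))).comp (X := ℂ)
      (c := fun v => ((0 : ℝ), chartAt ℂ (Φ u) (Φ v))) (t := u) rfl
      (contDiffAt_const.prodMk hc) contDiffAt_const contDiffAt_const).continuousAt
  refine (h1.abs.mul h2).congr ?_
  filter_upwards [hO.mem_nhds hu, (hd u hu).continuousAt.preimage_mem_nhds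
    ((chartAt ℂ (Φ u)).open_source.mem_nhds (mem_chart_source ℂ (Φ u)))] with v hv hv'
  simp only [Pi.mul_apply]
  rw [density, jac_eq ((hd v hv).mdifferentiableAt (by simp)) hv',
    (chartAt ℂ (Φ u)).left_inv hv', hG.metricForm_eq, abs_mul, abs_of_nonneg (normSq_nonneg _)]
  simp [normSq_apply]
  ring

variable [MeasurableSpace S]

/-- The area measure `Φ_* (√(det Φ^*G) dx⁰dx¹)` carried by the image of `D` under `Φ`. -/
noncomputable def paramVol (G : Metric S) (D : Set ℂ) (Φ : ℂ → S) : Measure S :=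
  Measure.map Φ ((volume.restrict D).withDensity fun u => ENNReal.ofReal (density G Φ u))

lemma chartVol_eq_paramVol (hG : IsCompatible G) (y : S) :
    chartVol G y = paramVol G (chartAt ℂ y).target (chartAt ℂ y).symm := by
  rw [chartVol, paramVol]
  congr 1
  apply withDensity_congr_ae
  refine (ae_restrict_iff' (chartAt ℂ y).open_target.measurableSet).2
    (Eventually.of_forall fun u hu => ?_)
  simp only
  congr 1
  rw [density, jac_chart_symm hu, abs_of_nonneg (normSq_nonneg _), Matrix.det_fin_two]
  simp only [gram, Matrix.of_apply, metricComp_eq _ hu, hG.metricForm_eq, e, Matrix.cons_val_zero,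
    Matrix.cons_val_one]
  have h := lam_pos G ((chartAt ℂ y).symm u)
  have h' := normSq_nonneg (frame y ((chartAt ℂ y).symm u))
  rw [← Real.sqrt_mul_self (mul_nonneg h' h.le)]
  congr 1
  simp [normSq_apply]
  ring

end

section

variable [IsManifold 𝓘(ℂ, ℂ) ω S] {G : Metric S} [MeasurableSpace S] [BorelSpace S]
  {D : Set ℂ} {Φ : ℂ → S}

lemma paramVol_apply (hD : MeasurableSet D) (hc : ContinuousOn Φ D) {s : Set S}
    (hs : MeasurableSet s) :
    paramVol G D Φ s = ∫⁻ u in D ∩ Φ ⁻¹' s, ENNReal.ofReal (density G Φ u) := by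
  rw [paramVol, Measure.map_apply_of_aemeasurable
    ((hc.aemeasurable hD).mono_ac (withDensity_absolutelyContinuous _ _)) hs,
    withDensity_apply' _ _, Measure.restrict_restrict' hD, inter_comm]

/-- Change of variables: inside a chart, the area of a set can be computed in that chart. -/
lemma paramVol_eq_lintegral_chart (hD : MeasurableSet D) (hc : ContinuousOn Φ D) (hi : InjOn Φ D)
    (hd : ∀ u ∈ D, MDifferentiableAt 𝓘(ℝ, ℂ) 𝓘(ℝ, ℂ) Φ u) {s : Set S} (hs : MeasurableSet s)
    {y : S} (hy : s ⊆ (chartAt ℂ y).source) :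
    paramVol G D Φ s = ∫⁻ v in chartAt ℂ y '' (s ∩ Φ '' D),
      ENNReal.ofReal (normSq (frame y ((chartAt ℂ y).symm v)) * lam G ((chartAt ℂ y).symm v)) := by
  rw [paramVol_apply hD hc hs]
  have e1 : chartAt ℂ y '' (s ∩ Φ '' D) = (fun u => chartAt ℂ y (Φ u)) '' (D ∩ Φ ⁻¹' s) := by
    rw [← Function.comp_def, image_comp, image_inter_preimage, inter_comm]
  rw [e1, lintegral_image_eq_lintegral_abs_det_fderiv_mul volume
    (measurableSet_inter_preimage hD hc hs)
    (f' := fun u => fderiv ℝ (fun v => chartAt ℂ y (Φ v)) u) ?_ ?_]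
  · refine setLIntegral_congr_fun (measurableSet_inter_preimage hD hc hs) fun u hu => ?_
    rw [(chartAt ℂ y).left_inv (hy hu.2), ← ENNReal.ofReal_mul (abs_nonneg _), density,
      jac_eq (hd u hu.1) (hy hu.2), abs_mul, abs_of_nonneg (normSq_nonneg _)]
    congr 1; ring
  · intro u hu
    exact ((mdiffAt_chart y (hy hu.2)).comp u (hd u hu.1)).differentiableAt.hasFDerivAt
      |>.hasFDerivWithinAt
  · intro u hu v hv huv
    exact hi hu.1 hv.1 ((chartAt ℂ y).injOn (hy hu.2) (hy hv.2) huv)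

lemma chartVol_apply (hG : IsCompatible G) {s : Set S} (hs : MeasurableSet s) {y z : S}
    (hy : s ⊆ (chartAt ℂ y).source) :
    chartVol G z s = ∫⁻ v in chartAt ℂ y '' (s ∩ (chartAt ℂ z).source),
      ENNReal.ofReal (normSq (frame y ((chartAt ℂ y).symm v)) * lam G ((chartAt ℂ y).symm v)) := by
  rw [chartVol_eq_paramVol hG, paramVol_eq_lintegral_chart (chartAt ℂ z).open_target.measurableSet
    (chartAt ℂ z).continuousOn_symm (chartAt ℂ z).symm.injOn
    (fun u hu => mdiffAt_chart_symm z hu) hs hy, (chartAt ℂ z).symm_image_target_eq_source]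

/-- The Riemannian area measure restricts to `chartVol G y` on the domain of the chart at `y`. -/
lemma dvol_apply (hG : IsCompatible G) {s : Set S} (hs : MeasurableSet s) {y : S}
    (hy : s ⊆ (chartAt ℂ y).source) : dvol G s = chartVol G y s := by
  have hm : MeasurableSet (chartAt ℂ y).source := (chartAt ℂ y).open_source.measurableSet
  refine le_antisymm ?_ (Measure.le_iff'.1 (le_iSup (chartVol G) y) s)
  -- this measure dominates all the measures `chartVol G z`, and agrees with `chartVol G y` on `s`
  have key : dvol G ≤ (dvol G).restrict (chartAt ℂ y).sourceᶜ + chartVol G y := by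
    refine iSup_le fun z => Measure.le_iff.2 fun t ht => ?_
    rw [Measure.add_apply, Measure.restrict_apply ht, ← measure_inter_add_sdiff t hm, add_comm]
    refine add_le_add ?_ ?_
    · rw [sdiff_eq]
      exact Measure.le_iff'.1 (le_iSup (chartVol G) z) _
    · refine le_trans ?_ (measure_mono (inter_subset_left (s := t) (t := (chartAt ℂ y).source)))
      rw [chartVol_apply hG (ht.inter hm) inter_subset_right,
        chartVol_apply hG (ht.inter hm) inter_subset_right]
      refine lintegral_mono_set (image_mono ?_)
      exact fun x hx => ⟨hx.1, hx.1.2⟩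
  refine (Measure.le_iff'.1 key s).trans ?_
  rw [Measure.add_apply, Measure.restrict_apply hs]
  have : s ∩ (chartAt ℂ y).sourceᶜ = ∅ := by
    rw [← sdiff_eq, sdiff_eq_empty]; exact hy
  rw [this]; simp

variable [T2Space S] [SecondCountableTopology S]

lemma dvol_restrict_image (hG : IsCompatible G) (hD : MeasurableSet D) (hc : ContinuousOn Φ D)
    (hi : InjOn Φ D) (hd : ∀ u ∈ D, MDifferentiableAt 𝓘(ℝ, ℂ) 𝓘(ℝ, ℂ) Φ u) :
    (dvol G).restrict (Φ '' D) = paramVol G D Φ := by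
  have hm : MeasurableSet (Φ '' D) := by
    have := (hc.measurableEmbedding hD hi).measurableSet_range
    rwa [range_domRestrict] at this
  obtain ⟨T, hT, hcov⟩ := TopologicalSpace.countable_cover_nhds (α := S)
    (f := fun y => (chartAt ℂ y).source)
    (fun y => (chartAt ℂ y).open_source.mem_nhds (mem_chart_source ℂ y))
  rw [← Measure.restrict_univ (μ := (dvol G).restrict _), ← Measure.restrict_univ (μ := paramVol G D Φ),
    ← hcov, Measure.restrict_biUnion_congr hT]
  intro y hy
  ext s hs
  have hsy : MeasurableSet (s ∩ (chartAt ℂ y).source) :=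
    hs.inter (chartAt ℂ y).open_source.measurableSet
  rw [Measure.restrict_apply hs, Measure.restrict_apply hs, Measure.restrict_apply hsy,
    paramVol_eq_lintegral_chart hD hc hi hd hsy inter_subset_right,
    dvol_apply hG (hsy.inter hm) (inter_subset_left.trans inter_subset_right),
    chartVol_apply hG (hsy.inter hm) (y := y) (inter_subset_left.trans inter_subset_right)]
  congr 3
  exact inter_eq_left.2 (inter_subset_left.trans inter_subset_right)

/-- The integral over the image of an injective parametrization. -/
lemma integral_dvol_image (hG : IsCompatible G) {O : Set ℂ} (hO : IsOpen O)
    (hΦ : ContMDiffOn 𝓘(ℝ, ℂ) 𝓘(ℝ, ℂ) ∞ Φ O) (hD : MeasurableSet D) (hDO : D ⊆ O) (hi : InjOn Φ D)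
    (f : S → ℂ) :
    ∫ x in Φ '' D, f x ∂(dvol G) = ∫ u in D, density G Φ u • f (Φ u) := by
  have hc : ContinuousOn Φ D := hΦ.continuousOn.mono hDO
  have hd : ∀ u ∈ D, MDifferentiableAt 𝓘(ℝ, ℂ) 𝓘(ℝ, ℂ) Φ u := fun u hu =>
    ((hΦ u (hDO hu)).contMDiffAt (hO.mem_nhds (hDO hu))).mdifferentiableAt (by simp)
  rw [dvol_restrict_image hG hD hc hi hd]
  set μ := (volume.restrict D).withDensity fun u => ENNReal.ofReal (density G Φ u) with hμ
  have hμD : Measure.map Subtype.val (Measure.comap (Subtype.val : D → ℂ) μ) = μ := by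
    rw [map_comap_subtype_coe hD, hμ, restrict_withDensity hD, Measure.restrict_restrict hD,
      inter_self]
  have h1 : paramVol G D Φ = Measure.map (D.domRestrict Φ) (Measure.comap Subtype.val μ) := by
    have e : D.domRestrict Φ = Φ ∘ Subtype.val := rfl
    rw [e, ← AEMeasurable.map_map_of_aemeasurable, hμD]
    · rfl
    · rw [hμD]
      exact (hc.aemeasurable hD).mono_ac (withDensity_absolutelyContinuous _ _)
    · exact measurable_subtype_coe.aemeasurable
  rw [h1, (hc.measurableEmbedding hD hi).integral_map]
  have h2 := (MeasurableEmbedding.subtype_coe hD).integral_map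
    (μ := Measure.comap (Subtype.val : D → ℂ) μ) (fun u => f (Φ u))
  rw [hμD] at h2
  change ∫ u : D, f (Φ u) ∂_ = _
  rw [← h2, hμ, integral_withDensity_eq_integral_toReal_smul₀]
  · refine setIntegral_congr_fun hD fun u _ => ?_
    rw [ENNReal.toReal_ofReal]
    exact mul_nonneg (abs_nonneg _) (lam_pos G _).le
  · have : ContinuousOn (density G Φ) D := fun u hu =>
      (continuousAt_density hG hO hΦ (hDO hu)).continuousWithinAt
    exact (this.aemeasurable hD).ennreal_ofReal
  · exact Eventually.of_forall fun u => ENNReal.ofReal_lt_top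

end

end Measure

/-! ### The energy-momentum tensor in two-point functions -/

section EnergyMomentum

variable {S : Type*} [TopologicalSpace S] [ChartedSpace ℂ S] [IsManifold 𝓘(ℂ, ℂ) ω S]
  {F : Type*} [AddCommGroup F] [Module ℂ F]

/-- The frame `eTan` is orthogonal for a compatible metric, of common squared length `lam`, so that the
contraction needs no inverse Gram matrix. -/
lemma contract_of_compatible {G : Metric S} (hG : IsCompatible G) (x : S)
    (t : Tan x →ₗ[ℝ] Tan x →ₗ[ℝ] F) (h : Tan x → Tan x → ℝ) :
    contract G x t h = (((lam G x)⁻¹ ^ 2 : ℝ) : ℂ) •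
      ∑ k : Fin 2, ∑ l : Fin 2, ((h (eTan x k) (eTan x l) : ℝ) : ℂ) • t (eTan x k) (eTan x l) := by
  have hg : (Matrix.of fun i j : Fin 2 => G.inner x (eTan x i) (eTan x j))
      = lam G x • (1 : Matrix (Fin 2) (Fin 2) ℝ) := by
    ext i j
    rw [Matrix.of_apply, metricForm_apply, hG.metricForm_eq]
    fin_cases i <;> fin_cases j <;> simp [toC, eTan, e]
  have hi : (Matrix.of fun i j : Fin 2 => G.inner x (eTan x i) (eTan x j))⁻¹
      = (lam G x)⁻¹ • (1 : Matrix (Fin 2) (Fin 2) ℝ) := by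
    rw [hg]
    apply Matrix.inv_eq_right_inv
    rw [smul_mul_smul_comm, mul_one, mul_inv_cancel₀ (lam_pos G x).ne', one_smul]
  simp only [contract, hi]
  simp [Fin.sum_univ_two, smul_smul, smul_add, -Complex.coe_smul, pow_two, mul_assoc]

/-- A real bilinear form on `ℂ` is determined by its values on `1` and `I`. -/
lemma bilin_expand (t : ℂ →ₗ[ℝ] ℂ →ₗ[ℝ] ℂ) (a b : ℂ) :
    t a b = a.re * b.re * t 1 1 + a.re * b.im * t 1 I + a.im * b.re * t I 1
      + a.im * b.im * t I I := by
  conv_lhs => rw [complex_eq_re_im a, complex_eq_re_im b]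
  simp only [map_add, map_smul, LinearMap.add_apply, LinearMap.smul_apply]
  simp only [real_smul]
  ring

/-- A traceless symmetric form paired with the variation `lam (σ̄ β ⊙ dz + σ β ⊙ dz̄)` of a metric
`lam |dz|²`, up to a multiple of the metric: only the `(2,0)` and `(0,2)` parts contribute. -/
lemma contract_variation (t : ℂ →ₗ[ℝ] ℂ →ₗ[ℝ] ℂ) (hs : t I 1 = t 1 I) (htr : t 1 1 + t I I = 0)
    (h : ℂ → ℂ → ℝ) (l c : ℝ) (σ : ℂ) (β : ℂ → ℝ)
    (hh : ∀ u v, h u v = l * ((starRingEnd ℂ) (σ * β u) * v + (starRingEnd ℂ) u * (σ * β v)).re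
      + c * ((starRingEnd ℂ) u * v).re) :
    ∑ k : Fin 2, ∑ m : Fin 2, (h (e k) (e m) : ℂ) * t (e k) (e m)
      = 2 * l * (σ * (β 1 + I * β I) * ((t 1 1 - 2 * I * t I 1 - t I I) / 4)
        + (starRingEnd ℂ) σ * (β 1 - I * β I) * ((t 1 1 + 2 * I * t I 1 - t I I) / 4)) := by
  have h2 : t I I = - t 1 1 := by linear_combination htr
  simp only [Fin.sum_univ_two, e, Matrix.cons_val_zero, Matrix.cons_val_one, hh, hs, h2]
  obtain ⟨p, q⟩ := σ
  have e1 : (⟨p, q⟩ : ℂ) = p + q * I := by apply Complex.ext <;> simp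
  rw [e1]
  simp only [map_mul, map_add, conj_ofReal, conj_I, map_one]
  simp only [mul_re, add_re, add_im, mul_im, ofReal_re, ofReal_im, I_re, I_im, one_re, one_im,
    neg_re, neg_im]
  push_cast
  ring_nf
  simp only [I_sq]
  ring

end EnergyMomentum

section TwoPoint

variable {S : Type*} [TopologicalSpace S] [ChartedSpace ℂ S] [IsManifold 𝓘(ℂ, ℂ) ω S]

section

variable {G : Metric S} {x y : S}

lemma dC_chart (hy : x ∈ (chartAt ℂ y).source) (a : Tan x) :
    dC (chartAt ℂ y) x a = (frame y x)⁻¹ * toC a := by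
  have h := mfderiv_from_surface (mdiffAt_chart y hy) hy ((frame y x)⁻¹ * toC a)
  have h1 : (fun v => chartAt ℂ y ((chartAt ℂ y).symm v)) =ᶠ[𝓝 (chartAt ℂ y x)] id := by
    filter_upwards [(chartAt ℂ y).open_target.mem_nhds ((chartAt ℂ y).map_source hy)] with v hv
    exact (chartAt ℂ y).right_inv hv
  rw [h1.fderiv_eq, mul_inv_cancel_left₀ (frame_ne_zero hy)] at h
  exact h.symm.trans (by simp)

lemma isConformalCoord_chart (hG : IsCompatible G) (hy : x ∈ (chartAt ℂ y).source) :
    IsConformalCoord G (chartAt ℂ y) x := by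
  filter_upwards [(chartAt ℂ y).open_source.mem_nhds hy] with q hq
  have hf := frame_ne_zero hq
  refine ⟨contMDiffAt_of_mem_maximalAtlas (IsManifold.chart_mem_maximalAtlas y) hq, ?_,
    lam G q * normSq (frame y q), mul_pos (lam_pos G q) (normSq_pos.2 hf), fun u v => ?_⟩
  · have h := det_complex_mul (M := dC (chartAt ℂ y) q) (L := ContinuousLinearMap.id ℝ ℂ)
      (m := (frame y q)⁻¹) (fun a => dC_chart hq a)
    have h1 : jac (chartAt ℂ y) q = normSq (frame y q)⁻¹ := by
      refine Eq.trans h ?_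
      rw [det_complex]; simp
    rw [h1]
    exact normSq_pos.2 (inv_ne_zero hf)
  · rw [dC_chart hq, dC_chart hq, metricForm_apply, hG.metricForm_eq, mul_assoc]
    congr 1
    have : ((normSq (frame y q) : ℝ) : ℂ) * ((starRingEnd ℂ) ((frame y q)⁻¹ * toC u)
        * ((frame y q)⁻¹ * toC v)) = (starRingEnd ℂ) (toC u) * toC v := by
      rw [normSq_eq_conj_mul_self, map_mul, map_inv₀]
      have : (starRingEnd ℂ) (frame y q) ≠ 0 := by simpa using hf
      field_simp
    rw [← this, re_ofReal_mul]

/-- The germ at `0` of the change of coordinates between two charts, both centred at `x`. -/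
noncomputable def chartGerm (y z x : S) (u : ℂ) : ℂ :=
  coordChange y z (u + chartAt ℂ y x) - chartAt ℂ z x

lemma isConformalGerm_chartGerm {z : S} (hy : x ∈ (chartAt ℂ y).source)
    (hz : x ∈ (chartAt ℂ z).source) : IsConformalGerm (chartGerm y z x) := by
  have hu := (chartAt ℂ y).map_source hy
  have hz' : (chartAt ℂ y).symm (chartAt ℂ y x) ∈ (chartAt ℂ z).source := by
    rwa [(chartAt ℂ y).left_inv hy]
  have hd := hasDerivAt_coordChange hu hz'
  have e0 : (0 : ℂ) + chartAt ℂ y x = chartAt ℂ y x := zero_add _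
  refine ⟨?_, ?_, ?_⟩
  · have h1 := (contDiffAt_coordChange hu hz').analyticAt
    have h2 : AnalyticAt ℂ (fun u : ℂ => u + chartAt ℂ y x) 0 := by fun_prop
    rw [← e0] at h1
    exact (h1.comp (f := fun u : ℂ => u + chartAt ℂ y x) h2).sub analyticAt_const
  · simp [chartGerm, coordChange, (chartAt ℂ y).left_inv hy]
  · rw [← e0] at hd
    have h3 := (hd.comp_add_const 0 (chartAt ℂ y x)).sub_const (chartAt ℂ z x)
    have h4 : deriv (chartGerm y z x) 0 = deriv (coordChange y z) (0 + chartAt ℂ y x) := h3.deriv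
    rw [h4, e0]
    exact deriv_coordChange_ne_zero hy hz

lemma isConfig_pair {w : S} {ζ : S → ℂ} (hζ : IsConformalCoord G ζ w) (hx : x ≠ w) {ξ : S → ℂ}
    (hξ : IsConformalCoord G ξ x) : IsConfig G ![x, w] ![ξ, ζ] := by
  refine ⟨?_, fun i => ?_⟩
  · intro i j hij
    fin_cases i <;> fin_cases j <;> simp_all
  · fin_cases i
    · exact hξ
    · exact hζ

lemma isConformalGerm_id : IsConformalGerm id := ⟨analyticAt_id, rfl, by simp⟩

end

variable {F : Type*} [AddCommGroup F] [Module ℂ F] [MeasurableSpace S]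

/-- The two-point function `⟨v(x) φ(w)⟩`, as a linear function of the vector `v` that represents a
field at `x` in the coordinate `ξ`. -/
noncomputable def twoPoint (C : ConformalFieldTheory S F) (G : Metric S) (w : S) (ζ : S → ℂ)
    (φ : F) (x : S) (ξ : S → ℂ) : F →ₗ[ℂ] ℂ where
  toFun v := C.state.corr G 2 ![x, w] ![ξ, ζ] ![v, φ]
  map_add' v v' := (C.state.corr G 2 ![x, w] ![ξ, ζ]).cons_add (M := fun _ => F) ![φ] v v'
  map_smul' r v := (C.state.corr G 2 ![x, w] ![ξ, ζ]).cons_smul (M := fun _ => F) ![φ] r v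

/-- The two-point function `⟨T(a, b) φ(w)⟩` of the energy-momentum tensor at `x`. -/
noncomputable def emTensor (C : ConformalFieldTheory S F) (G : Metric S) (w : S) (ζ : S → ℂ)
    (φ : F) (x : S) : ℂ →ₗ[ℝ] ℂ →ₗ[ℝ] ℂ :=
  (C.T G (chartAt ℂ x) x).compr₂ ((twoPoint C G w ζ φ x (chartAt ℂ x)).restrictScalars ℝ)

/-- The coefficient of the quadratic differential `⟨T_zz φ(w)⟩ dz²` in the preferred chart at `x`. -/
noncomputable def emHol (C : ConformalFieldTheory S F) (G : Metric S) (w : S) (ζ : S → ℂ)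
    (φ : F) (x : S) : ℂ :=
  (emTensor C G w ζ φ x 1 1 - 2 * I * emTensor C G w ζ φ x I 1 - emTensor C G w ζ φ x I I) / 4

/-- The complex conjugate of the coefficient of `⟨T_z̄z̄ φ(w)⟩ dz̄²` in the preferred chart at `x`;
conjugation turns it into the coefficient of a quadratic differential. -/
noncomputable def emAnti (C : ConformalFieldTheory S F) (G : Metric S) (w : S) (ζ : S → ℂ)
    (φ : F) (x : S) : ℂ :=
  (starRingEnd ℂ) ((emTensor C G w ζ φ x 1 1 + 2 * I * emTensor C G w ζ φ x I 1
    - emTensor C G w ζ φ x I I) / 4)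

variable {C : ConformalFieldTheory S F} {G : Metric S} {w : S} {ζ : S → ℂ} {φ : F}

lemma emTensor_symm (x : S) : emTensor C G w ζ φ x 1 I = emTensor C G w ζ φ x I 1 :=
  congrArg (twoPoint C G w ζ φ x (chartAt ℂ x)) (C.T_symm G (chartAt ℂ x) x (1 : ℂ) I)

lemma emHol_smul (x : S) (a : ℂ) :
    (emTensor C G w ζ φ x a a - 2 * I * emTensor C G w ζ φ x (I * a) a
      - emTensor C G w ζ φ x (I * a) (I * a)) / 4 = a ^ 2 * emHol C G w ζ φ x := by
  rw [bilin_expand _ a, bilin_expand _ (I * a) a, bilin_expand _ (I * a) (I * a), emTensor_symm,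
    emHol]
  conv_rhs => rw [← re_add_im a]
  simp only [mul_re, mul_im, I_re, I_im]
  push_cast
  ring_nf
  simp only [I_sq, show I ^ 3 = - I by rw [pow_succ, I_sq]; ring]
  ring

lemma emAnti_smul (x : S) (a : ℂ) :
    (starRingEnd ℂ) ((emTensor C G w ζ φ x a a + 2 * I * emTensor C G w ζ φ x (I * a) a
      - emTensor C G w ζ φ x (I * a) (I * a)) / 4) = a ^ 2 * emAnti C G w ζ φ x := by
  rw [bilin_expand _ a, bilin_expand _ (I * a) a, bilin_expand _ (I * a) (I * a), emTensor_symm,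
    emAnti, ← conj_conj (a ^ 2), ← map_mul]
  congr 1
  conv_rhs => rw [← re_add_im a]
  simp only [mul_re, mul_im, I_re, I_im, map_pow, map_add, map_mul, conj_ofReal, conj_I]
  push_cast
  ring_nf
  simp only [I_sq, show I ^ 3 = - I by rw [pow_succ, I_sq]; ring]
  ring

lemma twoPoint_Tzz (x : S) (a : Tan x) :
    twoPoint C G w ζ φ x (chartAt ℂ x) (Tzz (C.T G (chartAt ℂ x) x) a)
      = toC a ^ 2 * emHol C G w ζ φ x := by
  rw [← emHol_smul, Tzz, map_smul, map_sub, map_sub, map_smul, smul_eq_mul, smul_eq_mul, one_div,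
    mul_comm, div_eq_mul_inv]
  rfl

lemma twoPoint_Tzzbar (x : S) (a : Tan x) :
    twoPoint C G w ζ φ x (chartAt ℂ x) (Tzzbar (C.T G (chartAt ℂ x) x) a)
      = (starRingEnd ℂ) (toC a ^ 2 * emAnti C G w ζ φ x) := by
  rw [← emAnti_smul, conj_conj, Tzzbar, map_smul, map_sub, map_add, map_smul, smul_eq_mul,
    smul_eq_mul, one_div, mul_comm, div_eq_mul_inv]
  rfl

lemma twoPoint_contract (hG : IsCompatible G) (x : S) (h : Tan x → Tan x → ℝ) :
    twoPoint C G w ζ φ x (chartAt ℂ x) (contract G x (C.T G (chartAt ℂ x) x) h)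
      = (((lam G x)⁻¹ ^ 2 : ℝ) : ℂ) * ∑ k : Fin 2, ∑ l : Fin 2,
        (h (eTan x k) (eTan x l) : ℂ) * emTensor C G w ζ φ x (e k) (e l) := by
  rw [contract_of_compatible hG, map_smul, map_sum, smul_eq_mul]
  congr 1
  refine Finset.sum_congr rfl fun k _ => ?_
  rw [map_sum]
  refine Finset.sum_congr rfl fun l _ => ?_
  rw [map_smul]
  rfl

/-- In flat space the energy-momentum tensor is traceless. -/
lemma emTensor_trace (hG : IsCompatible G) (x : S) (hx : scalarCurvature G x = 0) :
    emTensor C G w ζ φ x 1 1 + emTensor C G w ζ φ x I I = 0 := by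
  have h := C.trace G x (chartAt ℂ x) (isConformalCoord_chart hG (mem_chart_source ℂ x))
  rw [hx] at h
  have h1 := congrArg (twoPoint C G w ζ φ x (chartAt ℂ x)) h
  have h2 := (twoPoint_contract (C := C) (w := w) (ζ := ζ) (φ := φ) hG x
    (fun a b => metricForm G x a b)).symm.trans h1
  have hl : (lam G x : ℂ) ≠ 0 := by exact_mod_cast (lam_pos G x).ne'
  simp [Fin.sum_univ_two, e, hl] at h2
  change (metricForm G x 1 1 : ℂ) * emTensor C G w ζ φ x 1 1
    + (metricForm G x 1 I : ℂ) * emTensor C G w ζ φ x 1 I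
    + ((metricForm G x I 1 : ℂ) * emTensor C G w ζ φ x I 1
    + (metricForm G x I I : ℂ) * emTensor C G w ζ φ x I I) = 0 at h2
  simpa [hG.metricForm_eq, ← mul_add, hl] using h2

/-- The response of `⟨φ(w)⟩` to a variation of the metric, at the point `x`: only the `(2,0)` and
`(0,2)` parts of the variation contribute. -/
lemma twoPoint_variation (hG : IsCompatible G) (x : S) (hx : scalarCurvature G x = 0)
    (h : ℂ → ℂ → ℝ) (c : ℝ) (σ : ℂ) (β : ℂ → ℝ)
    (hh : ∀ u v, h u v = lam G x * ((starRingEnd ℂ) (σ * β u) * v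
      + (starRingEnd ℂ) u * (σ * β v)).re + c * ((starRingEnd ℂ) u * v).re) :
    twoPoint C G w ζ φ x (chartAt ℂ x)
      ((-(1 / 2) : ℂ) • contract G x (C.T G (chartAt ℂ x) x) h)
    = -(lam G x : ℂ)⁻¹ * (σ * (β 1 + I * β I) * emHol C G w ζ φ x
        + (starRingEnd ℂ) (σ * (β 1 + I * β I) * emAnti C G w ζ φ x)) := by
  have hl : (lam G x : ℂ) ≠ 0 := by exact_mod_cast (lam_pos G x).ne'
  have h1 := twoPoint_contract (C := C) (w := w) (ζ := ζ) (φ := φ) hG x h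
  have h2 := contract_variation (emTensor C G w ζ φ x) (emTensor_symm x).symm
    (emTensor_trace hG x hx) h _ c σ β hh
  rw [map_smul]
  refine (congrArg (fun r => (-(1 / 2) : ℂ) • r) (h1.trans (congrArg (_ * ·) h2))).trans ?_
  simp only [emAnti, map_mul, map_add, conj_conj, conj_ofReal, conj_I, emHol, smul_eq_mul]
  push_cast
  field_simp
  ring

/-- The two-point function of `T` does not depend on the coordinate used for `T`. -/
lemma twoPoint_T_chart (hG : IsCompatible G) (hζ : IsConformalCoord G ζ w) {x y : S} (hx : x ≠ w)
    (hy : x ∈ (chartAt ℂ y).source) (a b : Tan x) :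
    twoPoint C G w ζ φ x (chartAt ℂ y) (C.T G (chartAt ℂ y) x a b)
      = emTensor C G w ζ φ x (toC a) (toC b) := by
  have hxx := mem_chart_source ℂ x
  have h1 := isConformalCoord_chart hG hy
  have h2 := isConformalCoord_chart hG hxx
  have hg := isConformalGerm_chartGerm hy hxx
  have hev : ∀ᶠ q in 𝓝 x, chartAt ℂ x q - chartAt ℂ x x
      = chartGerm y x x (chartAt ℂ y q - chartAt ℂ y x) := by
    filter_upwards [(chartAt ℂ y).open_source.mem_nhds hy] with q hq
    simp [chartGerm, coordChange, (chartAt ℂ y).left_inv hq]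
  have h3 := C.state.corr_coord G 2 ![x, w] ![chartAt ℂ y, ζ] ![chartAt ℂ x, ζ]
    ![chartGerm y x x, id] ![C.T G (chartAt ℂ y) x a b, φ] (isConfig_pair hζ hx h1)
    (isConfig_pair hζ hx h2) (fun i => by
      fin_cases i
      · exact hg
      · exact isConformalGerm_id) (fun i => by
      fin_cases i
      · exact hev
      · exact Eventually.of_forall fun q => rfl)
  refine h3.symm.trans ?_
  have h4 := C.T_coord G x _ _ _ h1 h2 hg hev a b
  change _ = C.state.corr G 2 ![x, w] ![chartAt ℂ x, ζ] ![C.T G (chartAt ℂ x) x a b, φ]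
  rw [h4]
  congr 1
  funext i
  fin_cases i
  · rfl
  · change C.bundle.ρ id φ = φ
    rw [C.bundle.ρ_id]; rfl

/-- A vector of a finite-dimensional subspace is the sum of its components, and the components extend
to linear functionals on the whole space. -/
lemma exists_dual_expansion (W : Submodule ℂ F) [FiniteDimensional ℂ W] :
    ∃ (k : ℕ) (b : Fin k → F) (f : Fin k → Module.Dual ℂ F),
      ∀ v ∈ W, v = ∑ i, f i v • b i := by
  let B := Module.finBasis ℂ W
  choose f hf using fun i => LinearMap.exists_extend (B.coord i)
  refine ⟨_, fun i => (B i : F), f, fun v hv => ?_⟩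
  have h := congrArg (Submodule.subtype W) (B.sum_repr ⟨v, hv⟩)
  rw [map_sum] at h
  refine h.symm.trans (Finset.sum_congr rfl fun i _ => ?_)
  rw [map_smul]
  have : f i v = B.repr ⟨v, hv⟩ i := DFunLike.congr_fun (hf i) ⟨v, hv⟩
  rw [this]; rfl

/-- The two-point function `⟨T_{μν} φ(w)⟩` is smooth away from `w`. -/
lemma contDiffAt_emTensor (hG : IsCompatible G) (hζ : IsConformalCoord G ζ w) {x : S} (hx : x ≠ w)
    [T2Space S] (a b : ℂ) :
    ContDiffAt ℝ ∞ (fun u => emTensor C G w ζ φ ((chartAt ℂ x).symm u)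
      (frame x ((chartAt ℂ x).symm u) * a) (frame x ((chartAt ℂ x).symm u) * b))
      (chartAt ℂ x x) := by
  have hxx := mem_chart_source ℂ x
  have hξ := isConformalCoord_chart hG hxx
  obtain ⟨n, hn⟩ := C.T_fil G x (chartAt ℂ x) hξ
  have := C.bundle.fil_finite n
  obtain ⟨k, v, f, hf⟩ := exists_dual_expansion (C.bundle.fil n)
  have hsm : ∀ i, ContDiffAt ℝ ∞ (fun u => twoPoint C G w ζ φ ((chartAt ℂ x).symm u)
      (chartAt ℂ x) (v i)) (chartAt ℂ x x) := by
    intro i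
    have h1 := C.state.corr_smooth G 2 ![x, w] ![chartAt ℂ x, ζ] ![v i, φ]
      (isConfig_pair hζ hx hξ)
    have h2 : ContDiffAt ℝ ∞ (fun u : ℂ => (![u, chartAt ℂ w w] : Fin 2 → ℂ)) (chartAt ℂ x x) := by
      rw [contDiffAt_pi]
      intro j
      fin_cases j
      · exact contDiffAt_id
      · exact contDiffAt_const
    have e1 : (fun i : Fin 2 => chartAt ℂ ((![x, w] : Fin 2 → S) i) ((![x, w] : Fin 2 → S) i))
        = ![chartAt ℂ x x, chartAt ℂ w w] := by
      funext j; fin_cases j <;> rfl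
    rw [e1] at h1
    refine (h1.comp (chartAt ℂ x x) h2).congr_of_eventuallyEq (Eventually.of_forall fun u => ?_)
    change C.state.corr G 2 ![(chartAt ℂ x).symm u, w] _ _ = C.state.corr G 2 _ _ _
    congr 2
    funext j
    fin_cases j
    · rfl
    · exact ((chartAt ℂ w).left_inv (mem_chart_source ℂ w)).symm
  have key : ContDiffAt ℝ ∞ (fun u => ∑ i, f i (C.T G (chartAt ℂ x) ((chartAt ℂ x).symm u)
      (chartVec x u a) (chartVec x u b)) * twoPoint C G w ζ φ ((chartAt ℂ x).symm u)
      (chartAt ℂ x) (v i)) (chartAt ℂ x x) :=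
    ContDiffAt.sum fun i _ => (C.T_smooth G x (chartAt ℂ x) hξ a b (f i)).mul (hsm i)
  refine key.congr_of_eventuallyEq ?_
  have hc : Tendsto (chartAt ℂ x).symm (𝓝 (chartAt ℂ x x)) (𝓝 x) := by
    have := (chartAt ℂ x).continuousAt_symm (mem_chart_target ℂ x)
    rwa [ContinuousAt, (chartAt ℂ x).left_inv hxx] at this
  filter_upwards [(chartAt ℂ x).open_target.mem_nhds (mem_chart_target ℂ x), hc.eventually hn,
    hc.eventually (isOpen_ne.eventually_mem hx)] with u hu hnu hne
  rw [← toC_chartVec hu, ← toC_chartVec hu,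
    ← twoPoint_T_chart hG hζ hne ((chartAt ℂ x).map_target hu)]
  conv_lhs => rw [hf _ (hnu (chartVec x u a) (chartVec x u b))]
  rw [map_sum]
  simp

end TwoPoint

/-! ### Quadratic differentials and the variation formula -/

section Quadratic

variable {S : Type*} [TopologicalSpace S] [ChartedSpace ℂ S]

/-- The coefficient, in the preferred chart at `y`, of the quadratic differential with coefficient
`q x` in the preferred chart at `x`, for all `x`. -/
noncomputable def quadCoord (q : S → ℂ) (y : S) (u : ℂ) : ℂ :=
  frame y ((chartAt ℂ y).symm u) ^ 2 * q ((chartAt ℂ y).symm u)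

variable [IsManifold 𝓘(ℂ, ℂ) ω S]

lemma quadCoord_change (q : S → ℂ) {x y z : S} (hy : x ∈ (chartAt ℂ y).source)
    (hz : x ∈ (chartAt ℂ z).source) :
    quadCoord q z =ᶠ[𝓝 (chartAt ℂ z x)]
      fun v => quadCoord q y (coordChange z y v) * deriv (coordChange z y) v ^ 2 := by
  have hu := (chartAt ℂ z).map_source hz
  have hn : ∀ᶠ v in 𝓝 (chartAt ℂ z x), (chartAt ℂ z).symm v ∈ (chartAt ℂ y).source := by
    apply ((chartAt ℂ z).continuousAt_symm hu).preimage_mem_nhds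
    rw [(chartAt ℂ z).left_inv hz]
    exact (chartAt ℂ y).open_source.mem_nhds hy
  filter_upwards [hn, (chartAt ℂ z).open_target.mem_nhds hu] with v hv hvt
  have e1 : (chartAt ℂ y).symm (coordChange z y v) = (chartAt ℂ z).symm v := by
    simp [coordChange, (chartAt ℂ y).left_inv hv]
  have e2 := frame_mul ((chartAt ℂ z).map_target hvt) hv
  rw [(chartAt ℂ z).right_inv hvt] at e2
  rw [quadCoord, quadCoord, e1, e2]
  ring

lemma contDiffAt_quadCoord_change {q : S → ℂ} {x y z : S} (hy : x ∈ (chartAt ℂ y).source)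
    (hz : x ∈ (chartAt ℂ z).source) (h : ContDiffAt ℝ ∞ (quadCoord q y) (chartAt ℂ y x)) :
    ContDiffAt ℝ ∞ (quadCoord q z) (chartAt ℂ z x) := by
  have hu := (chartAt ℂ z).map_source hz
  have h1 : ContDiffAt ℝ ∞ (coordChange z y) (chartAt ℂ z x) :=
    ((contDiffAt_coordChange hu (y := y) (by rwa [(chartAt ℂ z).left_inv hz])).restrict_scalars
      ℝ).of_le (by simp)
  have h2 : ContDiffAt ℝ ∞ (deriv (coordChange z y)) (chartAt ℂ z x) :=
    ((contDiffAt_deriv_coordChange hz hy).restrict_scalars ℝ).of_le (by simp)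
  have e1 : coordChange z y (chartAt ℂ z x) = chartAt ℂ y x := by
    simp [coordChange, (chartAt ℂ z).left_inv hz]
  rw [← e1] at h
  exact ((h.comp _ h1).mul (h2.pow 2)).congr_of_eventuallyEq (quadCoord_change q hy hz)

lemma IsConformalCoord.congr {G G' : Metric S} {ζ ζ' : S → ℂ} {p : S} (h : IsConformalCoord G ζ p)
    (hζ : ζ' =ᶠ[𝓝 p] ζ) (hG : ∀ᶠ q in 𝓝 p, ∀ a b : Tan q, G'.inner q a b = G.inner q a b) :
    IsConformalCoord G' ζ' p := by
  filter_upwards [h, hζ.eventuallyEq_nhds, hG] with q hq hζq hGq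
  obtain ⟨h1, h2, l, hl, h3⟩ := hq
  have hd : (mfderiv 𝓘(ℝ, ℂ) 𝓘(ℝ, ℂ) ζ' q : ℂ →L[ℝ] ℂ) = mfderiv 𝓘(ℝ, ℂ) 𝓘(ℝ, ℂ) ζ q :=
    hζq.mfderiv_eq
  have hd' : ∀ a : Tan q, dC ζ' q a = dC ζ q a := fun a => DFunLike.congr_fun hd a
  refine ⟨h1.congr_of_eventuallyEq hζq, ?_, l, hl, fun u v => ?_⟩
  · have : jac ζ' q = jac ζ q := congrArg (fun L : ℂ →L[ℝ] ℂ => ContinuousLinearMap.det L) hd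
    rwa [this]
  · rw [hGq, h3, hd', hd']

lemma metric_ext {G G' : Metric S} (h : ∀ x (a b : Tan x), G.inner x a b = G'.inner x a b) :
    G = G' := by
  obtain ⟨i, _⟩ := G
  obtain ⟨i', _⟩ := G'
  have : i = i' := by
    funext x
    exact ContinuousLinearMap.ext fun a => ContinuousLinearMap.ext fun b => h x a b
  subst this
  rfl

variable {F : Type*} [AddCommGroup F] [Module ℂ F] [MeasurableSpace S]
  {C : ConformalFieldTheory S F} {G : Metric S} {w : S} {ζ : S → ℂ} {φ : F}

lemma contDiffAt_quadCoord_emHol [T2Space S] (hG : IsCompatible G) (hζ : IsConformalCoord G ζ w)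
    {x y : S} (hx : x ≠ w) (hy : x ∈ (chartAt ℂ y).source) :
    ContDiffAt ℝ ∞ (quadCoord (emHol C G w ζ φ) y) (chartAt ℂ y x) := by
  refine contDiffAt_quadCoord_change (mem_chart_source ℂ x) hy ?_
  have h := contDiffAt_emTensor (C := C) (φ := φ) hG hζ hx
  refine ((((h 1 1).sub (contDiffAt_const.mul (h I 1) (f := fun _ => 2 * I))).sub (h I I)).mul
    (contDiffAt_const (c := (4⁻¹ : ℂ)))).congr_of_eventuallyEq (Eventually.of_forall fun u => ?_)
  rw [quadCoord, ← emHol_smul]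
  simp only [mul_one, div_eq_mul_inv, mul_comm I (frame _ _)]

lemma contDiffAt_quadCoord_emAnti [T2Space S] (hG : IsCompatible G) (hζ : IsConformalCoord G ζ w)
    {x y : S} (hx : x ≠ w) (hy : x ∈ (chartAt ℂ y).source) :
    ContDiffAt ℝ ∞ (quadCoord (emAnti C G w ζ φ) y) (chartAt ℂ y x) := by
  refine contDiffAt_quadCoord_change (mem_chart_source ℂ x) hy ?_
  have h := contDiffAt_emTensor (C := C) (φ := φ) hG hζ hx
  have h0 := ((((h 1 1).add (contDiffAt_const.mul (h I 1) (f := fun _ => 2 * I))).sub (h I I)).mul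
    (contDiffAt_const (c := (4⁻¹ : ℂ))))
  refine (conjCLE.contDiff.contDiffAt.comp _ h0).congr_of_eventuallyEq
    (Eventually.of_forall fun u => ?_)
  rw [quadCoord, ← emAnti_smul]
  simp only [mul_one, div_eq_mul_inv, mul_comm I (frame _ _)]
  rfl

/-- The variation formula for `⟨φ(w)⟩` in a family of metrics that is constant near `w`. -/
lemma exists_hasFDerivAt_corr (hG : IsCompatible G) (hζ : IsConformalCoord G ζ w) {g : ℂ → Metric S}
    (hg0 : g 0 = G) (hg : SmoothFamily g) {K : Set S} (hK : IsCompact K)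
    (hgK : ∀ᶠ s in 𝓝 (0 : ℂ), ∀ x ∉ K, ∀ a b : Tan x, (g s).inner x a b = G.inner x a b)
    (hw : Kᶜ ∈ 𝓝 w) :
    ∃ D : ℂ →L[ℝ] ℂ, HasFDerivAt (fun s => C.state.corr (g s) 1 ![w] ![ζ] ![φ]) D 0 ∧
      ∀ s, D s = ∫ x, twoPoint C G w ζ φ x (chartAt ℂ x) ((-(1 / 2) : ℂ) •
        contract G x (C.T G (chartAt ℂ x) x) (dMetric g s x)) ∂(dvol G) := by
  subst hg0
  refine C.variation ℂ g 1 ![w] ![ζ] ![φ] (fun x => chartAt ℂ x) hg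
    ⟨Function.injective_of_subsingleton _, fun i => ?_⟩
    (fun x => isConformalCoord_chart hG (mem_chart_source ℂ x)) ⟨K, hK, hgK⟩ fun i => ?_
  · rw [Subsingleton.elim i 0]; exact hζ
  · rw [Subsingleton.elim i 0]
    refine ⟨Kᶜ, hw, ?_⟩
    filter_upwards [hgK] with s hs x hx
    exact ⟨1, one_pos, fun a b => by rw [hs x hx, one_mul]⟩

end Quadratic

/-! ### Weyl's lemma and local diffeomorphisms -/

section WeaklyHolomorphic

lemma integrable_of_tsupport_subset {U : Set ℂ} (hU : IsOpen U) {f : ℂ → ℂ} {K : Set ℂ}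
    (hK : IsCompact K) (hKU : K ⊆ U) (hf : ContinuousOn f U) (h0 : ∀ u ∉ K, f u = 0) :
    Integrable f := by
  have hs : tsupport f ⊆ K := closure_minimal
    (fun u hu => by_contra fun h => hu (h0 u h)) hK.isClosed
  have hc : Continuous f := continuous_of_tsupport fun u hu =>
    hf.continuousAt (hU.mem_nhds (hKU (hs hu)))
  exact hc.integrable_of_hasCompactSupport (hK.of_isClosed_subset (isClosed_tsupport f) hs)

lemma notMem_tsupport_eq_zero {k : ℂ → ℝ} {u : ℂ} (hu : u ∉ tsupport k) :
    k u = 0 ∧ ∀ v, fderiv ℝ k u v = 0 :=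
  ⟨image_eq_zero_of_notMem_tsupport hu, fun v => by rw [fderiv_of_notMem_tsupport ℝ hu]; rfl⟩

/-- Weyl's lemma for smooth functions: a smooth function that is annihilated weakly by the
Cauchy–Riemann operator is holomorphic. -/
lemma differentiableAt_of_forall_integral {U : Set ℂ} (hU : IsOpen U) {q : ℂ → ℂ}
    (hq : ∀ u ∈ U, ContDiffAt ℝ ∞ q u)
    (h : ∀ k : ℂ → ℝ, ContDiff ℝ ∞ k → HasCompactSupport k → tsupport k ⊆ U →
      ∫ u, ((fderiv ℝ k u 1 : ℂ) + I * fderiv ℝ k u I) * q u = 0) {u : ℂ} (hu : u ∈ U) :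
    DifferentiableAt ℂ q u := by
  have hqc : ContinuousOn q U := fun u hu => (hq u hu).continuousAt.continuousWithinAt
  have hqd : ∀ v : ℂ, ContinuousOn (fun u => fderiv ℝ q u v) U := fun v u hu =>
    (((hq u hu).fderiv_right (m := 0) (by simp)).continuousAt.clm_apply
      continuousAt_const).continuousWithinAt
  have hdb : ContinuousOn (fun u => fderiv ℝ q u 1 + I * fderiv ℝ q u I) U :=
    (hqd 1).add (continuousOn_const.mul (hqd I))
  have key : ∀ k : ℂ → ℝ, ContDiff ℝ ∞ k → HasCompactSupport k → tsupport k ⊆ U →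
      ∫ u, k u • (fderiv ℝ q u 1 + I * fderiv ℝ q u I) = 0 := by
    intro k hk hks hkU
    have hkd : ∀ v : ℂ, Continuous fun u => fderiv ℝ k u v := fun v =>
      (hk.continuous_fderiv (by simp)).clm_apply continuous_const
    have i1 : ∀ v : ℂ, Integrable fun u => fderiv ℝ k u v • q u := fun v =>
      integrable_of_tsupport_subset hU hks hkU ((hkd v).continuousOn.smul hqc)
        fun u hu => by rw [(notMem_tsupport_eq_zero hu).2, zero_smul]
    have i2 : ∀ v : ℂ, Integrable fun u => k u • fderiv ℝ q u v := fun v =>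
      integrable_of_tsupport_subset hU hks hkU (hk.continuous.continuousOn.smul (hqd v))
        fun u hu => by rw [(notMem_tsupport_eq_zero hu).1, zero_smul]
    have i3 : Integrable fun u => k u • q u :=
      integrable_of_tsupport_subset hU hks hkU (hk.continuous.continuousOn.smul hqc)
        fun u hu => by rw [(notMem_tsupport_eq_zero hu).1, zero_smul]
    have hp : ∀ v : ℂ, ∫ u, k u • fderiv ℝ q u v = -∫ u, fderiv ℝ k u v • q u := fun v =>
      integral_smul_fderiv_eq_neg_fderiv_smul_of_integrable (i1 v) (i2 v) i3
        (fun x _ => hk.differentiable (by simp) x)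
        (fun x hx => (hq x (hkU hx)).differentiableAt (by simp))
    have e1 : ∀ u, k u • (fderiv ℝ q u 1 + I * fderiv ℝ q u I)
        = k u • fderiv ℝ q u 1 + I * (k u • fderiv ℝ q u I) := fun u => by
      rw [smul_add, mul_smul_comm]
    have e2 : ∀ u, ((fderiv ℝ k u 1 : ℂ) + I * fderiv ℝ k u I) * q u
        = fderiv ℝ k u 1 • q u + I * (fderiv ℝ k u I • q u) := fun u => by
      simp only [real_smul]; ring
    have h0 := h k hk hks hkU
    simp_rw [e2] at h0
    rw [integral_add (i1 1) ((i1 I).const_mul I), integral_const_mul] at h0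
    simp_rw [e1]
    rw [integral_add (i2 1) ((i2 I).const_mul I), integral_const_mul, hp, hp]
    linear_combination -h0
  have hae := hU.ae_eq_zero_of_integral_contDiff_smul_eq_zero
    (hdb.locallyIntegrableOn hU.measurableSet (μ := volume)) key
  have hz := Measure.eqOn_open_of_ae_eq ((ae_restrict_iff' hU.measurableSet).2 hae) hU hdb
    (continuousOn_const (c := (0 : ℂ))) hu
  rw [differentiableAt_complex_iff_differentiableAt_real]
  refine ⟨(hq u hu).differentiableAt (by simp), ?_⟩
  simp only at hz
  rw [smul_eq_mul]
  linear_combination (-I) * hz + fderiv ℝ q u I * I_sq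

end WeaklyHolomorphic

section Perturbation

/-- The displacement of the plane by the compactly supported real function `k` times the vector
`s`. -/
noncomputable def displace (k : ℂ → ℝ) (s u : ℂ) : ℂ := u + k u * s

variable {k : ℂ → ℝ}

lemma displace_eq {s u : ℂ} (hu : u ∉ tsupport k) : displace k s u = u := by
  simp [displace, (notMem_tsupport_eq_zero hu).1]

lemma contDiff_displace (hk : ContDiff ℝ ∞ k) :
    ContDiff ℝ ∞ fun q : ℂ × ℂ => displace k q.1 q.2 := by
  have h : ContDiff ℝ ∞ fun q : ℂ × ℂ => ((k q.2 : ℝ) : ℂ) :=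
    ofRealCLM.contDiff.comp (hk.comp contDiff_snd)
  exact contDiff_snd.add (h.mul contDiff_fst)

lemma hasFDerivAt_displace (hk : ContDiff ℝ ∞ k) (s u : ℂ) :
    HasFDerivAt (displace k s)
      (ContinuousLinearMap.id ℝ ℂ + (fderiv ℝ k u).smulRight s) u := by
  have h := (hk.differentiable (by simp) u).hasFDerivAt
  have h1 := (hasFDerivAt_id (𝕜 := ℝ) u).add (h.smul_const s)
  refine h1.congr_of_eventuallyEq (Eventually.of_forall fun v => ?_)
  simp [displace]

lemma det_displace_pos {s : ℂ} {M : NNReal} (hM : LipschitzWith M k) (hs : ‖s‖ * M < 1) (u : ℂ) :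
    0 < ContinuousLinearMap.det (ContinuousLinearMap.id ℝ ℂ + (fderiv ℝ k u).smulRight s) := by
  have h1 : |fderiv ℝ k u s| < 1 := by
    calc |fderiv ℝ k u s| ≤ ‖fderiv ℝ k u‖ * ‖s‖ := (fderiv ℝ k u).le_opNorm s
      _ ≤ M * ‖s‖ := by gcongr; exact norm_fderiv_le_of_lipschitz ℝ hM
      _ < 1 := by rwa [mul_comm]
  have h2 := clm_apply_re_im (fderiv ℝ k u) s
  have h3 : ContinuousLinearMap.det (ContinuousLinearMap.id ℝ ℂ + (fderiv ℝ k u).smulRight s)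
      = 1 + fderiv ℝ k u s := by
    rw [det_complex, h2]
    simp
    ring
  rw [h3]
  linarith [(abs_lt.1 h1).1]

/-- For a small vector `s` the displacement is a diffeomorphism of the plane. -/
lemma exists_homeomorph_displace (hk : ContDiff ℝ ∞ k) {s : ℂ} {M : NNReal}
    (hM : LipschitzWith M k) (hs : ‖s‖ * M < 1) :
    ∃ θ : ℂ ≃ₜ ℂ, (∀ u, θ u = displace k s u) ∧ ContDiff ℝ ∞ θ.symm := by
  have hap : ApproximatesLinearOn (displace k s)
      ((ContinuousLinearEquiv.refl ℝ ℂ : ℂ ≃L[ℝ] ℂ) : ℂ →L[ℝ] ℂ) univ (‖s‖₊ * M) := by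
    intro u _ v _
    have e1 : displace k s u - displace k s v
        - ((ContinuousLinearEquiv.refl ℝ ℂ : ℂ ≃L[ℝ] ℂ) : ℂ →L[ℝ] ℂ) (u - v)
        = ((k u - k v : ℝ) : ℂ) * s := by
      simp [displace]; ring
    rw [e1, norm_mul, norm_real, mul_comm]
    have := hM.dist_le_mul u v
    rw [Real.dist_eq, dist_eq_norm] at this
    push_cast
    rw [mul_assoc]
    exact mul_le_mul_of_nonneg_left this (norm_nonneg _)
  let θ := hap.toHomeomorph _ (Or.inr (by
    have h1 : ‖(((ContinuousLinearEquiv.refl ℝ ℂ).symm : ℂ ≃L[ℝ] ℂ) : ℂ →L[ℝ] ℂ)‖₊ = 1 :=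
      NNReal.eq ContinuousLinearMap.norm_id
    rw [h1, inv_one]
    exact_mod_cast hs))
  have hθ : ∀ u, θ u = displace k s u := fun u => rfl
  refine ⟨θ, hθ, ?_⟩
  refine θ.contDiff_symm (f₀' := fun u => ContinuousLinearMap.toContinuousLinearEquivOfDetNeZero _
    (det_displace_pos hM hs u).ne') (fun u => ?_) ?_
  · exact hasFDerivAt_displace hk s u
  · exact (contDiff_displace hk).comp (contDiff_const.prodMk contDiff_id)

end Perturbation

section Transport

variable {S : Type*} [TopologicalSpace S] [ChartedSpace ℂ S]

open scoped Classical in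
/-- The map of the surface that is given by `θ` in the chart at `y`, and is the identity outside of
that chart. -/
noncomputable def transport (y : S) (θ : ℂ → ℂ) (x : S) : S :=
  if x ∈ (chartAt ℂ y).source then (chartAt ℂ y).symm (θ (chartAt ℂ y x)) else x

variable {y : S} {θ : ℂ → ℂ} {K : Set ℂ}

lemma transport_of_mem {x : S} (hx : x ∈ (chartAt ℂ y).source) :
    transport y θ x = (chartAt ℂ y).symm (θ (chartAt ℂ y x)) := if_pos hx

lemma transport_of_notMem (hθK : ∀ u ∉ K, θ u = u) {x : S} (hx : x ∉ (chartAt ℂ y).symm '' K) :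
    transport y θ x = x := by
  by_cases hy : x ∈ (chartAt ℂ y).source
  · rw [transport_of_mem hy, hθK, (chartAt ℂ y).left_inv hy]
    exact fun h => hx ⟨_, h, (chartAt ℂ y).left_inv hy⟩
  · exact if_neg hy

/-- An injective map that is the identity outside of a subset `K` of the chart target preserves the
target. -/
lemma mem_target_of_injective (hθ : Function.Injective θ) (hθK : ∀ u ∉ K, θ u = u)
    (hKy : K ⊆ (chartAt ℂ y).target) {u : ℂ} (hu : u ∈ (chartAt ℂ y).target) :
    θ u ∈ (chartAt ℂ y).target := by
  by_cases h : θ u ∈ K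
  · exact hKy h
  · rwa [hθ (hθK _ h)]

lemma transport_transport {θ' : ℂ → ℂ} (hinv : ∀ u, θ' (θ u) = u) (hθ : Function.Injective θ)
    (hθK : ∀ u ∉ K, θ u = u) (hKy : K ⊆ (chartAt ℂ y).target) (x : S) :
    transport y θ' (transport y θ x) = x := by
  by_cases hx : x ∈ (chartAt ℂ y).source
  · have h1 := mem_target_of_injective hθ hθK hKy ((chartAt ℂ y).map_source hx)
    rw [transport_of_mem hx, transport_of_mem ((chartAt ℂ y).map_target h1),
      (chartAt ℂ y).right_inv h1, hinv, (chartAt ℂ y).left_inv hx]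
  · have : transport y θ x = x := if_neg hx
    rw [this]
    exact if_neg hx

lemma isOpen_compl_image [T2Space S] (hK : IsCompact K) (hKy : K ⊆ (chartAt ℂ y).target) :
    IsOpen ((chartAt ℂ y).symm '' K)ᶜ :=
  (hK.image_of_continuousOn ((chartAt ℂ y).continuousOn_symm.mono hKy)).isClosed.isOpen_compl

lemma transport_eventuallyEq_id [T2Space S] (hθK : ∀ u ∉ K, θ u = u) (hK : IsCompact K)
    (hKy : K ⊆ (chartAt ℂ y).target) {x : S} (hx : x ∉ (chartAt ℂ y).symm '' K) :
    transport y θ =ᶠ[𝓝 x] id := by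
  filter_upwards [(isOpen_compl_image hK hKy).mem_nhds hx] with q hq
  exact transport_of_notMem hθK hq

lemma notMem_image_of_notMem_source (hKy : K ⊆ (chartAt ℂ y).target) {x : S}
    (hx : x ∉ (chartAt ℂ y).source) : x ∉ (chartAt ℂ y).symm '' K := by
  rintro ⟨u, hu, rfl⟩
  exact hx ((chartAt ℂ y).map_target (hKy hu))

variable [IsManifold 𝓘(ℂ, ℂ) ω S]

lemma contMDiff_transport [T2Space S] (hθ : Function.Injective θ) (hθs : ContDiff ℝ ∞ θ)
    (hθK : ∀ u ∉ K, θ u = u) (hK : IsCompact K) (hKy : K ⊆ (chartAt ℂ y).target) :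
    ContMDiff 𝓘(ℝ, ℂ) 𝓘(ℝ, ℂ) ∞ (transport y θ : S → S) := by
  intro x
  by_cases hx : x ∈ (chartAt ℂ y).source
  · have h1 : ContMDiffAt 𝓘(ℝ, ℂ) 𝓘(ℝ, ℂ) ∞ (chartAt ℂ y) x :=
      contMDiffAt_of_mem_maximalAtlas (IsManifold.chart_mem_maximalAtlas y) hx
    have ht := mem_target_of_injective hθ hθK hKy ((chartAt ℂ y).map_source hx)
    have h2 : ContMDiffAt 𝓘(ℝ, ℂ) 𝓘(ℝ, ℂ) ∞ (chartAt ℂ y).symm (θ (chartAt ℂ y x)) :=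
      contMDiffAt_symm_of_mem_maximalAtlas (IsManifold.chart_mem_maximalAtlas y) ht
    have h3 : ContMDiffAt 𝓘(ℝ, ℂ) 𝓘(ℝ, ℂ) ∞ θ (chartAt ℂ y x) := hθs.contDiffAt.contMDiffAt
    refine (h2.comp x (h3.comp x h1)).congr_of_eventuallyEq ?_
    filter_upwards [(chartAt ℂ y).open_source.mem_nhds hx] with q hq
    exact transport_of_mem hq
  · exact contMDiffAt_id.congr_of_eventuallyEq
      (transport_eventuallyEq_id hθK hK hKy (notMem_image_of_notMem_source hKy hx))

lemma mfderiv_transport (hθ : Function.Injective θ) (hθs : ContDiff ℝ ∞ θ)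
    (hθK : ∀ u ∉ K, θ u = u) (hKy : K ⊆ (chartAt ℂ y).target) {x : S}
    (hx : x ∈ (chartAt ℂ y).source) (a : ℂ) :
    (mfderiv 𝓘(ℝ, ℂ) 𝓘(ℝ, ℂ) (transport y θ : S → S) x a : ℂ)
      = frame y (transport y θ x) * fderiv ℝ θ (chartAt ℂ y x) ((frame y x)⁻¹ * a) := by
  have ht := mem_target_of_injective hθ hθK hKy ((chartAt ℂ y).map_source hx)
  have hev : (transport y θ : S → S) =ᶠ[𝓝 x]
      (chartAt ℂ y).symm ∘ (fun q => θ (chartAt ℂ y q)) := by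
    filter_upwards [(chartAt ℂ y).open_source.mem_nhds hx] with q hq
    exact transport_of_mem hq
  have hd : MDifferentiableAt 𝓘(ℝ, ℂ) 𝓘(ℝ, ℂ) (fun q => θ (chartAt ℂ y q)) x :=
    ((hθs.differentiable (by simp)) _).mdifferentiableAt.comp x (mdiffAt_chart y hx)
  have h1 : (mfderiv 𝓘(ℝ, ℂ) 𝓘(ℝ, ℂ) (transport y θ : S → S) x : ℂ →L[ℝ] ℂ)
      = mfderiv 𝓘(ℝ, ℂ) 𝓘(ℝ, ℂ) ((chartAt ℂ y).symm ∘ (fun q => θ (chartAt ℂ y q))) x :=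
    hev.mfderiv_eq
  have h2 := mfderiv_comp (I' := 𝓘(ℝ, ℂ)) x (mdiffAt_chart_symm y ht) hd
  have h3 := mfderiv_from_surface hd hx ((frame y x)⁻¹ * a)
  rw [mul_inv_cancel_left₀ (frame_ne_zero hx)] at h3
  have h4 : (fun v => θ (chartAt ℂ y ((chartAt ℂ y).symm v))) =ᶠ[𝓝 (chartAt ℂ y x)] θ := by
    filter_upwards [(chartAt ℂ y).open_target.mem_nhds ((chartAt ℂ y).map_source hx)] with v hv
    rw [(chartAt ℂ y).right_inv hv]
  rw [h4.fderiv_eq] at h3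
  have h5 := DFunLike.congr_fun (h1.trans h2) a
  refine h5.trans ?_
  have h6 := toC_chartVec (S := S) ht (fderiv ℝ θ (chartAt ℂ y x) ((frame y x)⁻¹ * a))
  rw [transport_of_mem hx]
  refine Eq.trans ?_ h6
  rw [h3]
  rfl

end Transport

/-! ### Pulling the metric back by a local diffeomorphism -/

section Pullback

variable {S : Type*} [TopologicalSpace S] [ChartedSpace ℂ S] [IsManifold 𝓘(ℂ, ℂ) ω S]

/-- The pullback of `G` by the displacement `displace k s`, acting in the chart at `y`. -/
noncomputable def pullForm (G : Metric S) (y : S) (k : ℂ → ℝ) (s : ℂ) (x : S) :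
    ℂ →L[ℝ] ℂ →L[ℝ] ℝ :=
  let f : S → S := transport y (displace k s)
  let L : ℂ →L[ℝ] ℂ := mfderiv 𝓘(ℝ, ℂ) 𝓘(ℝ, ℂ) f x
  (metricForm G (f x)).bilinearComp L L

variable {G : Metric S} {y : S} {k : ℂ → ℝ} {M : NNReal}

lemma displace_injective (hk : ContDiff ℝ ∞ k) (hM : LipschitzWith M k) {s : ℂ}
    (hs : ‖s‖ * M < 1) : Function.Injective (displace k s) := by
  obtain ⟨θ, hθ, -⟩ := exists_homeomorph_displace hk hM hs
  rw [← funext hθ]; exact θ.injective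

lemma contDiff_displace_right (hk : ContDiff ℝ ∞ k) (s : ℂ) : ContDiff ℝ ∞ (displace k s) :=
  (contDiff_displace hk).comp (contDiff_const.prodMk contDiff_id)

lemma pullForm_of_mem (hk : ContDiff ℝ ∞ k) (hM : LipschitzWith M k)
    (hky : tsupport k ⊆ (chartAt ℂ y).target) {s : ℂ} (hs : ‖s‖ * M < 1) {u : ℂ}
    (hu : u ∈ (chartAt ℂ y).target) (a b : ℂ) :
    pullForm G y k s ((chartAt ℂ y).symm u) (frame y ((chartAt ℂ y).symm u) * a)
        (frame y ((chartAt ℂ y).symm u) * b)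
      = metricForm G ((chartAt ℂ y).symm (displace k s u))
        (frame y ((chartAt ℂ y).symm (displace k s u)) * (a + fderiv ℝ k u a * s))
        (frame y ((chartAt ℂ y).symm (displace k s u)) * (b + fderiv ℝ k u b * s)) := by
  have hx := (chartAt ℂ y).map_target hu
  have hf := frame_ne_zero hx
  have h := mfderiv_transport (displace_injective hk hM hs) (contDiff_displace_right hk s)
    (fun u hu => displace_eq hu) hky hx
  have ht : transport y (displace k s) ((chartAt ℂ y).symm u)
      = (chartAt ℂ y).symm (displace k s u) := by
    rw [transport_of_mem hx, (chartAt ℂ y).right_inv hu]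
  have e1 : ∀ c : ℂ, (mfderiv 𝓘(ℝ, ℂ) 𝓘(ℝ, ℂ) (transport y (displace k s) : S → S)
      ((chartAt ℂ y).symm u) (frame y ((chartAt ℂ y).symm u) * c : ℂ) : ℂ)
      = frame y ((chartAt ℂ y).symm (displace k s u))
        * (c + ((fderiv ℝ k u c : ℝ) : ℂ) * s) := by
    intro c
    refine (h _).trans ?_
    rw [ht, inv_mul_cancel_left₀ hf, (chartAt ℂ y).right_inv hu,
      (hasFDerivAt_displace hk s u).fderiv]
    simp
    rfl
  rw [← ht]
  rw [← ht] at e1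
  exact congrArg₂ (fun p r : ℂ => metricForm G (transport y (displace k s) _) p r) (e1 a) (e1 b)

lemma pullForm_zero (hky : tsupport k ⊆ (chartAt ℂ y).target) (x : S)
    (a b : ℂ) : pullForm G y k 0 x a b = metricForm G x a b := by
  have h0 : (transport y (displace k 0) : S → S) = id := by
    funext x
    by_cases hx : x ∈ (chartAt ℂ y).source
    · rw [transport_of_mem hx]
      simp [displace, (chartAt ℂ y).left_inv hx]
    · exact transport_of_notMem (fun u hu => displace_eq hu)
        (notMem_image_of_notMem_source hky hx)
  have h1 : (mfderiv 𝓘(ℝ, ℂ) 𝓘(ℝ, ℂ) (transport y (displace k 0) : S → S) x : ℂ →L[ℝ] ℂ)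
      = ContinuousLinearMap.id ℝ ℂ := by rw [h0]; exact mfderiv_id
  have h3 : ∀ c : ℂ, (mfderiv 𝓘(ℝ, ℂ) 𝓘(ℝ, ℂ) (transport y (displace k 0) : S → S) x c : ℂ) = c :=
    fun c => DFunLike.congr_fun h1 c
  refine (congrArg₂ (fun p r : ℂ => metricForm G (transport y (displace k 0) x) p r)
    (h3 a) (h3 b)).trans ?_
  rw [h0]; rfl

/-- The derivative of the pulled back metric. The first term comes from the displacement of the base
point. -/
lemma exists_fderiv_pullForm (hG : IsCompatible G) (hk : ContDiff ℝ ∞ k)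
    (hM : LipschitzWith M k) (hky : tsupport k ⊆ (chartAt ℂ y).target) {u : ℂ}
    (hu : u ∈ (chartAt ℂ y).target) (s : ℂ) :
    ∃ c : ℝ, ∀ a b : ℂ, fderiv ℝ (fun r => pullForm G y k r ((chartAt ℂ y).symm u) a b) 0 s
      = lam G ((chartAt ℂ y).symm u) *
        ((starRingEnd ℂ) (frame y ((chartAt ℂ y).symm u) * s
            * fderiv ℝ k u ((frame y ((chartAt ℂ y).symm u))⁻¹ * a)) * b
          + (starRingEnd ℂ) a * (frame y ((chartAt ℂ y).symm u) * s
            * fderiv ℝ k u ((frame y ((chartAt ℂ y).symm u))⁻¹ * b))).re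
        + c * ((starRingEnd ℂ) a * b).re := by
  set x := (chartAt ℂ y).symm u with hx
  have hxs : x ∈ (chartAt ℂ y).source := (chartAt ℂ y).map_target hu
  set m := frame y x with hm
  have hm0 : m ≠ 0 := frame_ne_zero hxs
  let l : ℂ → ℝ := fun v => lam G ((chartAt ℂ y).symm v) * normSq (frame y ((chartAt ℂ y).symm v))
  have hl : DifferentiableAt ℝ l u := by
    have h1 := smoothFormAt_metric (E := ℝ) (s := 0) G hxs 1 1
    rw [hx, (chartAt ℂ y).right_inv hu] at h1
    have h2 := h1.comp u (contDiffAt_const.prodMk contDiffAt_id :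
      ContDiffAt ℝ ∞ (fun v : ℂ => ((0 : ℝ), v)) u)
    refine (h2.congr_of_eventuallyEq (Eventually.of_forall fun v => ?_)).differentiableAt (by simp)
    simp only [Function.comp, l]
    rw [hG.metricForm_eq]
    simp [normSq_apply]
  have hlu : l u = lam G x * normSq m := rfl
  have hV : {s : ℂ | ‖s‖ * M < 1} ∈ 𝓝 (0 : ℂ) :=
    (isOpen_lt (by fun_prop) continuous_const).mem_nhds (by simp)
  refine ⟨k u * fderiv ℝ l u s * (normSq m)⁻¹, fun a b => ?_⟩
  set a' := m⁻¹ * a with ha'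
  set b' := m⁻¹ * b with hb'
  have ea : a = m * a' := by rw [ha', mul_inv_cancel_left₀ hm0]
  have eb : b = m * b' := by rw [hb', mul_inv_cancel_left₀ hm0]
  have hev : (fun r => pullForm G y k r x a b) =ᶠ[𝓝 0] fun r => l (displace k r u)
      * ((starRingEnd ℂ) (a' + fderiv ℝ k u a' * r) * (b' + fderiv ℝ k u b' * r)).re := by
    filter_upwards [hV] with r hr
    rw [ea, eb]
    refine (pullForm_of_mem hk hM hky hr hu a' b').trans ?_
    rw [hG.metricForm_eq]
    simp only [l, normSq_apply, map_mul, mul_re, mul_im, conj_re, conj_im]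
    ring
  have hd : HasFDerivAt (fun r : ℂ => displace k r u) ((k u) • ContinuousLinearMap.id ℝ ℂ) 0 := by
    have h1 := ((hasFDerivAt_id (𝕜 := ℝ) (0 : ℂ)).const_smul (k u)).const_add u
    refine h1.congr_of_eventuallyEq (Eventually.of_forall fun r => ?_)
    simp [displace]
  have e0 : displace k 0 u = u := by simp [displace]
  have hl' : HasFDerivAt l (fderiv ℝ l u) (displace k 0 u) := by rw [e0]; exact hl.hasFDerivAt
  have h1 := hl'.comp (0 : ℂ) hd
  have hp : ∀ c : ℂ, HasFDerivAt (fun r : ℂ => c + fderiv ℝ k u (c) * r)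
      (((fderiv ℝ k u c : ℝ) : ℂ) • ContinuousLinearMap.id ℝ ℂ) 0 := fun c =>
    ((hasFDerivAt_id (𝕜 := ℝ) (0 : ℂ)).const_smul ((fderiv ℝ k u c : ℝ) : ℂ)).const_add c
  have hpa : HasFDerivAt (fun r : ℂ => (starRingEnd ℂ) (a' + fderiv ℝ k u a' * r))
      ((conjCLE : ℂ →L[ℝ] ℂ) ∘L (((fderiv ℝ k u a' : ℝ) : ℂ) • ContinuousLinearMap.id ℝ ℂ)) 0 :=
    (conjCLE : ℂ →L[ℝ] ℂ).hasFDerivAt.comp (0 : ℂ) (hp a')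
  have h2 := reCLM.hasFDerivAt.comp (0 : ℂ) (hpa.mul (hp b'))
  have h3 := h1.mul h2
  rw [hev.fderiv_eq]
  have h4 := h3.fderiv
  refine (DFunLike.congr_fun h4 s).trans ?_
  have hn : normSq m ≠ 0 := (normSq_pos.2 hm0).ne'
  rw [ea, eb]
  have e1 : ((starRingEnd ℂ) (m * a') * (m * b')).re
      = normSq m * ((starRingEnd ℂ) a' * b').re := by
    simp only [normSq_apply, map_mul, mul_re, mul_im, conj_re, conj_im]; ring
  rw [e1, mul_assoc _ (normSq m)⁻¹, inv_mul_cancel_left₀ hn]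
  simp [e0, hlu]
  simp only [normSq_apply]
  ring

variable [T2Space S]

lemma pullForm_of_notMem (hks : HasCompactSupport k) (hky : tsupport k ⊆ (chartAt ℂ y).target)
    (s : ℂ) {x : S} (hx : x ∉ (chartAt ℂ y).symm '' tsupport k) (a b : ℂ) :
    pullForm G y k s x a b = metricForm G x a b := by
  have hev := transport_eventuallyEq_id (θ := displace k s) (fun u hu => displace_eq hu) hks hky hx
  have h1 : (mfderiv 𝓘(ℝ, ℂ) 𝓘(ℝ, ℂ) (transport y (displace k s) : S → S) x : ℂ →L[ℝ] ℂ)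
      = ContinuousLinearMap.id ℝ ℂ := hev.mfderiv_eq.trans mfderiv_id
  have h2 : transport y (displace k s) x = x := hev.eq_of_nhds
  have h3 : ∀ c : ℂ, (mfderiv 𝓘(ℝ, ℂ) 𝓘(ℝ, ℂ) (transport y (displace k s) : S → S) x c : ℂ) = c :=
    fun c => DFunLike.congr_fun h1 c
  refine (congrArg₂ (fun p r : ℂ => metricForm G (transport y (displace k s) x) p r)
    (h3 a) (h3 b)).trans ?_
  rw [h2]

/-- The metrics pulled back under the displacements depend smoothly on the parameter and the point, in
the chart at `y` and, where nothing is displaced, in any chart. -/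
lemma smoothFormAt_pullForm (hk : ContDiff ℝ ∞ k) (hks : HasCompactSupport k)
    (hM : LipschitzWith M k) (hky : tsupport k ⊆ (chartAt ℂ y).target) {s : ℂ} (hs : ‖s‖ * M < 1)
    (x : S) : ∃ z, x ∈ (chartAt ℂ z).source ∧ SmoothFormAt (pullForm G y k) z s x := by
  by_cases hx : x ∈ (chartAt ℂ y).source
  · refine ⟨y, hx, fun a b => ?_⟩
    have hu := (chartAt ℂ y).map_source hx
    have ht := mem_target_of_injective (displace_injective hk hM hs)
      (fun u hu => displace_eq hu) hky hu
    have hb : ∀ b : ℂ, ContDiffAt ℝ ∞ (fun q : ℂ × ℂ => b + fderiv ℝ k q.2 b * q.1)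
        (s, chartAt ℂ y x) := by
      intro b
      have h1 : ContDiff ℝ ∞ fun u => fderiv ℝ k u b :=
        (hk.fderiv_right (m := ∞) (by simp)).clm_apply contDiff_const
      have h2 : ContDiff ℝ ∞ fun q : ℂ × ℂ => ((fderiv ℝ k q.2 b : ℝ) : ℂ) :=
        ofRealCLM.contDiff.comp (h1.comp contDiff_snd)
      exact (contDiff_const.add (h2.mul contDiff_fst)).contDiffAt
    have key := (smoothFormAt_metric (E := ℝ) (s := 0) G ((chartAt ℂ y).map_target ht)).comp
      (X := ℂ × ℂ) (c := fun q => ((0 : ℝ), displace k q.1 q.2)) (t := (s, chartAt ℂ y x))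
      (by simp only; rw [(chartAt ℂ y).right_inv ht])
      (contDiffAt_const.prodMk (contDiff_displace hk).contDiffAt) (hb a) (hb b)
    refine key.congr_of_eventuallyEq ?_
    have hV : IsOpen {s : ℂ | ‖s‖ * M < 1} := isOpen_lt (by fun_prop) continuous_const
    filter_upwards [(hV.prod (chartAt ℂ y).open_target).mem_nhds (show (s, chartAt ℂ y x) ∈ _ from
      ⟨hs, hu⟩)] with q hq
    exact pullForm_of_mem hk hM hky hq.1 hq.2 a b
  · refine ⟨x, mem_chart_source ℂ x, fun a b => ?_⟩
    have h1 := smoothFormAt_metric (E := ℂ) G (mem_chart_source ℂ x) s a b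
    refine h1.congr_of_eventuallyEq ?_
    have hc : Tendsto (fun q : ℂ × ℂ => (chartAt ℂ x).symm q.2) (𝓝 (s, chartAt ℂ x x)) (𝓝 x) := by
      have h1 := (chartAt ℂ x).continuousAt_symm (mem_chart_target ℂ x)
      rw [ContinuousAt, (chartAt ℂ x).left_inv (mem_chart_source ℂ x)] at h1
      exact h1.comp (continuousAt_snd (p := (s, chartAt ℂ x x)))
    filter_upwards [hc.eventually ((isOpen_compl_image hks hky).mem_nhds
      (notMem_image_of_notMem_source hky hx))] with q hq
    exact pullForm_of_notMem hks hky q.1 hq _ _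

end Pullback

/-! ### Conservation of the energy-momentum tensor -/

section Conservation

lemma metricForm_pos {S : Type*} [TopologicalSpace S] [ChartedSpace ℂ S] [IsManifold 𝓘(ℂ, ℂ) ω S]
    {G : Metric S} {x : S} {a : ℂ} (ha : a ≠ 0) : 0 < metricForm G x a a :=
  G.pos x a ha

variable {S : Type*} [TopologicalSpace S] [ChartedSpace ℂ S] [IsManifold 𝓘(ℂ, ℂ) ω S]
  {F : Type*} [AddCommGroup F] [Module ℂ F] [MeasurableSpace S]
  {C : ConformalFieldTheory S F} {G : Metric S} {w : S} {ζ : S → ℂ} {φ : F} [T2Space S]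
  {y : S} {k : ℂ → ℝ} {M : NNReal}

/-- The one-point function `⟨φ(w)⟩` does not change when the metric is pulled back by a
diffeomorphism that is the identity near `w`. -/
lemma corr_pullback (hζ : IsConformalCoord G ζ w) (hk : ContDiff ℝ ∞ k)
    (hks : HasCompactSupport k) (hM : LipschitzWith M k)
    (hky : tsupport k ⊆ (chartAt ℂ y).target) (hkw : w ∉ (chartAt ℂ y).symm '' tsupport k) {s : ℂ}
    (hs : ‖s‖ * M < 1) {G' : Metric S}
    (hG' : ∀ x (a b : Tan x), G'.inner x a b = pullForm G y k s x (toC a) (toC b)) :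
    C.state.corr G' 1 ![w] ![ζ] ![φ] = C.state.corr G 1 ![w] ![ζ] ![φ] := by
  obtain ⟨θ, hθ, hθs⟩ := exists_homeomorph_displace hk hM hs
  have hθe : (θ : ℂ → ℂ) = displace k s := funext hθ
  have hθK : ∀ u ∉ tsupport k, θ u = u := fun u hu => by rw [hθ, displace_eq hu]
  have hθK' : ∀ u ∉ tsupport k, θ.symm u = u := fun u hu => by
    rw [θ.symm_apply_eq, hθK u hu]
  have hθc : ContDiff ℝ ∞ θ := by rw [hθe]; exact contDiff_displace_right hk s
  let f : Diffeomorph 𝓘(ℝ, ℂ) 𝓘(ℝ, ℂ) S S ∞ :=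
    { toFun := transport y θ
      invFun := transport y θ.symm
      left_inv := transport_transport θ.symm_apply_apply θ.injective hθK hky
      right_inv := transport_transport θ.apply_symm_apply θ.symm.injective hθK' hky
      contMDiff_toFun := contMDiff_transport θ.injective hθc hθK hks hky
      contMDiff_invFun := contMDiff_transport θ.symm.injective hθs hθK' hks hky }
  have hf : (f : S → S) = transport y (displace k s) := by rw [← hθe]; rfl
  have hev : (f : S → S) =ᶠ[𝓝 w] id := transport_eventuallyEq_id hθK hks hky hkw
  have hev' : (f.symm : S → S) =ᶠ[𝓝 w] id := transport_eventuallyEq_id hθK' hks hky hkw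
  have hfw : f w = w := hev.eq_of_nhds
  have hGw : ∀ᶠ q in 𝓝 w, ∀ a b : Tan q, G'.inner q a b = G.inner q a b := by
    filter_upwards [(isOpen_compl_image hks hky).mem_nhds hkw] with q hq a b
    rw [hG']
    exact pullForm_of_notMem hks hky s hq _ _
  have hjac : ∀ x, 0 < jac f x := by
    intro x
    by_cases hx : x ∈ (chartAt ℂ y).source
    · have hfx : f x ∈ (chartAt ℂ y).source := by
        rw [hf, transport_of_mem hx]
        exact (chartAt ℂ y).map_target (mem_target_of_injective (displace_injective hk hM hs)
          (fun u hu => displace_eq hu) hky ((chartAt ℂ y).map_source hx))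
      let N : ℂ →L[ℝ] ℂ := (ContinuousLinearMap.id ℝ ℂ
        + (fderiv ℝ k (chartAt ℂ y x)).smulRight s) ∘L
          ((frame y x)⁻¹ • ContinuousLinearMap.id ℝ ℂ)
      have h1 : jac f x = normSq (frame y (f x)) * ContinuousLinearMap.det N := by
        refine det_complex_mul (M := mfderiv 𝓘(ℝ, ℂ) 𝓘(ℝ, ℂ) f x) fun a => ?_
        have := mfderiv_transport θ.injective hθc hθK hky hx a
        rw [hθe, (hasFDerivAt_displace hk s _).fderiv] at this
        rw [hf]
        exact this
      have h2 : ContinuousLinearMap.det N = ContinuousLinearMap.det (ContinuousLinearMap.id ℝ ℂ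
          + (fderiv ℝ k (chartAt ℂ y x)).smulRight s) * normSq (frame y x)⁻¹ := by
        have e1 : ContinuousLinearMap.det ((frame y x)⁻¹ • ContinuousLinearMap.id ℝ ℂ)
            = normSq (frame y x)⁻¹ := by
          rw [det_complex_mul (M := (frame y x)⁻¹ • ContinuousLinearMap.id ℝ ℂ)
            (L := ContinuousLinearMap.id ℝ ℂ) (m := (frame y x)⁻¹) (fun a => rfl), det_complex]
          simp
        rw [← e1]
        exact LinearMap.det_comp _ _
      rw [h1, h2]
      exact mul_pos (normSq_pos.2 (frame_ne_zero hfx)) (mul_pos (det_displace_pos hM hs _)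
        (normSq_pos.2 (inv_ne_zero (frame_ne_zero hx))))
    · have hid : (f : S → S) =ᶠ[𝓝 x] id :=
        transport_eventuallyEq_id hθK hks hky (notMem_image_of_notMem_source hky hx)
      have h1 : (mfderiv 𝓘(ℝ, ℂ) 𝓘(ℝ, ℂ) f x : ℂ →L[ℝ] ℂ) = ContinuousLinearMap.id ℝ ℂ :=
        hid.mfderiv_eq.trans mfderiv_id
      have h2 : jac f x = ContinuousLinearMap.det (ContinuousLinearMap.id ℝ ℂ) :=
        congrArg (fun L : ℂ →L[ℝ] ℂ => ContinuousLinearMap.det L) h1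
      rw [h2, det_complex]
      simp
  have hζf : ζ ∘ f.symm =ᶠ[𝓝 w] ζ := by
    filter_upwards [hev'] with q hq
    simp only [Function.comp, hq, id]
  have hζ' : IsConformalCoord G' ζ w := hζ.congr (EventuallyEq.refl _ _) hGw
  have hconf : ∀ {H : Metric S} {ξ : S → ℂ}, IsConformalCoord H ξ w → IsConfig H ![w] ![ξ] :=
    fun h => ⟨Function.injective_of_subsingleton _, fun i => by rw [Subsingleton.elim i 0]; exact h⟩
  have h := C.diffeo G' G f 1 ![w] ![ζ] ![φ] hjac (fun x a b => by
    rw [hG', hf]; rfl) (hconf hζ') (fun i => by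
    rw [Subsingleton.elim i 0]
    change IsConformalCoord G' (ζ ∘ f.symm) (f w)
    rw [hfw]
    exact hζ'.congr hζf (Eventually.of_forall fun q a b => rfl))
  rw [← h]
  have e1 : (f : S → S) ∘ ![w] = ![w] := by
    funext i; rw [Subsingleton.elim i 0]; exact hfw
  have e2 : (fun i => (![ζ] : Fin 1 → S → ℂ) i ∘ f.symm) = ![ζ ∘ f.symm] := by
    funext i; rw [Subsingleton.elim i 0]; rfl
  rw [e1, e2]
  have h3 := C.state.corr_coord G 1 ![w] ![ζ] ![ζ ∘ f.symm] ![id] ![φ] (hconf hζ)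
    (hconf (hζ.congr hζf (Eventually.of_forall fun q a b => rfl)))
    (fun i => by rw [Subsingleton.elim i 0]; exact isConformalGerm_id) (fun i => by
      rw [Subsingleton.elim i 0]
      filter_upwards [hζf] with q hq
      change (ζ ∘ f.symm) q - (ζ ∘ f.symm) w = ζ q - ζ w
      rw [hq, hζf.eq_of_nhds])
  rw [← h3]
  congr 1
  funext i
  rw [Subsingleton.elim i 0]
  change φ = C.bundle.ρ id φ
  rw [C.bundle.ρ_id]; rfl

variable [BorelSpace S] [SecondCountableTopology S]

/-- Diffeomorphism invariance, in infinitesimal form: the energy-momentum tensor is conserved in the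
weak sense. -/
lemma integral_quadCoord (hG : IsCompatible G) (hflat : ∀ x, scalarCurvature G x = 0)
    (hζ : IsConformalCoord G ζ w) (hk : ContDiff ℝ ∞ k) (hks : HasCompactSupport k)
    (hky : tsupport k ⊆ (chartAt ℂ y).target) (hkw : w ∉ (chartAt ℂ y).symm '' tsupport k)
    (s : ℂ) :
    ∫ u, (s * (((fderiv ℝ k u 1 : ℂ) + I * fderiv ℝ k u I) * quadCoord (emHol C G w ζ φ) y u)
      + (starRingEnd ℂ) (s * (((fderiv ℝ k u 1 : ℂ) + I * fderiv ℝ k u I)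
        * quadCoord (emAnti C G w ζ φ) y u))) = 0 := by
  obtain ⟨M, hM⟩ := hk.lipschitzWith_of_hasCompactSupport hks (by simp)
  set V : Set ℂ := {s : ℂ | ‖s‖ * M < 1} with hVdef
  have hVo : IsOpen V := isOpen_lt (by fun_prop) continuous_const
  have h0V : (0 : ℂ) ∈ V := by simp [hVdef]
  have hpos : ∀ s ∈ V, ∀ x (a : ℂ), a ≠ 0 → 0 < pullForm G y k s x a a := by
    intro s hs x a ha
    by_cases hx : x ∈ (chartAt ℂ y).source
    · have hu := (chartAt ℂ y).map_source hx
      have hf := frame_ne_zero hx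
      have h1 := pullForm_of_mem (G := G) hk hM hky hs hu ((frame y x)⁻¹ * a) ((frame y x)⁻¹ * a)
      rw [(chartAt ℂ y).left_inv hx, mul_inv_cancel_left₀ hf] at h1
      rw [h1]
      have ht := mem_target_of_injective (displace_injective hk hM hs)
        (fun u hu => displace_eq hu) hky hu
      refine metricForm_pos (mul_ne_zero (frame_ne_zero ((chartAt ℂ y).map_target ht)) ?_)
      intro h0
      have hdet := (det_displace_pos hM hs (chartAt ℂ y x)).ne'
      have hinj := (ContinuousLinearMap.toContinuousLinearEquivOfDetNeZero _ hdet).injective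
      have : (frame y x)⁻¹ * a = 0 := hinj (by rw [map_zero]; exact h0)
      exact mul_ne_zero (inv_ne_zero hf) ha this
    · rw [pullForm_of_notMem hks hky s (notMem_image_of_notMem_source hky hx)]
      exact G.pos x a ha
  have hex : ∀ s ∈ V, ∃ G' : Metric S, ∀ x (a b : Tan x),
      G'.inner x a b = pullForm G y k s x (toC a) (toC b) := fun s hs =>
    exists_metric (pullForm G y k) s (fun x a b => metricForm_symm G _ _ _) (hpos s hs)
      (smoothFormAt_pullForm hk hks hM hky hs)
  classical
  have : Nonempty (Metric S) := ⟨G⟩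
  choose! g hg using hex
  have hg0 : g 0 = G := metric_ext fun x a b => by
    rw [hg 0 h0V]; exact pullForm_zero hky x _ _
  have hVn : V ∈ 𝓝 (0 : ℂ) := hVo.mem_nhds h0V
  have hK := hks.image_of_continuousOn ((chartAt ℂ y).continuousOn_symm.mono hky)
  obtain ⟨D, hD, hDs⟩ := exists_hasFDerivAt_corr (C := C) (φ := φ) hG hζ hg0
    (smoothFamily_of_smoothFormAt g (pullForm G y k) hVo h0V hg
      fun s hs => smoothFormAt_pullForm hk hks hM hky hs) hK
    (by
      filter_upwards [hVn] with s hs x hx a b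
      rw [hg s hs]; exact pullForm_of_notMem hks hky s hx _ _)
    ((isOpen_compl_image hks hky).mem_nhds hkw)
  have hD0 : D = 0 := by
    refine hD.unique ((hasFDerivAt_const (C.state.corr G 1 ![w] ![ζ] ![φ]) (0 : ℂ)).congr_of_eventuallyEq ?_)
    filter_upwards [hVn] with s hs
    exact corr_pullback hζ hk hks hM hky hkw hs (hg s hs)
  have h1 := hDs s
  rw [hD0] at h1
  -- the derivative of the metric vanishes outside of the chart
  have hdm : ∀ x (a b : Tan x), dMetric g s x a b
      = fderiv ℝ (fun r => pullForm G y k r x (toC a) (toC b)) 0 s := by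
    intro x a b
    have : (fun r => (g r).inner x a b) =ᶠ[𝓝 0] fun r => pullForm G y k r x (toC a) (toC b) := by
      filter_upwards [hVn] with r hr
      exact hg r hr x a b
    rw [dMetric, this.fderiv_eq]
  have hout : ∀ x ∉ (chartAt ℂ y).symm '' (chartAt ℂ y).target,
      twoPoint C G w ζ φ x (chartAt ℂ x) ((-(1 / 2) : ℂ) •
        contract G x (C.T G (chartAt ℂ x) x) (dMetric g s x)) = 0 := by
    intro x hx
    rw [(chartAt ℂ y).symm_image_target_eq_source] at hx
    have hz : ∀ a b : Tan x, dMetric g s x a b = 0 := by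
      intro a b
      rw [hdm]
      have : (fun r => pullForm G y k r x (toC a) (toC b)) = fun _ => metricForm G x (toC a) (toC b) := by
        funext r
        exact pullForm_of_notMem hks hky r (notMem_image_of_notMem_source hky hx) _ _
      rw [this, fderiv_const_apply]; rfl
    have := twoPoint_variation (C := C) (w := w) (ζ := ζ) (φ := φ) hG x (hflat x)
      (fun a b => dMetric g s x a b) 0 0 0 (fun a b => (hz a b).trans (by simp))
    refine this.trans ?_
    simp
  rw [← setIntegral_eq_integral_of_forall_compl_eq_zero hout] at h1
  have h2 := h1.trans (integral_dvol_image hG (chartAt ℂ y).open_target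
    contMDiffOn_chart_symm (chartAt ℂ y).open_target.measurableSet Subset.rfl
    (chartAt ℂ y).symm.injOn _)
  have h3 : ∀ u ∈ (chartAt ℂ y).target, density G (chartAt ℂ y).symm u •
      twoPoint C G w ζ φ ((chartAt ℂ y).symm u) (chartAt ℂ ((chartAt ℂ y).symm u))
        ((-(1 / 2) : ℂ) • contract G ((chartAt ℂ y).symm u)
          (C.T G (chartAt ℂ ((chartAt ℂ y).symm u)) ((chartAt ℂ y).symm u))
          (dMetric g s ((chartAt ℂ y).symm u)))
      = -(s * (((fderiv ℝ k u 1 : ℂ) + I * fderiv ℝ k u I) * quadCoord (emHol C G w ζ φ) y u)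
      + (starRingEnd ℂ) (s * (((fderiv ℝ k u 1 : ℂ) + I * fderiv ℝ k u I)
        * quadCoord (emAnti C G w ζ φ) y u))) := by
    intro u hu
    have hxs := (chartAt ℂ y).map_target hu
    have hm0 := frame_ne_zero hxs
    obtain ⟨c, hc⟩ := exists_fderiv_pullForm hG hk hM hky hu s
    rw [density, jac_chart_symm hu, abs_of_nonneg (normSq_nonneg _)]
    have hv := twoPoint_variation (C := C) (w := w) (ζ := ζ) (φ := φ) hG ((chartAt ℂ y).symm u)
      (hflat _) (fun a b => dMetric g s ((chartAt ℂ y).symm u) a b) c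
      (frame y ((chartAt ℂ y).symm u) * s)
      (fun a => fderiv ℝ k u ((frame y ((chartAt ℂ y).symm u))⁻¹ * a))
      (fun a b => (hdm _ a b).trans (hc a b))
    refine (congrArg _ hv).trans ?_
    set m := frame y ((chartAt ℂ y).symm u)
    have hl : (lam G ((chartAt ℂ y).symm u) : ℂ) ≠ 0 := by
      exact_mod_cast (lam_pos G ((chartAt ℂ y).symm u)).ne'
    -- the antilinear part of the differential of `k`, evaluated on `1 / m`
    have e1 : ((normSq m : ℝ) : ℂ) * ((fderiv ℝ k u (m⁻¹ * 1) : ℂ) + I * fderiv ℝ k u (m⁻¹ * I))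
        = m * ((fderiv ℝ k u 1 : ℂ) + I * fderiv ℝ k u I) := by
      have hn : normSq m ≠ 0 := (normSq_pos.2 hm0).ne'
      rw [clm_apply_re_im (fderiv ℝ k u) (m⁻¹ * 1), clm_apply_re_im (fderiv ℝ k u) (m⁻¹ * I)]
      simp only [mul_one, inv_re, inv_im, mul_re, mul_im, I_re, I_im, smul_eq_mul]
      push_cast
      have hn' : ((normSq m : ℝ) : ℂ) ≠ 0 := by exact_mod_cast hn
      field_simp
      conv_rhs => rw [← re_add_im m]
      ring_nf
      simp only [I_sq]
      ring
    have e2 : (starRingEnd ℂ) (((normSq m : ℝ) : ℂ) * ((fderiv ℝ k u (m⁻¹ * 1) : ℂ)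
        + I * fderiv ℝ k u (m⁻¹ * I)))
        = (starRingEnd ℂ) (m * ((fderiv ℝ k u 1 : ℂ) + I * fderiv ℝ k u I)) := by rw [e1]
    rw [map_mul, conj_ofReal] at e2
    rw [real_smul]
    simp only [quadCoord, map_mul, map_pow] at e2 ⊢
    push_cast
    generalize fderiv ℝ k u (m⁻¹ * 1) = X at *
    generalize fderiv ℝ k u (m⁻¹ * I) = Y at *
    field_simp
    linear_combination (-(m * s * emHol C G w ζ φ ((chartAt ℂ y).symm u))) * e1
      - ((starRingEnd ℂ) m * (starRingEnd ℂ) s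
        * (starRingEnd ℂ) (emAnti C G w ζ φ ((chartAt ℂ y).symm u))) * e2
  have h4 := h2.trans (setIntegral_congr_fun (chartAt ℂ y).open_target.measurableSet h3)
  rw [setIntegral_eq_integral_of_forall_compl_eq_zero, integral_neg] at h4
  · simpa using h4
  · intro u hu
    have := (notMem_tsupport_eq_zero (fun h => hu (hky h))).2
    simp [this]

/-- By conservation and Weyl's lemma, the quadratic differentials `⟨T_zz φ(w)⟩ dz²` and the conjugate
of `⟨T_z̄z̄ φ(w)⟩ dz̄²` are holomorphic away from `w`. -/
lemma differentiableAt_quadCoord (hG : IsCompatible G)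
    (hflat : ∀ x, scalarCurvature G x = 0) (hζ : IsConformalCoord G ζ w) {u : ℂ}
    (hu : u ∈ (chartAt ℂ y).target) (huw : (chartAt ℂ y).symm u ≠ w) :
    DifferentiableAt ℂ (quadCoord (emHol C G w ζ φ) y) u ∧
      DifferentiableAt ℂ (quadCoord (emAnti C G w ζ φ) y) u := by
  have hU : IsOpen ((chartAt ℂ y).target ∩ (chartAt ℂ y).symm ⁻¹' {w}ᶜ) :=
    (chartAt ℂ y).isOpen_inter_preimage_symm isOpen_compl_singleton
  set U : Set ℂ := (chartAt ℂ y).target ∩ (chartAt ℂ y).symm ⁻¹' {w}ᶜ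
  have hq : ∀ u ∈ U, ContDiffAt ℝ ∞ (quadCoord (emHol C G w ζ φ) y) u := fun u hu => by
    have := contDiffAt_quadCoord_emHol (C := C) (φ := φ) hG hζ hu.2
      ((chartAt ℂ y).map_target hu.1)
    rwa [(chartAt ℂ y).right_inv hu.1] at this
  have hq' : ∀ u ∈ U, ContDiffAt ℝ ∞ (quadCoord (emAnti C G w ζ φ) y) u := fun u hu => by
    have := contDiffAt_quadCoord_emAnti (C := C) (φ := φ) hG hζ hu.2
      ((chartAt ℂ y).map_target hu.1)
    rwa [(chartAt ℂ y).right_inv hu.1] at this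
  have key : ∀ k : ℂ → ℝ, ContDiff ℝ ∞ k → HasCompactSupport k → tsupport k ⊆ U →
      (∫ u, ((fderiv ℝ k u 1 : ℂ) + I * fderiv ℝ k u I) * quadCoord (emHol C G w ζ φ) y u) = 0 ∧
      (∫ u, ((fderiv ℝ k u 1 : ℂ) + I * fderiv ℝ k u I) * quadCoord (emAnti C G w ζ φ) y u) = 0 := by
    intro k hk hks hkU
    have hkd : ∀ v : ℂ, Continuous fun u => fderiv ℝ k u v := fun v =>
      (hk.continuous_fderiv (by simp)).clm_apply continuous_const
    have hint : ∀ q : ℂ → ℂ, (∀ u ∈ U, ContDiffAt ℝ ∞ q u) →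
        Integrable fun u => ((fderiv ℝ k u 1 : ℂ) + I * fderiv ℝ k u I) * q u := fun q hq =>
      integrable_of_tsupport_subset hU hks hkU
        (((continuous_ofReal.comp (hkd 1)).add
          (continuous_const.mul (continuous_ofReal.comp (hkd I)))).continuousOn.mul
          fun u hu => (hq u hu).continuousAt.continuousWithinAt)
        fun u hu => by simp [(notMem_tsupport_eq_zero hu).2]
    have hkw : w ∉ (chartAt ℂ y).symm '' tsupport k := by
      rintro ⟨v, hv, rfl⟩
      exact (hkU hv).2 rfl
    set X := ∫ u, ((fderiv ℝ k u 1 : ℂ) + I * fderiv ℝ k u I) * quadCoord (emHol C G w ζ φ) y u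
    set Y := ∫ u, ((fderiv ℝ k u 1 : ℂ) + I * fderiv ℝ k u I) * quadCoord (emAnti C G w ζ φ) y u
    have hs : ∀ s : ℂ, s * X + (starRingEnd ℂ) (s * Y) = 0 := by
      intro s
      have h1 := integral_quadCoord (C := C) (φ := φ) hG hflat hζ hk hks
        (hkU.trans inter_subset_left) hkw s
      have i1 := (hint _ hq).const_mul s
      have i2 := (hint _ hq').const_mul s
      have i3 : Integrable fun u => (starRingEnd ℂ) (s * (((fderiv ℝ k u 1 : ℂ)
          + I * fderiv ℝ k u I) * quadCoord (emAnti C G w ζ φ) y u)) :=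
        conjCLE.toContinuousLinearMap.integrable_comp i2
      rw [integral_add i1 i3, integral_conj, integral_const_mul, integral_const_mul] at h1
      exact h1
    have h1 := hs 1
    have h2 := hs I
    simp only [one_mul, map_mul, conj_I] at h1 h2
    have hX : X = 0 := by linear_combination (1 / 2) * h1 - (I / 2) * h2 + (X / 2 - (starRingEnd ℂ) Y / 2) * I_sq
    refine ⟨hX, ?_⟩
    rw [hX, zero_add] at h1
    simpa using h1
  exact ⟨differentiableAt_of_forall_integral hU hq (fun k h1 h2 h3 => (key k h1 h2 h3).1) ⟨hu, huw⟩,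
    differentiableAt_of_forall_integral hU hq' (fun k h1 h2 h3 => (key k h1 h2 h3).2) ⟨hu, huw⟩⟩

end Conservation

/-! ### The tube and the cutoff function -/

section Tube

variable {S : Type*} [TopologicalSpace S] [ChartedSpace ℂ S]

lemma isOpen_strip : IsOpen strip :=
  isOpen_lt (continuous_abs.comp continuous_im) continuous_const

lemma ofReal_mem_strip (t : ℝ) : (t : ℂ) ∈ strip := by simp [strip]

/-- A fundamental domain of the strip for the translation by `1`. -/
def stripDomain : Set ℂ := {u | u.re ∈ Ico (0 : ℝ) 1 ∧ |u.im| < 1}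

lemma measurableSet_stripDomain : MeasurableSet stripDomain :=
  (measurable_re measurableSet_Ico).inter isOpen_strip.measurableSet

lemma stripDomain_subset : stripDomain ⊆ strip := fun _ h => h.2

/-- The translate of `u` with real part in `[0,1)`. -/
lemma sub_floor_mem {u : ℂ} (hu : u ∈ strip) : u - (⌊u.re⌋ : ℤ) ∈ stripDomain := by
  refine ⟨?_, ?_⟩
  · have : (u - (⌊u.re⌋ : ℤ)).re = Int.fract u.re := by
      rw [sub_re, intCast_re, Int.self_sub_floor]
    rw [this]
    exact ⟨Int.fract_nonneg _, Int.fract_lt_one _⟩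
  · have : (u - (⌊u.re⌋ : ℤ)).im = u.im := by simp
    rw [this]
    exact hu

variable {Ψ : ℂ → S}

namespace IsTube

lemma contMDiffAt (hΨ : IsTube Ψ) {u : ℂ} (hu : u ∈ strip) : ContMDiffAt 𝓘(ℝ, ℂ) 𝓘(ℝ, ℂ) ∞ Ψ u :=
  hΨ.smooth.contMDiffAt (isOpen_strip.mem_nhds hu)

lemma mdiffAt (hΨ : IsTube Ψ) {u : ℂ} (hu : u ∈ strip) :
    MDifferentiableAt 𝓘(ℝ, ℂ) 𝓘(ℝ, ℂ) Ψ u :=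
  (hΨ.contMDiffAt hu).mdifferentiableAt (by simp)

lemma continuousAt (hΨ : IsTube Ψ) {u : ℂ} (hu : u ∈ strip) : ContinuousAt Ψ u :=
  (hΨ.contMDiffAt hu).continuousAt

lemma add_intCast (hΨ : IsTube Ψ) {u : ℂ} (hu : u ∈ strip) (n : ℤ) : Ψ (u + n) = Ψ u := by
  have : u + n ∈ strip := by
    simp only [strip, mem_ofPred_eq, add_im, intCast_im, add_zero] at hu ⊢
    exact hu
  exact (hΨ.inj _ this u hu).2 ⟨n, rfl⟩

lemma im_eq (hΨ : IsTube Ψ) {u v : ℂ} (hu : u ∈ strip) (hv : v ∈ strip) (h : Ψ u = Ψ v) :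
    u.im = v.im := by
  obtain ⟨n, rfl⟩ := (hΨ.inj u hu v hv).1 h
  simp

lemma image_stripDomain (hΨ : IsTube Ψ) : Ψ '' stripDomain = tube Ψ := by
  refine Subset.antisymm (image_mono stripDomain_subset) ?_
  rintro _ ⟨u, hu, rfl⟩
  refine ⟨_, sub_floor_mem hu, ?_⟩
  have := hΨ.add_intCast hu (-⌊u.re⌋)
  rw [← this]
  push_cast
  rw [sub_eq_add_neg]

lemma injOn_stripDomain (hΨ : IsTube Ψ) : InjOn Ψ stripDomain := by
  intro u hu v hv h
  obtain ⟨n, rfl⟩ := (hΨ.inj u hu.2 v hv.2).1 h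
  have h1 := hu.1
  have h2 := hv.1
  simp only [add_re, intCast_re, mem_Ico] at h1 h2
  have h3 : (n : ℝ) < 1 := by linarith
  have h4 : (-1 : ℝ) < n := by linarith
  have h5 : n < 1 := by exact_mod_cast h3
  have h6 : -1 < n := by exact_mod_cast h4
  have : n = 0 := by omega
  simp [this]

end IsTube

namespace IsCutoff

variable {W : Set S} {f : S → ℝ}

lemma mem_tube (hW : IsCutoff Ψ W f) {x : S} (hx : x ∉ W) : x ∈ tube Ψ :=
  ((hW.cover.symm ▸ mem_univ x : x ∈ W ∪ tube Ψ)).resolve_left hx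

lemma im_ne_zero (hW : IsCutoff Ψ W f) {u : ℂ} (h : Ψ u ∈ W) : u.im ≠ 0 := fun h0 => by
  refine hW.disjoint u.re (subset_closure ?_)
  rwa [core, show ((u.re : ℝ) : ℂ) = u from Complex.ext rfl (by simp [h0])]

lemma eventuallyEq_one (hW : IsCutoff Ψ W f) (hΨ : IsTube Ψ) {u : ℂ} (hu : u ∈ strip)
    (huW : Ψ u ∈ W) (h : 0 < u.im) : (fun v => f (Ψ v)) =ᶠ[𝓝 u] fun _ => 1 := by
  filter_upwards [(hΨ.continuousAt hu).preimage_mem_nhds (hW.isOpen.mem_nhds huW),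
    isOpen_strip.mem_nhds hu, (isOpen_lt continuous_const continuous_im).mem_nhds h] with v h1 h2 h3
  exact hW.left v h2 h3 h1

lemma eventuallyEq_zero (hW : IsCutoff Ψ W f) (hΨ : IsTube Ψ) {u : ℂ} (hu : u ∈ strip)
    (huW : Ψ u ∈ W) (h : u.im < 0) : (fun v => f (Ψ v)) =ᶠ[𝓝 u] fun _ => 0 := by
  filter_upwards [(hΨ.continuousAt hu).preimage_mem_nhds (hW.isOpen.mem_nhds huW),
    isOpen_strip.mem_nhds hu, (isOpen_lt continuous_im continuous_const).mem_nhds h] with v h1 h2 h3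
  exact hW.right v h2 h3 h1

end IsCutoff

variable [IsManifold 𝓘(ℂ, ℂ) ω S]

namespace IsTube

lemma contDiffAt_chart (hΨ : IsTube Ψ) {u : ℂ} (hu : u ∈ strip) {y : S}
    (hy : Ψ u ∈ (chartAt ℂ y).source) : ContDiffAt ℝ ∞ (fun v => chartAt ℂ y (Ψ v)) u :=
  contMDiffAt_iff_contDiffAt.1
    (((contMDiffOn_chart (I := 𝓘(ℝ, ℂ)) (n := ∞) (x := y)).contMDiffAt
      ((chartAt ℂ y).open_source.mem_nhds hy)).comp u (hΨ.contMDiffAt hu))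

lemma det_ne_zero (hΨ : IsTube Ψ) {u : ℂ} (hu : u ∈ strip) {y : S}
    (hy : Ψ u ∈ (chartAt ℂ y).source) :
    ContinuousLinearMap.det (fderiv ℝ (fun v => chartAt ℂ y (Ψ v)) u) ≠ 0 := by
  have h1 := hΨ.oriented u hu
  rw [jac_eq (hΨ.mdiffAt hu) hy] at h1
  exact right_ne_zero_of_mul h1.ne'

lemma map_nhds (hΨ : IsTube Ψ) {u : ℂ} (hu : u ∈ strip) : map Ψ (𝓝 u) = 𝓝 (Ψ u) := by
  have hy := mem_chart_source ℂ (Ψ u)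
  set y := Ψ u with hyd
  have hd := hΨ.contDiffAt_chart hu hy
  have hs := hd.hasStrictFDerivAt (by simp)
  have hdet := hΨ.det_ne_zero hu hy
  have h2 := hs.map_nhds_eq_of_equiv
    (f' := ContinuousLinearMap.toContinuousLinearEquivOfDetNeZero _ hdet)
  have h3 : Ψ =ᶠ[𝓝 u] (chartAt ℂ y).symm ∘ fun v => chartAt ℂ y (Ψ v) := by
    filter_upwards [(hΨ.continuousAt hu).preimage_mem_nhds
      ((chartAt ℂ y).open_source.mem_nhds hy)] with v hv
    exact ((chartAt ℂ y).left_inv hv).symm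
  rw [map_congr h3, ← map_map, h2]
  exact (chartAt ℂ y).symm_map_nhds_eq hy

lemma isOpen_image (hΨ : IsTube Ψ) {O : Set ℂ} (hO : IsOpen O) (hOs : O ⊆ strip) :
    IsOpen (Ψ '' O) := by
  rw [isOpen_iff_mem_nhds]
  rintro _ ⟨u, hu, rfl⟩
  rw [← hΨ.map_nhds (hOs hu)]
  exact image_mem_map (hO.mem_nhds hu)

lemma isOpen_tube (hΨ : IsTube Ψ) : IsOpen (tube Ψ) := hΨ.isOpen_image isOpen_strip Subset.rfl

end IsTube

/-- A function on the tube that is a smooth function of the transverse coordinate `Im u` is smooth. -/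
lemma contMDiffOn_of_comp (hΨ : IsTube Ψ) {f : S → ℝ} {h : ℝ → ℝ} (hh : ContDiff ℝ ∞ h)
    (hf : ∀ u ∈ strip, f (Ψ u) = h u.im) : ContMDiffOn 𝓘(ℝ, ℂ) 𝓘(ℝ, ℝ) ∞ f (tube Ψ) := by
  rintro _ ⟨u, hu, rfl⟩
  refine ContMDiffAt.contMDiffWithinAt ?_
  have hy := mem_chart_source ℂ (Ψ u)
  set y := Ψ u with hyd
  have hd := hΨ.contDiffAt_chart hu hy
  have hdet := hΨ.det_ne_zero hu hy
  have hder : HasFDerivAt (fun v => chartAt ℂ y (Ψ v))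
      (ContinuousLinearMap.toContinuousLinearEquivOfDetNeZero _ hdet : ℂ →L[ℝ] ℂ) u :=
    (hd.differentiableAt (by simp)).hasFDerivAt
  set L := hd.toOpenPartialHomeomorph _ hder (by simp)
  have hL : ContDiffAt ℝ ∞ L.symm (chartAt ℂ y y) := hd.to_localInverse hder (by simp)
  have hLs : u ∈ L.source := hd.mem_toOpenPartialHomeomorph_source hder (by simp)
  have hLu : L.symm (chartAt ℂ y y) = u := L.left_inv hLs
  have h1 : ContMDiffAt 𝓘(ℝ, ℂ) 𝓘(ℝ, ℝ) ∞ (fun x => h (L.symm (chartAt ℂ y x)).im) y := by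
    have h2 : ContDiffAt ℝ ∞ (fun v => h (L.symm v).im) (chartAt ℂ y y) :=
      hh.contDiffAt.comp _ (imCLM.contDiff.contDiffAt.comp _ hL)
    exact h2.contMDiffAt.comp y ((contMDiffOn_chart (I := 𝓘(ℝ, ℂ)) (n := ∞) (x := y)).contMDiffAt
      ((chartAt ℂ y).open_source.mem_nhds hy))
  refine h1.congr_of_eventuallyEq ?_
  change f =ᶠ[𝓝 (Ψ u)] _
  rw [← hΨ.map_nhds hu]
  change ∀ᶠ v in 𝓝 u, f (Ψ v) = h (L.symm (chartAt ℂ y (Ψ v))).im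
  filter_upwards [isOpen_strip.mem_nhds hu, L.open_source.mem_nhds hLs] with v hv hv'
  rw [hf v hv]
  have : L.symm (chartAt ℂ y (Ψ v)) = v := L.left_inv hv'
  rw [this]

/-- Cut and reglue data away from `w`: the complement of a thin closed neighbourhood of the curve, with
a smooth step function of `Im u`. -/
lemma exists_isCutoff (hΨ : IsTube Ψ) [T2Space S] {w : S} (hw : ∀ t : ℝ, w ≠ core Ψ t) :
    ∃ (W : Set S) (f : S → ℝ), IsCutoff Ψ W f ∧ w ∈ W := by
  obtain ⟨δ, hδ0, hδ1, hδw⟩ : ∃ δ : ℝ, 0 < δ ∧ δ < 1 ∧ ∀ u ∈ strip, Ψ u = w → δ < |u.im| := by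
    by_cases h : w ∈ tube Ψ
    · obtain ⟨u, hu, rfl⟩ := h
      have h0 : 0 < |u.im| := by
        rw [abs_pos]
        intro h0
        refine hw u.re ?_
        rw [core, show ((u.re : ℝ) : ℂ) = u from Complex.ext rfl (by simp [h0])]
      have hu' : |u.im| < 1 := hu
      refine ⟨|u.im| / 2, by positivity, by linarith, fun v hv h => ?_⟩
      rw [hΨ.im_eq hv hu h]
      linarith
    · exact ⟨1 / 2, by norm_num, by norm_num, fun u hu h' => (h ⟨u, hu, h'⟩).elim⟩
  set h : ℝ → ℝ := fun t => Real.smoothTransition ((t + δ) / (2 * δ)) with hh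
  have hsm : ContDiff ℝ ∞ h := Real.smoothTransition.contDiff.comp (by fun_prop)
  have himg : Ψ '' {u | |u.im| ≤ δ} = Ψ '' (Icc 0 1 ×ℂ Icc (-δ) δ) := by
    apply Subset.antisymm
    · rintro _ ⟨u, hu, rfl⟩
      have hs : u ∈ strip := lt_of_le_of_lt hu hδ1
      have hm := sub_floor_mem hs
      refine ⟨_, ⟨⟨hm.1.1, hm.1.2.le⟩, ?_⟩, ?_⟩
      · simpa using abs_le.1 hu
      · rw [← hΨ.add_intCast hs (-⌊u.re⌋)]
        push_cast
        rw [sub_eq_add_neg]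
    · refine image_mono fun u hu => ?_
      exact abs_le.2 hu.2
  have hsub : {u : ℂ | |u.im| ≤ δ} ⊆ strip := fun u hu => lt_of_le_of_lt hu hδ1
  have hK : IsCompact (Ψ '' {u | |u.im| ≤ δ}) := by
    rw [himg]
    refine (isCompact_Icc.reProdIm isCompact_Icc).image_of_continuousOn fun u hu => ?_
    exact (hΨ.continuousAt (hsub (abs_le.2 hu.2))).continuousWithinAt
  -- the parameter `Im u` as a function on the tube
  have hex : ∃ f : S → ℝ, ∀ u ∈ strip, f (Ψ u) = h u.im := by
    classical
    refine ⟨fun x => if hx : x ∈ tube Ψ then h hx.choose.im else 0, fun u hu => ?_⟩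
    have hx : Ψ u ∈ tube Ψ := ⟨u, hu, rfl⟩
    simp only [dif_pos hx]
    rw [hΨ.im_eq hx.choose_spec.1 hu hx.choose_spec.2]
  obtain ⟨f, hf⟩ := hex
  have hmem : ∀ u ∈ strip, Ψ u ∈ (Ψ '' {u | |u.im| ≤ δ})ᶜ → δ < |u.im| := fun u hu h1 => by
    by_contra h2
    exact h1 ⟨u, not_lt.1 h2, rfl⟩
  refine ⟨(Ψ '' {u | |u.im| ≤ δ})ᶜ, f, ⟨hK.isClosed.isOpen_compl, fun t ht => ?_, ?_, ?_,
    contMDiffOn_of_comp hΨ hsm hf, ?_, fun u hu h0 h1 => ?_, fun u hu h0 h1 => ?_⟩, ?_⟩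
  · have ho : IsOpen (Ψ '' {u | |u.im| < δ}) :=
      hΨ.isOpen_image (isOpen_lt (continuous_abs.comp continuous_im) continuous_const)
        fun u hu => lt_trans hu hδ1
    obtain ⟨_, ⟨u, hu, rfl⟩, h1⟩ := mem_closure_iff.1 ht _ ho ⟨(t : ℂ), by simpa using hδ0, rfl⟩
    exact h1 ⟨u, (le_of_lt hu : |u.im| ≤ δ), rfl⟩
  · refine eq_univ_of_forall fun x => ?_
    by_cases hx : x ∈ Ψ '' {u | |u.im| ≤ δ}
    · exact Or.inr (image_mono hsub hx)
    · exact Or.inl hx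
  · rwa [compl_compl]
  · rintro _ ⟨u, hu, rfl⟩
    rw [hf u hu]
    exact ⟨Real.smoothTransition.nonneg _, Real.smoothTransition.le_one _⟩
  · have := hmem u hu h1
    rw [abs_of_pos h0] at this
    rw [hf u hu, hh]
    refine Real.smoothTransition.one_of_one_le ?_
    rw [le_div_iff₀ (by positivity)]
    linarith
  · have := hmem u hu h1
    rw [abs_of_neg h0] at this
    rw [hf u hu, hh]
    refine Real.smoothTransition.zero_of_nonpos (div_nonpos_of_nonpos_of_nonneg ?_ (by positivity))
    linarith
  · rintro ⟨u, hu, h1⟩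
    exact absurd (hδw u (hsub hu) h1) (not_lt.2 hu)

namespace IsCutoff

variable {W : Set S} {f : S → ℝ}

lemma contMDiffAt (hW : IsCutoff Ψ W f) (hΨ : IsTube Ψ) {x : S} (hx : x ∈ tube Ψ) :
    ContMDiffAt 𝓘(ℝ, ℂ) 𝓘(ℝ, ℝ) ∞ f x :=
  hW.smooth.contMDiffAt (hΨ.isOpen_tube.mem_nhds hx)

/-- The cutoff function is locally constant on the overlap of `W` with the tube. -/
lemma dR_eq_zero (hW : IsCutoff Ψ W f) (hΨ : IsTube Ψ) {x : S} (hx : x ∈ tube Ψ) (hxW : x ∈ W) :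
    dR f x = 0 := by
  obtain ⟨u, hu, rfl⟩ := hx
  obtain ⟨c, hc⟩ : ∃ c : ℝ, f =ᶠ[𝓝 (Ψ u)] fun _ => c := by
    rcases (hW.im_ne_zero hxW).lt_or_gt with h | h
    · refine ⟨0, ?_⟩
      rw [← hΨ.map_nhds hu]
      exact hW.eventuallyEq_zero hΨ hu hxW h
    · refine ⟨1, ?_⟩
      rw [← hΨ.map_nhds hu]
      exact hW.eventuallyEq_one hΨ hu hxW h
  rw [dR, hc.mfderiv_eq]
  exact mfderiv_const

/-- By compactness, the part of the tube outside of `W` stays away from the ends of the tube. -/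
lemma exists_im_lt (hW : IsCutoff Ψ W f) (hΨ : IsTube Ψ) :
    ∃ δ : ℝ, 0 < δ ∧ δ < 1 ∧ ∀ u ∈ strip, Ψ u ∉ W → |u.im| < δ := by
  have hlt : ∀ n : ℕ, 1 - 1 / ((n : ℝ) + 2) < 1 := fun n => by
    have : 0 < 1 / ((n : ℝ) + 2) := by positivity
    linarith
  have ho : ∀ n : ℕ, IsOpen (Ψ '' {u | |u.im| < 1 - 1 / ((n : ℝ) + 2)}) := fun n =>
    hΨ.isOpen_image (isOpen_lt (continuous_abs.comp continuous_im) continuous_const)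
      fun u hu => lt_trans hu (hlt n)
  obtain ⟨n, hn⟩ := hW.compact.elim_directed_cover _ ho (fun x hx => by
    obtain ⟨u, hu, rfl⟩ := hW.mem_tube hx
    obtain ⟨n, hn⟩ := exists_nat_one_div_lt (sub_pos.2 (show |u.im| < 1 from hu))
    refine mem_iUnion.2 ⟨n, u, ?_, rfl⟩
    have h1 : 1 / ((n : ℝ) + 2) ≤ 1 / ((n : ℝ) + 1) := by gcongr; norm_num
    change |u.im| < 1 - 1 / ((n : ℝ) + 2)
    linarith) (directed_of_isDirected_le fun m n hmn => image_mono fun u hu => by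
      change |u.im| < 1 - 1 / ((n : ℝ) + 2)
      refine lt_of_lt_of_le hu ?_
      gcongr)
  refine ⟨1 - 1 / ((n : ℝ) + 2), ?_, hlt n, fun u hu hx => ?_⟩
  · rw [sub_pos, div_lt_one (by positivity)]
    have : (0 : ℝ) ≤ n := n.cast_nonneg
    linarith
  · obtain ⟨v, hv, h⟩ := hn hx
    rw [hΨ.im_eq hu (lt_trans hv (hlt n)) h.symm]
    exact hv

end IsCutoff

end Tube

/-! ### The reglued metrics -/

section VectorField

variable {S : Type*} [TopologicalSpace S] [ChartedSpace ℂ S]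

/-- The coefficient, in the preferred chart at `y`, of a vector field. -/
noncomputable def vecCoord (A : (x : S) → TangentSpace 𝓘(ℂ, ℂ) x) (y : S) (u : ℂ) : ℂ :=
  toC (real (A ((chartAt ℂ y).symm u))) / frame y ((chartAt ℂ y).symm u)

variable [IsManifold 𝓘(ℂ, ℂ) ω S] {A : (x : S) → TangentSpace 𝓘(ℂ, ℂ) x} {R : Set S} {x y : S}

lemma frame_mul_vecCoord {u : ℂ} (hu : u ∈ (chartAt ℂ y).target) :
    frame y ((chartAt ℂ y).symm u) * vecCoord A y u = toC (real (A ((chartAt ℂ y).symm u))) :=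
  mul_div_cancel₀ _ (frame_ne_zero ((chartAt ℂ y).map_target hu))

lemma trivializationAt_vec (hx : x ∈ (chartAt ℂ y).source) (v : ℂ) :
    (trivializationAt ℂ (TangentSpace 𝓘(ℂ, ℂ)) y (⟨x, v⟩ : TangentBundle 𝓘(ℂ, ℂ) S)).2
      = v / frame y x := by
  have hxx := mem_chart_source ℂ x
  have h2 := hasDerivAt_coordChange ((chartAt ℂ x).map_source hxx) (y := y)
    (by rwa [(chartAt ℂ x).left_inv hxx])
  have h3 := frame_mul hxx hx
  rw [frame_self] at h3
  rw [TangentBundle.trivializationAt_apply]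
  simp only [mfld_simps, fderivWithin_univ]
  change fderiv ℂ (coordChange x y) (chartAt ℂ x x) v = _
  rw [h2.hasFDerivAt.fderiv, eq_div_iff (frame_ne_zero hx)]
  simp only [ContinuousLinearMap.toSpanSingleton_apply, smul_eq_mul]
  linear_combination -v * h3

lemma differentiableAt_vecCoord (hR : IsOpen R)
    (hA : MDifferentiableOn 𝓘(ℂ, ℂ) 𝓘(ℂ, ℂ).tangent
      (fun x => (⟨x, A x⟩ : TangentBundle 𝓘(ℂ, ℂ) S)) R) (hx : x ∈ R)
    (hy : x ∈ (chartAt ℂ y).source) : DifferentiableAt ℂ (vecCoord A y) (chartAt ℂ y x) := by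
  have h1 := (hA x hx).mdifferentiableAt (hR.mem_nhds hx)
  have h2 := ((trivializationAt ℂ (TangentSpace 𝓘(ℂ, ℂ)) y).mdifferentiableAt_section_iff
    𝓘(ℂ, ℂ) A (by simpa using hy)).1 h1
  have hu := (chartAt ℂ y).map_source hy
  have h3 : MDifferentiableAt 𝓘(ℂ, ℂ) 𝓘(ℂ, ℂ) (chartAt ℂ y).symm (chartAt ℂ y x) :=
    mdifferentiableAt_atlas_symm (chart_mem_atlas ℂ y) hu
  have h4 := MDifferentiableAt.comp (chartAt ℂ y x)
    (by rwa [(chartAt ℂ y).left_inv hy]) h3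
  refine h4.differentiableAt.congr_of_eventuallyEq ?_
  filter_upwards [(chartAt ℂ y).open_target.mem_nhds hu] with v hv
  exact (trivializationAt_vec ((chartAt ℂ y).map_target hv) _).symm

lemma contDiffAt_vecCoord (hR : IsOpen R)
    (hA : MDifferentiableOn 𝓘(ℂ, ℂ) 𝓘(ℂ, ℂ).tangent
      (fun x => (⟨x, A x⟩ : TangentBundle 𝓘(ℂ, ℂ) S)) R) (hx : x ∈ R)
    (hy : x ∈ (chartAt ℂ y).source) : ContDiffAt ℝ ∞ (vecCoord A y) (chartAt ℂ y x) := by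
  have hU : IsOpen ((chartAt ℂ y).target ∩ (chartAt ℂ y).symm ⁻¹' R) :=
    (chartAt ℂ y).isOpen_inter_preimage_symm hR
  have hd : DifferentiableOn ℂ (vecCoord A y) ((chartAt ℂ y).target ∩ (chartAt ℂ y).symm ⁻¹' R) := by
    rintro u ⟨hu, huR⟩
    have := differentiableAt_vecCoord hR hA huR ((chartAt ℂ y).map_target hu)
    rw [(chartAt ℂ y).right_inv hu] at this
    exact this.differentiableWithinAt
  have hxu : chartAt ℂ y x ∈ (chartAt ℂ y).target ∩ (chartAt ℂ y).symm ⁻¹' R :=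
    ⟨(chartAt ℂ y).map_source hy, by rwa [mem_preimage, (chartAt ℂ y).left_inv hy]⟩
  exact ((hd.contDiffOn hU (n := ∞)).contDiffAt (hU.mem_nhds hxu)).restrict_scalars ℝ

end VectorField

section Reglue

variable {S : Type*} [TopologicalSpace S] [ChartedSpace ℂ S]

/-- The differential of a function, as a linear form on the plane `Tan x = ℂ`. -/
noncomputable def differential (f : S → ℝ) (x : S) : ℂ →L[ℝ] ℝ := dR f x

/-- The infinitesimal displacement `a ↦ a + s df(a) A` of the tangent plane at `x`. -/
noncomputable def displaceTan (A : (x : S) → TangentSpace 𝓘(ℂ, ℂ) x) (f : S → ℝ) (s : ℂ) (x : S) :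
    ℂ →L[ℝ] ℂ :=
  ContinuousLinearMap.id ℝ ℂ + (differential f x).smulRight (s * toC (real (A x)))

lemma displaceTan_apply (A : (x : S) → TangentSpace 𝓘(ℂ, ℂ) x) (f : S → ℝ) (s : ℂ) (x : S) (a : ℂ) :
    displaceTan A f s x a = a + s * toC (real (A x)) * (differential f x a : ℝ) := by
  rw [mul_comm, ← real_smul]
  rfl

variable [IsManifold 𝓘(ℂ, ℂ) ω S]

open Classical in
/-- The reglued metric, as a family of bilinear forms: on the tube `R` the form `ρ |d(z + s f)|²`,
written as the pullback of the compatible metric `G` under `displaceTan`, and `G` elsewhere. -/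
noncomputable def reglueForm (G : Metric S) (A : (x : S) → TangentSpace 𝓘(ℂ, ℂ) x) (R : Set S)
    (f : S → ℝ) (s : ℂ) (x : S) : ℂ →L[ℝ] ℂ →L[ℝ] ℝ :=
  if x ∈ R then lam G x •
    (innerSL ℝ : ℂ →L[ℝ] ℂ →L[ℝ] ℝ).bilinearComp (displaceTan A f s x) (displaceTan A f s x)
  else metricForm G x

variable {G : Metric S} {A : (x : S) → TangentSpace 𝓘(ℂ, ℂ) x} {R : Set S} {f : S → ℝ} {x y : S}

lemma reglueForm_of_mem (hx : x ∈ R) (s a b : ℂ) :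
    reglueForm G A R f s x a b = lam G x *
      ((starRingEnd ℂ) (displaceTan A f s x a) * displaceTan A f s x b).re := by
  rw [reglueForm, if_pos hx]
  rw [mul_comm ((starRingEnd ℂ) _)]
  rfl

lemma reglueForm_of_notMem (hx : x ∉ R) (s : ℂ) : reglueForm G A R f s x = metricForm G x := by
  rw [reglueForm, if_neg hx]

lemma reglueForm_symm (s : ℂ) (x : S) (a b : ℂ) :
    reglueForm G A R f s x a b = reglueForm G A R f s x b a := by
  by_cases hx : x ∈ R
  · rw [reglueForm_of_mem hx, reglueForm_of_mem hx]
    simp only [mul_re, conj_re, conj_im]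
    ring
  · rw [reglueForm_of_notMem hx]
    exact metricForm_symm G x a b

lemma reglueForm_of_differential_eq_zero (hG : IsCompatible G) (h : x ∈ R → differential f x = 0)
    (s : ℂ) : reglueForm G A R f s x = metricForm G x := by
  by_cases hx : x ∈ R
  · ext1 a; ext1 b
    rw [reglueForm_of_mem hx, hG.metricForm_eq]
    simp [displaceTan_apply, h hx]
  · rw [reglueForm_of_notMem hx]

lemma reglueForm_zero (hG : IsCompatible G) (x : S) :
    reglueForm G A R f 0 x = metricForm G x := by
  by_cases hx : x ∈ R
  · ext1 a; ext1 b
    rw [reglueForm_of_mem hx, hG.metricForm_eq]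
    simp only [displaceTan_apply, zero_mul, add_zero]
  · rw [reglueForm_of_notMem hx]

lemma reglueForm_pos {s : ℂ} (hs : ∀ x ∈ R, |differential f x (s * toC (real (A x)))| < 1) (x : S)
    (a : ℂ) (ha : a ≠ 0) : 0 < reglueForm G A R f s x a a := by
  by_cases hx : x ∈ R
  · rw [reglueForm_of_mem hx]
    refine mul_pos (lam_pos G x) ?_
    rw [← normSq_eq_conj_mul_self, ofReal_re, normSq_pos, displaceTan_apply]
    intro h0
    -- a kernel vector of `a ↦ a + β(a) v` is a multiple of `v`, and then `1 + β(v) = 0`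
    have h1 := hs x hx
    set β := differential f x
    set v : ℂ := s * toC (real (A x))
    have h2 : β a * (1 + β v) = 0 := by
      have := congrArg β h0
      rw [map_zero, map_add, mul_comm, ← real_smul, map_smul, smul_eq_mul] at this
      linear_combination this
    rcases mul_eq_zero.1 h2 with h3 | h3
    · rw [h3] at h0
      exact ha (by simpa using h0)
    · rw [show β v = -1 by linarith] at h1
      norm_num at h1
  · rw [reglueForm_of_notMem hx]
    exact metricForm_pos ha

lemma fderiv_reglueForm (hx : x ∈ R) (s a b : ℂ) :
    fderiv ℝ (fun r => reglueForm G A R f r x a b) 0 s = lam G x *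
      ((starRingEnd ℂ) (s * toC (real (A x)) * (differential f x a : ℝ)) * b
        + (starRingEnd ℂ) a * (s * toC (real (A x)) * (differential f x b : ℝ))).re := by
  have h1 : ∀ c : ℂ, HasFDerivAt (fun r : ℂ => displaceTan A f r x c)
      ((toC (real (A x)) * (differential f x c : ℝ)) • ContinuousLinearMap.id ℝ ℂ) 0 := by
    intro c
    simp only [displaceTan_apply]
    have := ((hasFDerivAt_id (𝕜 := ℝ) (0 : ℂ)).const_mul
      (toC (real (A x)) * (differential f x c : ℝ))).const_add c
    refine this.congr_of_eventuallyEq (Eventually.of_forall fun r => ?_)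
    simp only [id]
    ring
  have h2 := ((reCLM.hasFDerivAt.comp _ ((conjCLE.hasFDerivAt.comp _ (h1 a)).mul (h1 b))).const_mul
    (lam G x)).congr_of_eventuallyEq (f₁ := fun r => reglueForm G A R f r x a b)
      (Eventually.of_forall fun r => reglueForm_of_mem hx r a b)
  rw [h2.fderiv]
  simp only [add_apply, smul_apply, ContinuousLinearMap.comp_apply, displaceTan_apply, zero_mul,
    add_zero, Function.comp, smul_eq_mul, ContinuousLinearEquiv.coe_coe, conjCLE_apply, reCLM_apply,
    ContinuousLinearMap.id_apply]
  congr 2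
  simp only [map_mul, conj_ofReal]
  ring

lemma contDiffAt_differential (hf : ContMDiffAt 𝓘(ℝ, ℂ) 𝓘(ℝ, ℝ) ∞ f x)
    (hy : x ∈ (chartAt ℂ y).source) :
    ContDiffAt ℝ ∞ (fun u => f ((chartAt ℂ y).symm u)) (chartAt ℂ y x) := by
  have hu := (chartAt ℂ y).map_source hy
  refine contMDiffAt_iff_contDiffAt.1 (ContMDiffAt.comp (chartAt ℂ y x) ?_
    ((contMDiffOn_chart_symm (I := 𝓘(ℝ, ℂ)) (n := ∞) (x := y)).contMDiffAt
      ((chartAt ℂ y).open_target.mem_nhds hu)))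
  rwa [(chartAt ℂ y).left_inv hy]

lemma differential_frame_mul (hf : ContMDiffAt 𝓘(ℝ, ℂ) 𝓘(ℝ, ℝ) ∞ f x)
    (hy : x ∈ (chartAt ℂ y).source) (a : ℂ) :
    differential f x (frame y x * a)
      = fderiv ℝ (fun u => f ((chartAt ℂ y).symm u)) (chartAt ℂ y x) a :=
  (mfderiv_from_surface (hf.mdifferentiableAt (by simp)) hy a).symm

/-- The reglued metrics depend smoothly on the parameter and the point. -/
lemma smoothFormAt_reglueForm (hG : IsCompatible G) (hR : IsOpen R)
    (hA : MDifferentiableOn 𝓘(ℂ, ℂ) 𝓘(ℂ, ℂ).tangent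
      (fun x => (⟨x, A x⟩ : TangentBundle 𝓘(ℂ, ℂ) S)) R)
    (hf : ContMDiffOn 𝓘(ℝ, ℂ) 𝓘(ℝ, ℝ) ∞ f R) (hx : x ∈ R) (s : ℂ) :
    SmoothFormAt (reglueForm G A R f) x s x := by
  have hxx := mem_chart_source ℂ x
  have hu := (chartAt ℂ x).map_source hxx
  intro a b
  have h1 : ContDiffAt ℝ ∞ (fun q : ℂ × ℂ => metricForm G ((chartAt ℂ x).symm q.2)
      (frame x ((chartAt ℂ x).symm q.2) * 1) (frame x ((chartAt ℂ x).symm q.2) * 1))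
      (s, chartAt ℂ x x) := smoothFormAt_metric G hxx s 1 1
  have h2 : ContDiffAt ℝ ∞ (fun q : ℂ × ℂ => vecCoord A x q.2) (s, chartAt ℂ x x) :=
    (contDiffAt_vecCoord hR hA hx hxx).comp (s, chartAt ℂ x x) contDiffAt_snd
  have h3 : ∀ c : ℂ, ContDiffAt ℝ ∞ (fun q : ℂ × ℂ =>
      fderiv ℝ (fun u => f ((chartAt ℂ x).symm u)) q.2 c) (s, chartAt ℂ x x) := fun c =>
    ContDiffAt.comp (g := fun u => fderiv ℝ (fun u => f ((chartAt ℂ x).symm u)) u c)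
      (s, chartAt ℂ x x) (((contDiffAt_differential (hf.contMDiffAt (hR.mem_nhds hx)) hxx).fderiv_right
        (m := ∞) (by simp)).clm_apply contDiffAt_const) contDiffAt_snd
  have h4 : ∀ c : ℂ, ContDiffAt ℝ ∞ (fun q : ℂ × ℂ => c + q.1 * vecCoord A x q.2
      * (fderiv ℝ (fun u => f ((chartAt ℂ x).symm u)) q.2 c : ℝ)) (s, chartAt ℂ x x) := fun c =>
    contDiffAt_const.add ((contDiffAt_fst.mul h2).mul (ofRealCLM.contDiff.contDiffAt.comp _ (h3 c)))
  have h5 := h1.mul (reCLM.contDiff.contDiffAt.comp _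
    ((conjCLE.contDiff.contDiffAt.comp _ (h4 a)).mul (h4 b)))
  refine h5.congr_of_eventuallyEq ?_
  have hn : ∀ᶠ q : ℂ × ℂ in 𝓝 (s, chartAt ℂ x x),
      q.2 ∈ (chartAt ℂ x).target ∩ (chartAt ℂ x).symm ⁻¹' R :=
    continuousAt_snd.preimage_mem_nhds (((chartAt ℂ x).isOpen_inter_preimage_symm hR).mem_nhds
      ⟨hu, by rwa [mem_preimage, (chartAt ℂ x).left_inv hxx]⟩)
  filter_upwards [hn] with q hq
  have hd : ∀ c, differential f ((chartAt ℂ x).symm q.2) (frame x ((chartAt ℂ x).symm q.2) * c)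
      = fderiv ℝ (fun u => f ((chartAt ℂ x).symm u)) q.2 c := fun c => by
    rw [differential_frame_mul (hf.contMDiffAt (hR.mem_nhds hq.2)) ((chartAt ℂ x).map_target hq.1),
      (chartAt ℂ x).right_inv hq.1]
  rw [reglueForm_of_mem (show (chartAt ℂ x).symm q.2 ∈ R from hq.2), displaceTan_apply, displaceTan_apply, hd, hd,
    ← frame_mul_vecCoord hq.1, hG.metricForm_eq]
  simp
  ring

end Reglue

section RegluedFamily

variable {S : Type*} [TopologicalSpace S] [ChartedSpace ℂ S] [IsManifold 𝓘(ℂ, ℂ) ω S]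
  {G : Metric S} {A : (x : S) → TangentSpace 𝓘(ℂ, ℂ) x} {f : S → ℝ} {Ψ : ℂ → S} {W : Set S}

lemma isReglued_iff (hG : IsCompatible G) (hΨ : IsTube Ψ)
    (hA : IsMetricPreservingField G (tube Ψ) A) (hW : IsCutoff Ψ W f) {s : ℂ} {G' : Metric S} :
    IsReglued G A W f s G' ↔
      ∀ x (a b : Tan x), G'.inner x a b = reglueForm G A (tube Ψ) f s x (toC a) (toC b) := by
  have h1 : ∀ x ∈ W, ∀ a b : Tan x, G.inner x a b
      = reglueForm G A (tube Ψ) f s x (toC a) (toC b) := fun x hx a b => by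
    rw [reglueForm_of_differential_eq_zero hG (fun h => hW.dR_eq_zero hΨ h hx)]
    rfl
  have h2 : ∀ x ∉ W, ∀ a b : Tan x, G.inner x (real (A x)) (real (A x)) *
      ((starRingEnd ℂ) (dz A x a + s * (dR f x a : ℝ)) * (dz A x b + s * (dR f x b : ℝ))).re
      = reglueForm G A (tube Ψ) f s x (toC a) (toC b) := fun x hx a b => by
    have hx' := hW.mem_tube hx
    have hA0 : toC (real (A x)) ≠ 0 := hA.ne_zero x hx'
    have h3 : ∀ c : Tan x, displaceTan A f s x (toC c)
        = toC (real (A x)) * (dz A x c + s * (dR f x c : ℝ)) := fun c => by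
      rw [displaceTan_apply, dz, mul_add, mul_div_cancel₀ _ hA0]
      change _ = toC c + toC (real (A x)) * (s * ((differential f x (toC c) : ℝ) : ℂ))
      ring
    rw [reglueForm_of_mem hx', h3, h3, metricForm_apply, hG.metricForm_eq]
    simp only [mul_re, mul_im, conj_re, conj_im]
    ring
  constructor
  · intro h x a b
    by_cases hx : x ∈ W
    · rw [h.1 x hx, h1 x hx]
    · rw [h.2 x hx, h2 x hx]
  · exact fun h => ⟨fun x hx a b => by rw [h, h1 x hx], fun x hx a b => by rw [h, h2 x hx]⟩

/-- The derivative of the cutoff function along the vector field is bounded, by compactness. -/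
lemma exists_bound_differential (hΨ : IsTube Ψ)
    (hA : IsMetricPreservingField G (tube Ψ) A) (hW : IsCutoff Ψ W f) :
    ∃ M : ℝ, ∀ s : ℂ, ∀ x ∈ tube Ψ, |differential f x (s * toC (real (A x)))| ≤ ‖s‖ * M := by
  have hc : ∀ c : ℂ, ContinuousOn (fun x => differential f x (c * toC (real (A x)))) Wᶜ := by
    intro c x hx
    have hx' := hW.mem_tube hx
    have hxx := mem_chart_source ℂ x
    have hu := (chartAt ℂ x).map_source hxx
    have h1 := (contDiffAt_differential (hW.contMDiffAt hΨ hx') hxx).continuousAt_fderiv (by simp)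
    have h2 := (differentiableAt_vecCoord hΨ.isOpen_tube hA.holomorphic hx' hxx).continuousAt
    have h3 : ContinuousAt (fun u => fderiv ℝ (fun u => f ((chartAt ℂ x).symm u)) u
        (c * vecCoord A x u)) (chartAt ℂ x x) := h1.clm_apply (continuousAt_const.mul h2)
    have h4 := h3.comp ((chartAt ℂ x).continuousAt hxx)
    refine (h4.congr ?_).continuousWithinAt
    filter_upwards [(chartAt ℂ x).open_source.mem_nhds hxx, hΨ.isOpen_tube.mem_nhds hx'] with q hq hq'
    have h5 := frame_mul_vecCoord (A := A) ((chartAt ℂ x).map_source hq)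
    rw [(chartAt ℂ x).left_inv hq] at h5
    rw [Function.comp, ← differential_frame_mul (hW.contMDiffAt hΨ hq') hq, mul_left_comm, h5]
  obtain ⟨M₁, hM₁⟩ := hW.compact.exists_bound_of_continuousOn (hc 1)
  obtain ⟨M₂, hM₂⟩ := hW.compact.exists_bound_of_continuousOn (hc I)
  refine ⟨|M₁| + |M₂|, fun s x hx => ?_⟩
  by_cases hxW : x ∈ W
  · have : differential f x = 0 := hW.dR_eq_zero hΨ hx hxW
    rw [this]
    simp only [zero_apply, abs_zero]
    positivity
  · have e1 : s * toC (real (A x)) = s.re • (1 * toC (real (A x))) + s.im • (I * toC (real (A x))) := by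
      conv_lhs => rw [complex_eq_re_im s]
      simp only [real_smul]
      ring
    rw [e1, map_add, map_smul, map_smul, smul_eq_mul, smul_eq_mul, mul_add]
    refine (abs_add_le _ _).trans (add_le_add ?_ ?_) <;> rw [abs_mul]
    · exact mul_le_mul (abs_re_le_norm s) ((hM₁ x hxW).trans (le_abs_self _)) (abs_nonneg _)
        (norm_nonneg _)
    · exact mul_le_mul (abs_im_le_norm s) ((hM₂ x hxW).trans (le_abs_self _)) (abs_nonneg _)
        (norm_nonneg _)

lemma exists_smoothFormAt_reglueForm (hG : IsCompatible G) (hΨ : IsTube Ψ)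
    (hA : IsMetricPreservingField G (tube Ψ) A) (hW : IsCutoff Ψ W f) (s : ℂ) (x : S) :
    ∃ y, x ∈ (chartAt ℂ y).source ∧ SmoothFormAt (reglueForm G A (tube Ψ) f) y s x := by
  have hxx := mem_chart_source ℂ x
  refine ⟨x, hxx, ?_⟩
  by_cases hx : x ∈ tube Ψ
  · exact smoothFormAt_reglueForm hG hΨ.isOpen_tube hA.holomorphic hW.smooth hx s
  · have hxW : x ∈ W := by_contra fun h => hx (hW.mem_tube h)
    intro a b
    refine (smoothFormAt_metric G hxx s a b).congr_of_eventuallyEq ?_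
    have hn : ∀ᶠ q : ℂ × ℂ in 𝓝 (s, chartAt ℂ x x), (chartAt ℂ x).symm q.2 ∈ W :=
      ContinuousAt.preimage_mem_nhds
        (ContinuousAt.comp (g := (chartAt ℂ x).symm) (f := Prod.snd) (x := (s, chartAt ℂ x x))
          ((chartAt ℂ x).continuousAt_symm ((chartAt ℂ x).map_source hxx)) continuousAt_snd)
        (hW.isOpen.mem_nhds (by
          change (chartAt ℂ x).symm (chartAt ℂ x x) ∈ W
          rwa [(chartAt ℂ x).left_inv hxx]))
    filter_upwards [hn] with q hq
    rw [reglueForm_of_differential_eq_zero hG (fun h => hW.dR_eq_zero hΨ h hq)]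

lemma eventually_exists_isReglued (hG : IsCompatible G) (hΨ : IsTube Ψ)
    (hA : IsMetricPreservingField G (tube Ψ) A) (hW : IsCutoff Ψ W f) :
    ∀ᶠ s in 𝓝 (0 : ℂ), ∃ G' : Metric S, IsReglued G A W f s G' := by
  obtain ⟨M, hM⟩ := exists_bound_differential hΨ hA hW
  have hV : ∀ᶠ s in 𝓝 (0 : ℂ), ‖s‖ * M < 1 :=
    (isOpen_lt (by fun_prop) continuous_const).mem_nhds (by simp)
  filter_upwards [hV] with s hs
  obtain ⟨G', hG'⟩ := exists_metric (reglueForm G A (tube Ψ) f) s (reglueForm_symm s)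
    (reglueForm_pos fun x hx => (hM s x hx).trans_lt hs)
    (exists_smoothFormAt_reglueForm hG hΨ hA hW s)
  exact ⟨G', (isReglued_iff hG hΨ hA hW).2 hG'⟩

variable {F : Type*} [AddCommGroup F] [Module ℂ F] [MeasurableSpace S]
  {C : ConformalFieldTheory S F} {w : S} {ζ : S → ℂ} {φ : F}
  [T2Space S] [BorelSpace S] [SecondCountableTopology S]

/-- The variation formula for the reglued metrics, in the coordinates of the tube. -/
lemma exists_hasFDerivAt_reglued (hG : IsCompatible G) (hflat : ∀ x, scalarCurvature G x = 0)
    (hζ : IsConformalCoord G ζ w) (hΨ : IsTube Ψ)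
    (hA : IsMetricPreservingField G (tube Ψ) A) (hW : IsCutoff Ψ W f) (hw : w ∈ W)
    {g : ℂ → Metric S} (hg : ∀ᶠ s in 𝓝 (0 : ℂ), IsReglued G A W f s (g s)) :
    ∃ D : ℂ →L[ℝ] ℂ, HasFDerivAt (fun s => C.state.corr (g s) 1 ![w] ![ζ] ![φ]) D 0 ∧
      ∀ s, D s = ∫ u in stripDomain, -((jac Ψ u : ℂ)
        * (s * toC (real (A (Ψ u))) * (differential f (Ψ u) 1 + I * differential f (Ψ u) I)
            * emHol C G w ζ φ (Ψ u)
          + (starRingEnd ℂ) (s * toC (real (A (Ψ u)))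
            * (differential f (Ψ u) 1 + I * differential f (Ψ u) I) * emAnti C G w ζ φ (Ψ u)))) := by
  simp only [isReglued_iff hG hΨ hA hW] at hg
  obtain ⟨V, hVg, hVo, h0V⟩ := eventually_nhds_iff.1 hg
  have hg0 : g 0 = G := metric_ext fun x a b => by
    rw [hVg 0 h0V, reglueForm_zero hG]; rfl
  obtain ⟨D, hD, hDs⟩ := exists_hasFDerivAt_corr (C := C) (φ := φ) hG hζ hg0
    (smoothFamily_of_smoothFormAt g (reglueForm G A (tube Ψ) f) hVo h0V hVg
      fun s hs => exists_smoothFormAt_reglueForm hG hΨ hA hW s) hW.compact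
    (by
      filter_upwards [hg] with s hs x hx a b
      rw [hs, reglueForm_of_differential_eq_zero hG
        (fun h => hW.dR_eq_zero hΨ h (not_notMem.1 hx))]; rfl)
    (by rw [compl_compl]; exact hW.isOpen.mem_nhds hw)
  refine ⟨D, hD, fun s => ?_⟩
  have hdm : ∀ x (a b : Tan x), dMetric g s x a b
      = fderiv ℝ (fun r => reglueForm G A (tube Ψ) f r x (toC a) (toC b)) 0 s := by
    intro x a b
    have : (fun r => (g r).inner x a b) =ᶠ[𝓝 0]
        fun r => reglueForm G A (tube Ψ) f r x (toC a) (toC b) := by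
      filter_upwards [hg] with r hr
      exact hr x a b
    rw [dMetric, this.fderiv_eq]
  have hout : ∀ x ∉ Ψ '' stripDomain,
      twoPoint C G w ζ φ x (chartAt ℂ x) ((-(1 / 2) : ℂ) •
        contract G x (C.T G (chartAt ℂ x) x) (dMetric g s x)) = 0 := by
    intro x hx
    rw [hΨ.image_stripDomain] at hx
    have hz : ∀ a b : Tan x, dMetric g s x a b = 0 := by
      intro a b
      rw [hdm]
      simp only [reglueForm_of_notMem hx, fderiv_const_apply]
      rfl
    refine (twoPoint_variation (C := C) (w := w) (ζ := ζ) (φ := φ) hG x (hflat x)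
      (fun a b => dMetric g s x a b) 0 0 0 (fun a b => (hz a b).trans (by simp))).trans ?_
    simp
  rw [hDs, ← setIntegral_eq_integral_of_forall_compl_eq_zero hout,
    integral_dvol_image hG isOpen_strip hΨ.smooth measurableSet_stripDomain stripDomain_subset
      hΨ.injOn_stripDomain]
  refine setIntegral_congr_fun measurableSet_stripDomain fun u hu => ?_
  have hus := stripDomain_subset hu
  have hl : (lam G (Ψ u) : ℂ) ≠ 0 := by exact_mod_cast (lam_pos G (Ψ u)).ne'
  have hv := twoPoint_variation (C := C) (w := w) (ζ := ζ) (φ := φ) hG (Ψ u) (hflat _)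
    (fun a b => dMetric g s (Ψ u) a b) 0 (s * toC (real (A (Ψ u)))) (differential f (Ψ u))
    (fun a b => ((hdm _ a b).trans (fderiv_reglueForm (show Ψ u ∈ tube Ψ from ⟨u, hus, rfl⟩) s a b)).trans (by simp))
  refine (congrArg _ hv).trans ?_
  rw [density, abs_of_pos (hΨ.oriented u hus), real_smul]
  push_cast
  field_simp

end RegluedFamily

/-! ### Stokes' theorem on the tube -/

section Rectangle

/-- Green's formula for functions of period `1` on a strip. -/
lemma integral_periodic_strip {X Y k : ℂ → ℂ} {c d : ℝ} (hcd : c ≤ d)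
    (hX : ∀ u : ℂ, u.im ∈ Icc c d → DifferentiableAt ℝ X u)
    (hY : ∀ u : ℂ, u.im ∈ Icc c d → DifferentiableAt ℝ Y u)
    (hper : ∀ u : ℂ, u.im ∈ Icc c d → X (u + 1) = X u)
    (hk : ∀ u : ℂ, u.im ∈ Icc c d → fderiv ℝ X u 1 - fderiv ℝ Y u I = k u)
    (hkc : ContinuousOn k {u | u.im ∈ Icc c d}) :
    ∫ u in Ico 0 1 ×ℂ Ioc c d, k u
      = (∫ t in (0 : ℝ)..1, Y (t + c * I)) - ∫ t in (0 : ℝ)..1, Y (t + d * I) := by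
  have hes : ∀ p : ℝ × ℝ, equivRealProdCLM.symm p = (p.1 : ℂ) + p.2 * I := fun p =>
    equivRealProd_symm_apply p
  have him : ∀ p : ℝ × ℝ, (equivRealProdCLM.symm p).im = p.2 := fun p => by rw [hes]; simp
  have hmem : ∀ p ∈ Icc ((0 : ℝ), c) (1, d), (equivRealProdCLM.symm p).im ∈ Icc c d := fun p hp => by
    rw [him]; exact ⟨hp.1.2, hp.2.2⟩
  have hmem' : ∀ p ∈ Ioo (0 : ℝ) 1 ×ˢ Ioo c d, (equivRealProdCLM.symm p).im ∈ Icc c d :=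
    fun p hp => by rw [him]; exact Ioo_subset_Icc_self hp.2
  have e0 : ∫ u in Ico 0 1 ×ℂ Ioc c d, k u
      = ∫ p in Icc ((0 : ℝ), c) (1, d), k (equivRealProdCLM.symm p) := by
    have h1 := volume_preserving_equiv_real_prod.symm.setIntegral_preimage_emb
      measurableEquivRealProd.symm.measurableEmbedding k (Ico 0 1 ×ℂ Ioc c d)
    have h2 : (Ico (0 : ℝ) 1 ×ˢ Ioc c d : Set (ℝ × ℝ)) =ᵐ[volume] Icc ((0 : ℝ), c) (1, d) := by
      rw [← Icc_prod_Icc]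
      exact Measure.set_prod_ae_eq Ico_ae_eq_Icc Ioc_ae_eq_Icc
    rw [← h1, ← setIntegral_congr_set h2]
    rfl
  have hdc : ∀ Z : ℂ → ℂ, ∀ p : ℝ × ℝ, DifferentiableAt ℝ Z (equivRealProdCLM.symm p) →
      HasFDerivAt (fun p => Z (equivRealProdCLM.symm p))
        (fderiv ℝ Z (equivRealProdCLM.symm p) ∘L
          (equivRealProdCLM.symm : (ℝ × ℝ) →L[ℝ] ℂ)) p := fun Z p hZ =>
    hZ.hasFDerivAt.comp p equivRealProdCLM.symm.hasFDerivAt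
  have e1 : ((equivRealProdCLM.symm : (ℝ × ℝ) →L[ℝ] ℂ) (1, 0)) = 1 := by
    change equivRealProdCLM.symm (1, 0) = 1
    rw [hes]; simp
  have e2 : ((equivRealProdCLM.symm : (ℝ × ℝ) →L[ℝ] ℂ) (0, 1)) = I := by
    change equivRealProdCLM.symm (0, 1) = I
    rw [hes]; simp
  have hval : ∀ p ∈ Icc ((0 : ℝ), c) (1, d),
      (fderiv ℝ X (equivRealProdCLM.symm p) ∘L (equivRealProdCLM.symm : (ℝ × ℝ) →L[ℝ] ℂ)) (1, 0)
        + (-(fderiv ℝ Y (equivRealProdCLM.symm p)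
          ∘L (equivRealProdCLM.symm : (ℝ × ℝ) →L[ℝ] ℂ))) (0, 1) = k (equivRealProdCLM.symm p) := by
    intro p hp
    rw [← hk _ (hmem p hp), neg_apply, ContinuousLinearMap.comp_apply,
      ContinuousLinearMap.comp_apply, e1, e2, sub_eq_add_neg]
  have hki : IntegrableOn (fun p => k (equivRealProdCLM.symm p)) (Icc ((0 : ℝ), c) (1, d)) :=
    (hkc.comp equivRealProdCLM.symm.continuous.continuousOn hmem).integrableOn_compact isCompact_Icc
  have h := integral_divergence_prod_Icc_of_hasFDerivAt_of_le
    (fun p => X (equivRealProdCLM.symm p)) (fun p => -Y (equivRealProdCLM.symm p))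
    (fun p => fderiv ℝ X (equivRealProdCLM.symm p) ∘L (equivRealProdCLM.symm : (ℝ × ℝ) →L[ℝ] ℂ))
    (fun p => -(fderiv ℝ Y (equivRealProdCLM.symm p)
      ∘L (equivRealProdCLM.symm : (ℝ × ℝ) →L[ℝ] ℂ))) ((0 : ℝ), c) (1, d) ⟨zero_le_one, hcd⟩
    (fun p hp => (hdc X p (hX _ (hmem p hp))).continuousAt.continuousWithinAt)
    (fun p hp => (hdc Y p (hY _ (hmem p hp))).neg.continuousAt.continuousWithinAt)
    (fun p hp => hdc X p (hX _ (hmem' p hp))) (fun p hp => (hdc Y p (hY _ (hmem' p hp))).neg)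
    (hki.congr_fun (fun p hp => (hval p hp).symm) measurableSet_Icc)
  rw [e0, ← setIntegral_congr_fun measurableSet_Icc hval]
  refine h.trans ?_
  have e3 : ∫ y in c..d, X (equivRealProdCLM.symm (1, y))
      = ∫ y in c..d, X (equivRealProdCLM.symm (0, y)) := by
    refine intervalIntegral.integral_congr fun y hy => ?_
    rw [uIcc_of_le hcd] at hy
    have := hper (equivRealProdCLM.symm (0, y)) (by rw [him]; exact hy)
    rw [← this]
    congr 1
    rw [hes, hes]
    push_cast
    ring
  simp only [intervalIntegral.integral_neg]
  rw [e3, add_sub_cancel_right, sub_neg_eq_add, neg_add_eq_sub]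
  simp only [hes]

end Rectangle

section OneForm

lemma two_le_infty : (2 : ℕ∞ω) ≤ (∞ : ℕ∞ω) :=
  WithTop.coe_le_coe.2 (le_top : (2 : ℕ∞) ≤ ⊤)

variable {S : Type*} [TopologicalSpace S] [ChartedSpace ℂ S]

/-- The coefficient, in the preferred chart at `y`, of the one-form that is given by the complex
number `b x` in the plane `Tan x = ℂ`. -/
noncomputable def formCoord (b : S → ℂ) (y : S) (u : ℂ) : ℂ :=
  b ((chartAt ℂ y).symm u) * frame y ((chartAt ℂ y).symm u)

/-- The pullback by `Ψ` of the one-form `b`, evaluated on the constant vector `v`. -/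
noncomputable def pullback (b : S → ℂ) (Ψ : ℂ → S) (v u : ℂ) : ℂ :=
  b (Ψ u) * toC (x := Ψ u) (mfderiv 𝓘(ℝ, ℂ) 𝓘(ℝ, ℂ) Ψ u v)

variable [IsManifold 𝓘(ℂ, ℂ) ω S] {b : S → ℂ} {Ψ : ℂ → S}

lemma pullback_eq (hΨ : IsTube Ψ) {u : ℂ} (hu : u ∈ strip) {y : S}
    (hy : Ψ u ∈ (chartAt ℂ y).source) (v : ℂ) :
    pullback b Ψ v u = formCoord b y (chartAt ℂ y (Ψ u))
      * fderiv ℝ (fun u => chartAt ℂ y (Ψ u)) u v := by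
  rw [pullback, mfderiv_to_surface (hΨ.mdiffAt hu) hy, formCoord, (chartAt ℂ y).left_inv hy]
  ring

lemma pullback_add_one (hΨ : IsTube Ψ) {u : ℂ} (hu : u ∈ strip) (v : ℂ) :
    pullback b Ψ v (u + 1) = pullback b Ψ v u := by
  have hu1 : u + 1 ∈ strip := by simpa [strip] using hu
  have hΨ1 : Ψ (u + 1) = Ψ u := by simpa using hΨ.add_intCast hu 1
  have hy := mem_chart_source ℂ (Ψ u)
  rw [pullback_eq hΨ hu hy, pullback_eq hΨ hu1 (y := Ψ u) (by rwa [hΨ1]), hΨ1]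
  congr 1
  have h1 : (fun v => chartAt ℂ (Ψ u) (Ψ v)) =ᶠ[𝓝 u] fun v => chartAt ℂ (Ψ u) (Ψ (v + 1)) := by
    filter_upwards [isOpen_strip.mem_nhds hu] with v hv
    have := hΨ.add_intCast hv 1
    rw [Int.cast_one] at this
    rw [this]
  rw [h1.fderiv_eq, fderiv_comp_add_right (f := fun v => chartAt ℂ (Ψ u) (Ψ v))]

/-- The pullback of a holomorphic one-form is closed. -/
lemma pullback_closed (hΨ : IsTube Ψ) {u : ℂ} (hu : u ∈ strip)
    (hb : DifferentiableAt ℂ (formCoord b (Ψ u)) (chartAt ℂ (Ψ u) (Ψ u))) :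
    (∀ v, DifferentiableAt ℝ (pullback b Ψ v) u) ∧
      fderiv ℝ (pullback b Ψ I) u 1 = fderiv ℝ (pullback b Ψ 1) u I := by
  have hy := mem_chart_source ℂ (Ψ u)
  set y := Ψ u with hyd
  have hd := hΨ.contDiffAt_chart hu hy
  set q : ℂ → ℂ := fun v => chartAt ℂ y (Ψ v) with hq
  have h1 : HasFDerivAt (fun v => formCoord b y (q v))
      (deriv (formCoord b y) (q u) • fderiv ℝ q u) u := by
    have := (hb.hasDerivAt.hasFDerivAt.restrictScalars ℝ).comp u
      (hd.differentiableAt (by simp)).hasFDerivAt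
    refine this.congr_fderiv ?_
    ext v
    simp [mul_comm]
    exact Or.inl rfl
  have h2 : ∀ v, HasFDerivAt (fun u => fderiv ℝ q u v) ((fderiv ℝ (fderiv ℝ q) u).flip v) u :=
    fun v => by
      have h3 : DifferentiableAt ℝ (fderiv ℝ q) u :=
        (hd.fderiv_right (m := ∞) (by simp)).differentiableAt (by simp)
      have := h3.hasFDerivAt.clm_apply (hasFDerivAt_const v u)
      refine this.congr_fderiv ?_
      ext a
      simp
  have h3 : ∀ v, HasFDerivAt (pullback b Ψ v) _ u := fun v =>
    (h1.mul (h2 v)).congr_of_eventuallyEq (by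
      filter_upwards [isOpen_strip.mem_nhds hu, (hΨ.continuousAt hu).preimage_mem_nhds
        ((chartAt ℂ y).open_source.mem_nhds hy)] with a ha ha'
      exact pullback_eq hΨ ha ha' v)
  refine ⟨fun v => (h3 v).differentiableAt, ?_⟩
  have hs : IsSymmSndFDerivAt ℝ q u := hd.isSymmSndFDerivAt (by simpa using two_le_infty)
  rw [(h3 I).fderiv, (h3 1).fderiv]
  simp only [add_apply, smul_apply, smul_eq_mul, ContinuousLinearMap.flip_apply]
  rw [hs.eq 1 I]
  ring

end OneForm

section Stokes

variable {S : Type*} [TopologicalSpace S] [ChartedSpace ℂ S]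

/-- The two-form `df ∧ b` in the coordinates of the tube. -/
noncomputable def wedge (b : S → ℂ) (f : S → ℝ) (Ψ : ℂ → S) (u : ℂ) : ℂ :=
  (fderiv ℝ (fun v => f (Ψ v)) u 1 : ℂ) * pullback b Ψ I u
    - (fderiv ℝ (fun v => f (Ψ v)) u I : ℂ) * pullback b Ψ 1 u

variable [IsManifold 𝓘(ℂ, ℂ) ω S] {b : S → ℂ} {f : S → ℝ} {Ψ : ℂ → S} {W : Set S} {w : S}

lemma contDiffAt_comp_tube (hΨ : IsTube Ψ) (hW : IsCutoff Ψ W f) {u : ℂ} (hu : u ∈ strip) :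
    ContDiffAt ℝ ∞ (fun v => f (Ψ v)) u :=
  contMDiffAt_iff_contDiffAt.1
    ((hW.contMDiffAt hΨ (show Ψ u ∈ tube Ψ from ⟨u, hu, rfl⟩)).comp u (hΨ.contMDiffAt hu))

lemma fderiv_comp_tube (hΨ : IsTube Ψ) (hW : IsCutoff Ψ W f) {u : ℂ} (hu : u ∈ strip) (v : ℂ) :
    fderiv ℝ (fun v => f (Ψ v)) u v
      = differential f (Ψ u) (toC (x := Ψ u) (mfderiv 𝓘(ℝ, ℂ) 𝓘(ℝ, ℂ) Ψ u v)) := by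
  have h := mfderiv_comp u ((hW.contMDiffAt hΨ
    (show Ψ u ∈ tube Ψ from ⟨u, hu, rfl⟩)).mdifferentiableAt (by simp)) (hΨ.mdiffAt hu)
  rw [mfderiv_eq_fderiv] at h
  exact DFunLike.congr_fun (h : (_ : ℂ →L[ℝ] ℝ) = _) v

lemma wedge_eq_zero (hΨ : IsTube Ψ) (hW : IsCutoff Ψ W f) {u : ℂ} (hu : u ∈ strip)
    (huW : Ψ u ∈ W) : wedge b f Ψ u = 0 := by
  have h : differential f (Ψ u) = 0 := hW.dR_eq_zero hΨ ⟨u, hu, rfl⟩ huW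
  rw [wedge, fderiv_comp_tube hΨ hW hu, fderiv_comp_tube hΨ hW hu, h]
  simp

/-- Where the cutoff function is not constant, the form is closed, so `df ∧ b = d((f - c) b)`. The
other points, and in particular `w`, do not contribute if `c` is the value of `f` there. -/
lemma fderiv_cutoff_mul (hΨ : IsTube Ψ) (hW : IsCutoff Ψ W f) (hw : w ∈ W)
    (hb : ∀ x ∈ tube Ψ, x ≠ w → DifferentiableAt ℂ (formCoord b x) (chartAt ℂ x x)) (c : ℝ) {u : ℂ}
    (hu : u ∈ strip) (hc : Ψ u ∈ W → (fun v => f (Ψ v)) =ᶠ[𝓝 u] fun _ => c) :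
    (∀ v, DifferentiableAt ℝ (fun u => ((f (Ψ u) - c : ℝ) : ℂ) * pullback b Ψ v u) u) ∧
      fderiv ℝ (fun u => ((f (Ψ u) - c : ℝ) : ℂ) * pullback b Ψ I u) u 1
        - fderiv ℝ (fun u => ((f (Ψ u) - c : ℝ) : ℂ) * pullback b Ψ 1 u) u I = wedge b f Ψ u := by
  by_cases huW : Ψ u ∈ W
  · have h0 : ∀ v, (fun u => ((f (Ψ u) - c : ℝ) : ℂ) * pullback b Ψ v u) =ᶠ[𝓝 u] fun _ => 0 := by
      intro v
      filter_upwards [hc huW] with a ha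
      rw [ha, sub_self, ofReal_zero, zero_mul]
    refine ⟨fun v => (differentiableAt_const (0 : ℂ)).congr_of_eventuallyEq (h0 v), ?_⟩
    rw [(h0 I).fderiv_eq, (h0 1).fderiv_eq, wedge_eq_zero hΨ hW hu huW]
    simp
  · obtain ⟨hd, hs⟩ := pullback_closed hΨ hu (hb _ ⟨u, hu, rfl⟩ fun h => huW (h ▸ hw))
    have hf := ((contDiffAt_comp_tube hΨ hW hu).differentiableAt (by simp)).hasFDerivAt
    have h1 : HasFDerivAt (fun u => ((f (Ψ u) - c : ℝ) : ℂ))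
        (ofRealCLM ∘L fderiv ℝ (fun v => f (Ψ v)) u) u :=
      ofRealCLM.hasFDerivAt.comp u (hf.sub_const c)
    have h2 : ∀ v, HasFDerivAt (fun u => ((f (Ψ u) - c : ℝ) : ℂ) * pullback b Ψ v u)
        (((f (Ψ u) - c : ℝ) : ℂ) • fderiv ℝ (pullback b Ψ v) u
          + pullback b Ψ v u • (ofRealCLM ∘L fderiv ℝ (fun v => f (Ψ v)) u)) u :=
      fun v => h1.mul (hd v).hasFDerivAt
    refine ⟨fun v => (h2 v).differentiableAt, ?_⟩
    rw [(h2 I).fderiv, (h2 1).fderiv, wedge]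
    simp only [add_apply, smul_apply, smul_eq_mul, ContinuousLinearMap.comp_apply, ofRealCLM_apply]
    rw [hs]
    ring

lemma continuousOn_wedge (hΨ : IsTube Ψ) (hW : IsCutoff Ψ W f) (hw : w ∈ W)
    (hb : ∀ x ∈ tube Ψ, x ≠ w → DifferentiableAt ℂ (formCoord b x) (chartAt ℂ x x)) :
    ContinuousOn (wedge b f Ψ) strip := by
  intro u hu
  refine ContinuousAt.continuousWithinAt ?_
  by_cases huW : Ψ u ∈ W
  · refine continuousAt_const.congr (f := fun _ => (0 : ℂ)) ?_
    filter_upwards [isOpen_strip.mem_nhds hu,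
      (hΨ.continuousAt hu).preimage_mem_nhds (hW.isOpen.mem_nhds huW)] with v hv hv'
    exact (wedge_eq_zero hΨ hW hv hv').symm
  · obtain ⟨hd, -⟩ := pullback_closed hΨ hu (hb _ ⟨u, hu, rfl⟩ fun h => huW (h ▸ hw))
    have hf := (contDiffAt_comp_tube hΨ hW hu).continuousAt_fderiv (by simp)
    have hfv : ∀ v, ContinuousAt (fun a => (fderiv ℝ (fun v => f (Ψ v)) a v : ℂ)) u := fun v =>
      continuous_ofReal.continuousAt.comp (hf.clm_apply continuousAt_const)
    exact ((hfv 1).mul (hd I).continuousAt).sub ((hfv I).mul (hd 1).continuousAt)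

/-- Stokes' theorem on the two halves of the tube: on the left half `df ∧ b = d((f - 1) b)`, on the
right half `df ∧ b = d(f b)`, and only the boundary terms along the core curve survive. -/
lemma integral_wedge (hΨ : IsTube Ψ) (hW : IsCutoff Ψ W f) (hw : w ∈ W)
    (hb : ∀ x ∈ tube Ψ, x ≠ w → DifferentiableAt ℂ (formCoord b x) (chartAt ℂ x x)) :
    IntegrableOn (wedge b f Ψ) stripDomain ∧
      ∫ u in stripDomain, wedge b f Ψ u = -∫ t in (0 : ℝ)..1, pullback b Ψ 1 t := by
  obtain ⟨δ, hδ0, hδ1, hδ⟩ := hW.exists_im_lt hΨ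
  have hkc := continuousOn_wedge hΨ hW hw hb
  have hst : ∀ {u : ℂ}, u.im ∈ Icc (-δ) δ → u ∈ strip := fun h =>
    lt_of_le_of_lt (abs_le.2 h) hδ1
  have hsub : Ico (0 : ℝ) 1 ×ℂ Ioc (-δ) δ ⊆ stripDomain := fun u hu =>
    ⟨hu.1, hst (Ioc_subset_Icc_self hu.2)⟩
  have hmeas : ∀ c d : ℝ, MeasurableSet (Ico (0 : ℝ) 1 ×ℂ Ioc c d) := fun c d =>
    (measurable_re measurableSet_Ico).inter (measurable_im measurableSet_Ioc)
  have hout : ∀ u ∈ stripDomain \ Ico (0 : ℝ) 1 ×ℂ Ioc (-δ) δ, wedge b f Ψ u = 0 := by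
    intro u hu
    refine wedge_eq_zero hΨ hW (stripDomain_subset hu.1) (by_contra fun h => hu.2 ?_)
    have := abs_lt.1 (hδ u (stripDomain_subset hu.1) h)
    exact ⟨hu.1.1, this.1, this.2.le⟩
  have hint : IntegrableOn (wedge b f Ψ) (Ico (0 : ℝ) 1 ×ℂ Ioc (-δ) δ) := by
    have h1 : IntegrableOn (wedge b f Ψ) (Icc (0 : ℝ) 1 ×ℂ Icc (-δ) δ) :=
      (hkc.mono fun u hu => hst hu.2).integrableOn_compact (isCompact_Icc.reProdIm isCompact_Icc)
    exact h1.mono_set fun u hu => ⟨Ico_subset_Icc_self hu.1, Ioc_subset_Icc_self hu.2⟩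
  refine ⟨hint.of_forall_sdiff_eq_zero measurableSet_stripDomain hout, ?_⟩
  rw [setIntegral_eq_of_subset_of_forall_sdiff_eq_zero measurableSet_stripDomain hsub hout]
  have hsplit : Ico (0 : ℝ) 1 ×ℂ Ioc (-δ) δ
      = (Ico (0 : ℝ) 1 ×ℂ Ioc (-δ) 0) ∪ (Ico (0 : ℝ) 1 ×ℂ Ioc 0 δ) := by
    ext u
    have := Set.ext_iff.1 (Ioc_union_Ioc_eq_Ioc (neg_nonpos.2 hδ0.le) hδ0.le) u.im
    simp only [mem_union, mem_reProdIm] at this ⊢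
    tauto
  have hdisj : Disjoint (Ico (0 : ℝ) 1 ×ℂ Ioc (-δ) 0) (Ico (0 : ℝ) 1 ×ℂ Ioc 0 δ) :=
    Set.disjoint_left.2 fun u h1 h2 => absurd h1.2.2 (not_le.2 h2.2.1)
  rw [hsplit] at hint ⊢
  rw [setIntegral_union hdisj (hmeas _ _) hint.left_of_union hint.right_of_union]
  have hper : ∀ (c : ℝ) (u : ℂ), u ∈ strip → ((f (Ψ (u + 1)) - c : ℝ) : ℂ) * pullback b Ψ I (u + 1)
      = ((f (Ψ u) - c : ℝ) : ℂ) * pullback b Ψ I u := fun c u hu => by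
    have := hΨ.add_intCast hu 1
    rw [Int.cast_one] at this
    rw [pullback_add_one hΨ hu, this]
  have hlow : ∀ u : ℂ, u.im ∈ Icc (-δ) 0 → u ∈ strip ∧
      (Ψ u ∈ W → (fun v => f (Ψ v)) =ᶠ[𝓝 u] fun _ => 0) := fun u hu => by
    have hus : u ∈ strip := hst ⟨hu.1, hu.2.trans hδ0.le⟩
    exact ⟨hus, fun h => hW.eventuallyEq_zero hΨ hus h (lt_of_le_of_ne hu.2 (hW.im_ne_zero h))⟩
  have hupp : ∀ u : ℂ, u.im ∈ Icc 0 δ → u ∈ strip ∧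
      (Ψ u ∈ W → (fun v => f (Ψ v)) =ᶠ[𝓝 u] fun _ => 1) := fun u hu => by
    have hus : u ∈ strip := hst ⟨(neg_nonpos.2 hδ0.le).trans hu.1, hu.2⟩
    exact ⟨hus, fun h => hW.eventuallyEq_one hΨ hus h (lt_of_le_of_ne hu.1 (hW.im_ne_zero h).symm)⟩
  have hcut := fun c {u : ℂ} => fderiv_cutoff_mul (u := u) hΨ hW hw hb c
  have h1 := integral_periodic_strip (neg_nonpos.2 hδ0.le)
    (X := fun u => ((f (Ψ u) - 0 : ℝ) : ℂ) * pullback b Ψ I u)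
    (Y := fun u => ((f (Ψ u) - 0 : ℝ) : ℂ) * pullback b Ψ 1 u) (k := wedge b f Ψ)
    (fun u hu => (hcut 0 (hlow u hu).1 (hlow u hu).2).1 I)
    (fun u hu => (hcut 0 (hlow u hu).1 (hlow u hu).2).1 1) (fun u hu => hper 0 u (hlow u hu).1)
    (fun u hu => (hcut 0 (hlow u hu).1 (hlow u hu).2).2) (hkc.mono fun u hu => (hlow u hu).1)
  have h2 := integral_periodic_strip hδ0.le
    (X := fun u => ((f (Ψ u) - 1 : ℝ) : ℂ) * pullback b Ψ I u)
    (Y := fun u => ((f (Ψ u) - 1 : ℝ) : ℂ) * pullback b Ψ 1 u) (k := wedge b f Ψ)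
    (fun u hu => (hcut 1 (hupp u hu).1 (hupp u hu).2).1 I)
    (fun u hu => (hcut 1 (hupp u hu).1 (hupp u hu).2).1 1) (fun u hu => hper 1 u (hupp u hu).1)
    (fun u hu => (hcut 1 (hupp u hu).1 (hupp u hu).2).2) (hkc.mono fun u hu => (hupp u hu).1)
  -- the outer boundaries lie in `W`, where `f - c` vanishes
  have hbd : ∀ (t : ℝ) (d c : ℝ), d ≠ 0 → |d| = δ → (0 < d → c = 1) → (d < 0 → c = 0) →
      ((f (Ψ (t + d * I)) - c : ℝ) : ℂ) = 0 := by
    intro t d c hd0 hd hc1 hc0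
    have him : ((t : ℂ) + d * I).im = d := by simp
    have hs : (t : ℂ) + d * I ∈ strip := by
      change |((t : ℂ) + d * I).im| < 1
      rw [him, hd]; exact hδ1
    have hmW : Ψ (t + d * I) ∈ W := by
      by_contra h
      have := hδ _ hs h
      rw [him, hd] at this
      exact lt_irrefl _ this
    rcases hd0.lt_or_gt with h | h
    · rw [hc0 h, hW.right _ hs (by rwa [him]) hmW, sub_zero, ofReal_zero]
    · rw [hc1 h, hW.left _ hs (by rwa [him]) hmW, sub_self, ofReal_zero]
  rw [h1, h2]
  have e1 : ∫ t in (0 : ℝ)..1, ((f (Ψ (t + (-δ : ℝ) * I)) - 0 : ℝ) : ℂ)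
      * pullback b Ψ 1 (t + (-δ : ℝ) * I) = 0 := by
    simp_rw [fun t : ℝ => hbd t (-δ) 0 (neg_ne_zero.2 hδ0.ne') (by rw [abs_neg, abs_of_pos hδ0])
      (fun h => by linarith) (fun _ => rfl)]
    simp
  have e2 : ∫ t in (0 : ℝ)..1, ((f (Ψ (t + δ * I)) - 1 : ℝ) : ℂ)
      * pullback b Ψ 1 (t + δ * I) = 0 := by
    simp_rw [fun t : ℝ => hbd t δ 1 hδ0.ne' (abs_of_pos hδ0) (fun _ => rfl) (fun h => by linarith)]
    simp
  rw [e1, e2]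
  have hcont : ∀ c : ℝ, (∀ u : ℂ, u.im = 0 → DifferentiableAt ℝ
      (fun u => ((f (Ψ u) - c : ℝ) : ℂ) * pullback b Ψ 1 u) u) →
      IntervalIntegrable (fun t : ℝ => ((f (Ψ (t + (0 : ℝ) * I)) - c : ℝ) : ℂ)
        * pullback b Ψ 1 (t + (0 : ℝ) * I)) volume 0 1 := fun c h => by
    refine Continuous.intervalIntegrable (continuous_iff_continuousAt.2 fun t => ?_) _ _
    exact ContinuousAt.comp (f := fun t : ℝ => (t : ℂ) + (0 : ℝ) * I)
      (h _ (by simp)).continuousAt (by fun_prop)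
  have i0 := hcont 0 fun u hu => (hcut 0 (hlow u (by simp [hu, hδ0.le])).1
    (hlow u (by simp [hu, hδ0.le])).2).1 1
  have i1 := hcont 1 fun u hu => (hcut 1 (hupp u (by simp [hu, hδ0.le])).1
    (hupp u (by simp [hu, hδ0.le])).2).1 1
  rw [zero_sub, sub_zero, neg_add_eq_sub, ← intervalIntegral.integral_sub i1 i0,
    ← intervalIntegral.integral_neg]
  refine intervalIntegral.integral_congr fun t _ => ?_
  simp only [ofReal_zero, zero_mul, add_zero]
  push_cast
  ring

end Stokes

/-! ### The contour integrals -/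

section Contour

variable {S : Type*} [TopologicalSpace S] [ChartedSpace ℂ S]

lemma toC_coreVel {Ψ : ℂ → S} (hΨ : IsTube Ψ) (t : ℝ) : toC (coreVel Ψ t)
    = toC (x := Ψ t) (mfderiv 𝓘(ℝ, ℂ) 𝓘(ℝ, ℂ) Ψ (t : ℂ) (1 : ℂ)) := by
  have h1 : HasMFDerivAt 𝓘(ℝ, ℝ) 𝓘(ℝ, ℂ) (fun t : ℝ => (t : ℂ)) t ofRealCLM :=
    ofRealCLM.hasFDerivAt.hasMFDerivAt
  have h2 := ((hΨ.mdiffAt (ofReal_mem_strip t)).hasMFDerivAt.comp t h1).mfderiv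
  exact DFunLike.congr_fun (h2 : (_ : ℝ →L[ℝ] ℂ) = _) (1 : ℝ)

variable [IsManifold 𝓘(ℂ, ℂ) ω S]
  {G : Metric S} {A : (x : S) → TangentSpace 𝓘(ℂ, ℂ) x} {f : S → ℝ} {Ψ : ℂ → S} {W : Set S}

/-- The product of a holomorphic vector field and a holomorphic quadratic differential is a
holomorphic one-form. -/
lemma differentiableAt_formCoord_mul {q : S → ℂ} {R : Set S} (hR : IsOpen R)
    (hA : MDifferentiableOn 𝓘(ℂ, ℂ) 𝓘(ℂ, ℂ).tangent
      (fun x => (⟨x, A x⟩ : TangentBundle 𝓘(ℂ, ℂ) S)) R) {x : S} (hx : x ∈ R)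
    (hq : DifferentiableAt ℂ (quadCoord q x) (chartAt ℂ x x)) :
    DifferentiableAt ℂ (formCoord (fun x => toC (real (A x)) * q x) x) (chartAt ℂ x x) := by
  have hxx := mem_chart_source ℂ x
  refine ((differentiableAt_vecCoord hR hA hx hxx).mul hq).congr_of_eventuallyEq ?_
  filter_upwards [(chartAt ℂ x).open_target.mem_nhds ((chartAt ℂ x).map_source hxx)] with u hu
  change _ = vecCoord A x u * quadCoord q x u
  rw [formCoord, quadCoord, ← frame_mul_vecCoord hu]
  ring

/-- The Jacobian times `b` times the antilinear part of `df` is, up to the factor `-i`, the two-form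
`df ∧ b` in the coordinates of the tube. -/
lemma jac_mul_differential (hΨ : IsTube Ψ) (hW : IsCutoff Ψ W f) {u : ℂ} (hu : u ∈ strip)
    (b : S → ℂ) :
    -((jac Ψ u : ℂ) * (b (Ψ u) * (differential f (Ψ u) 1 + I * differential f (Ψ u) I)))
      = I * wedge b f Ψ u := by
  have hj : jac Ψ u = _ := det_complex (mfderiv 𝓘(ℝ, ℂ) 𝓘(ℝ, ℂ) Ψ u : ℂ →L[ℝ] ℂ)
  rw [wedge, fderiv_comp_tube hΨ hW hu, fderiv_comp_tube hΨ hW hu, pullback, pullback, hj]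
  change -((((starRingEnd ℂ) (toC (x := Ψ u) (mfderiv 𝓘(ℝ, ℂ) 𝓘(ℝ, ℂ) Ψ u (1 : ℂ)))
    * toC (x := Ψ u) (mfderiv 𝓘(ℝ, ℂ) 𝓘(ℝ, ℂ) Ψ u I)).im : ℂ) * _) = _
  generalize toC (x := Ψ u) (mfderiv 𝓘(ℝ, ℂ) 𝓘(ℝ, ℂ) Ψ u (1 : ℂ)) = p
  generalize toC (x := Ψ u) (mfderiv 𝓘(ℝ, ℂ) 𝓘(ℝ, ℂ) Ψ u I) = r
  rw [clm_apply_re_im _ p, clm_apply_re_im _ r]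
  conv_rhs => rw [← re_add_im p, ← re_add_im r]
  simp only [mul_im, conj_re, conj_im, smul_eq_mul, add_re, add_im, ofReal_re, ofReal_im, mul_re,
    I_re, I_im]
  push_cast
  ring_nf
  simp only [I_sq]
  ring

variable {F : Type*} [AddCommGroup F] [Module ℂ F] [MeasurableSpace S]
  {C : ConformalFieldTheory S F} {w : S} {ζ : S → ℂ} {φ : F}

lemma contourT_eq (hΨ : IsTube Ψ) (hA : IsMetricPreservingField G (tube Ψ) A) :
    contourT C G A Ψ φ w ζ
      = ∫ t in (0 : ℝ)..1, pullback (fun x => toC (real (A x)) * emHol C G w ζ φ x) Ψ 1 t := by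
  refine intervalIntegral.integral_congr fun t _ => ?_
  have h0 : toC (real (A (core Ψ t))) ≠ 0 := hA.ne_zero _ ⟨t, ofReal_mem_strip t, rfl⟩
  have h := twoPoint_Tzz (C := C) (G := G) (w := w) (ζ := ζ) (φ := φ) (core Ψ t)
    (real (A (core Ψ t)))
  refine (congrArg (· * dz A (core Ψ t) (coreVel Ψ t)) h).trans ?_
  simp only [dz, pullback, toC_coreVel hΨ]
  change toC (real (A (core Ψ t))) ^ 2 * emHol C G w ζ φ (core Ψ t) * (_ / toC (real (A (core Ψ t))))
    = toC (real (A (core Ψ t))) * emHol C G w ζ φ (core Ψ t) * _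
  field_simp

lemma contourTbar_eq (hΨ : IsTube Ψ) (hA : IsMetricPreservingField G (tube Ψ) A) :
    contourTbar C G A Ψ φ w ζ = (starRingEnd ℂ)
      (∫ t in (0 : ℝ)..1, pullback (fun x => toC (real (A x)) * emAnti C G w ζ φ x) Ψ 1 t) := by
  rw [contourTbar, intervalIntegral.integral_of_le zero_le_one,
    intervalIntegral.integral_of_le zero_le_one, ← integral_conj]
  refine setIntegral_congr_fun measurableSet_Ioc fun t _ => ?_
  have h0 : toC (real (A (core Ψ t))) ≠ 0 := hA.ne_zero _ ⟨t, ofReal_mem_strip t, rfl⟩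
  have h := twoPoint_Tzzbar (C := C) (G := G) (w := w) (ζ := ζ) (φ := φ) (core Ψ t)
    (real (A (core Ψ t)))
  refine (congrArg (· * (starRingEnd ℂ) (dz A (core Ψ t) (coreVel Ψ t))) h).trans ?_
  simp only [← map_mul]
  refine congrArg (starRingEnd ℂ) ?_
  simp only [dz, pullback, toC_coreVel hΨ]
  change toC (real (A (core Ψ t))) ^ 2 * emAnti C G w ζ φ (core Ψ t)
      * (_ / toC (real (A (core Ψ t))))
    = toC (real (A (core Ψ t))) * emAnti C G w ζ φ (core Ψ t) * _
  field_simp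

variable [T2Space S] [BorelSpace S] [SecondCountableTopology S]

/-- The real derivative of `⟨φ(w)⟩` with respect to the gluing parameter, as a contour integral. -/
lemma exists_hasFDerivAt_contour (hG : IsCompatible G) (hflat : ∀ x, scalarCurvature G x = 0)
    (hζ : IsConformalCoord G ζ w) (hΨ : IsTube Ψ)
    (hA : IsMetricPreservingField G (tube Ψ) A) (hW : IsCutoff Ψ W f) (hw : w ∈ W)
    {g : ℂ → Metric S} (hg : ∀ᶠ s in 𝓝 (0 : ℂ), IsReglued G A W f s (g s)) :
    ∃ D : ℂ →L[ℝ] ℂ, HasFDerivAt (fun s => C.state.corr (g s) 1 ![w] ![ζ] ![φ]) D 0 ∧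
      ∀ s, D s = -(I * s) * contourT C G A Ψ φ w ζ
        + I * (starRingEnd ℂ) s * contourTbar C G A Ψ φ w ζ := by
  obtain ⟨D, hD, hDs⟩ := exists_hasFDerivAt_reglued (C := C) (φ := φ) hG hflat hζ hΨ hA hW hw hg
  refine ⟨D, hD, fun s => ?_⟩
  have hb : ∀ x ∈ tube Ψ, x ≠ w →
      DifferentiableAt ℂ (quadCoord (emHol C G w ζ φ) x) (chartAt ℂ x x) ∧
      DifferentiableAt ℂ (quadCoord (emAnti C G w ζ φ) x) (chartAt ℂ x x) := fun x _ hx =>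
    differentiableAt_quadCoord hG hflat hζ (mem_chart_target ℂ x)
      (by rwa [(chartAt ℂ x).left_inv (mem_chart_source ℂ x)])
  obtain ⟨i1, h1⟩ := integral_wedge hΨ hW hw fun x hx hxw =>
    differentiableAt_formCoord_mul hΨ.isOpen_tube hA.holomorphic hx (hb x hx hxw).1
  obtain ⟨i2, h2⟩ := integral_wedge hΨ hW hw fun x hx hxw =>
    differentiableAt_formCoord_mul hΨ.isOpen_tube hA.holomorphic hx (hb x hx hxw).2
  set b₁ : S → ℂ := fun x => toC (real (A x)) * emHol C G w ζ φ x with hb1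
  set b₂ : S → ℂ := fun x => toC (real (A x)) * emAnti C G w ζ φ x with hb2
  have e : ∀ u ∈ stripDomain, -((jac Ψ u : ℂ)
        * (s * toC (real (A (Ψ u))) * (differential f (Ψ u) 1 + I * differential f (Ψ u) I)
            * emHol C G w ζ φ (Ψ u)
          + (starRingEnd ℂ) (s * toC (real (A (Ψ u)))
            * (differential f (Ψ u) 1 + I * differential f (Ψ u) I) * emAnti C G w ζ φ (Ψ u))))
      = s * I * wedge b₁ f Ψ u + (starRingEnd ℂ) (s * I * wedge b₂ f Ψ u) := by
    intro u hu
    have h3 := jac_mul_differential hΨ hW (stripDomain_subset hu) b₁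
    have h4 := jac_mul_differential hΨ hW (stripDomain_subset hu) b₂
    rw [mul_assoc s I, mul_assoc s I, ← h3, ← h4]
    simp only [hb1, hb2, map_mul, map_neg, conj_ofReal]
    ring
  have i3 : IntegrableOn (fun u => (starRingEnd ℂ) (s * I * wedge b₂ f Ψ u)) stripDomain :=
    conjCLE.toContinuousLinearMap.integrable_comp (i2.const_mul (s * I))
  rw [hDs, setIntegral_congr_fun measurableSet_stripDomain e,
    integral_add (i1.const_mul (s * I)) i3, integral_conj, integral_const_mul, integral_const_mul,
    h1, h2, contourT_eq hΨ hA, contourTbar_eq hΨ hA]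
  simp only [map_mul, map_neg, conj_I]
  ring

end Contour

end CFT

theorem mainTheorem1 {S : Type*} [TopologicalSpace S] [T2Space S] [SecondCountableTopology S]
    [ChartedSpace ℂ S] [IsManifold 𝓘(ℂ, ℂ) ω S] [MeasurableSpace S] [BorelSpace S]
    {F : Type*} [AddCommGroup F] [Module ℂ F] (C : CFT.ConformalFieldTheory S F)
    (G : CFT.Metric S) (hG : CFT.IsCompatible G) (hflat : ∀ x, CFT.scalarCurvature G x = 0)
    (Ψ : ℂ → S) (hΨ : CFT.IsTube Ψ)
    (A : (x : S) → TangentSpace 𝓘(ℂ, ℂ) x)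
    (hA : CFT.IsMetricPreservingField G (CFT.tube Ψ) A)
    (φ : F) (hφ : CFT.IsHolomorphicField C G φ)
    (w : S) (hw : ∀ t : ℝ, w ≠ CFT.core Ψ t)
    (ζ : S → ℂ) (hζ : CFT.IsConformalCoord G ζ w) :
    (∃ (W : Set S) (f : S → ℝ), CFT.IsCutoff Ψ W f ∧ w ∈ W) ∧
    ∀ (W : Set S) (f : S → ℝ), CFT.IsCutoff Ψ W f → w ∈ W →
      (∀ᶠ ε in 𝓝 (0 : ℂ), ∃ G' : CFT.Metric S, CFT.IsReglued G A W f ε G') ∧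
      ∀ g : ℂ → CFT.Metric S, (∀ᶠ ε in 𝓝 (0 : ℂ), CFT.IsReglued G A W f ε (g ε)) →
        ∃ D : ℂ →L[ℝ] ℂ,
          HasFDerivAt (fun ε : ℂ => C.state.corr (g ε) 1 ![w] ![ζ] ![φ]) D 0 ∧
          (D 1 - I * D I) / 2 = -I * CFT.contourT C G A Ψ φ w ζ ∧
          (D 1 + I * D I) / 2 = I * CFT.contourTbar C G A Ψ φ w ζ := by
  refine ⟨CFT.exists_isCutoff hΨ hw, fun W f hW hwW =>
    ⟨CFT.eventually_exists_isReglued hG hΨ hA hW, fun g hg => ?_⟩⟩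
  obtain ⟨D, hD, hDs⟩ := CFT.exists_hasFDerivAt_contour (C := C) (φ := φ) hG hflat hζ hΨ hA hW hwW hg
  refine ⟨D, hD, ?_, ?_⟩ <;> rw [hDs, hDs] <;> simp only [map_one, conj_I, mul_one]
  · linear_combination
      (CFT.contourT C G A Ψ φ w ζ + CFT.contourTbar C G A Ψ φ w ζ) * (I / 2) * I_sq
  · linear_combination
      (CFT.contourT C G A Ψ φ w ζ + CFT.contourTbar C G A Ψ φ w ζ) * (-I / 2) * I_sq
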